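/- Let $v$ be an indeterminate and $n\ge 1$. For $d\ge 0$ let $\Theta_d$ be the set of $n\times n$ matrices over $\mathbb N$ with sum of entries $d$, and let $\mathbf S(n,d)$ be the quantum Schur algebra over $\mathbb Q(v)$: it has basis $e_A$ ($A\in\Theta_d$) and product $e_Ae_B=\sum_C g_{A,B,C}(v^2)e_C$, where $g_{A,B,C}$ is the polynomial such that for every finite field $\mathbb F_q$ and every pair $(f,f'')$ of $n$-step partial flags in $\mathbb F_q^d$ in relative position $C$, $g_{A,B,C}(q)$ is the number of flags $f'$ with $(f,f')$ in relative position $A$ and $(f',f'')$ in relative position $B$. (The relative position of $(V_i)$ and $(V'_j)$ is the matrix with entries $a_{ij}=\dim\,(V_{i-1}+V_i\cap V'_j)/(V_{i-1}+V_i\cap V'_{j-1})$.) Put $[A]=v^{-d_A}e_A$ with $d_A=\sum_{i\ge k,\,j<l}a_{ij}a_{kl}$. Let $\tilde\Theta$ be the set of $n\times n$ integer matrices with nonnegative off-diagonal entries, and let $\dot{\mathbf U}(\mathfrak{gl}_n)$ be the Beilinson--Lusztig--MacPherson algebra over $\mathbb Q(v)$ (isomorphic to the modified quantum $\mathfrak{gl}_n$):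 it has the standard basis $[A]$ ($A\in\tilde\Theta$) and the product $[A]*[B]=\sum_Z G_Z(v,1)[Z]$, where the $G_Z\in\mathbb Q(v)[v']$ (almost all zero) are such that $[A+pI][B+pI]=\sum_Z G_Z(v,v^{-p})[Z+pI]$ for all large integers $p$. The bar involution of $\dot{\mathbf U}(\mathfrak{gl}_n)$ is the ring endomorphism that is semilinear with respect to $v\mapsto v^{-1}$ and fixes the generators $1_\lambda=[\mathrm{diag}(\lambda)]$, $E_h1_\lambda=[\mathrm{diag}(\lambda-\epsilon_{h+1})+E_{h,h+1}]$ and $F_h1_\lambda=[\mathrm{diag}(\lambda-\epsilon_h)+E_{h+1,h}]$, for $\lambda\in\mathbb Z^n$ and $1\le h\le n-1$, where on the right-hand sides $E_{i,j}$ denotes a matrix unit. For $A,B\in\tilde\Theta$ write $B\sqsubset A$ if $B\ne A$, $A$ and $B$ have the same row sums and the same column sums, $\sum_{r\le i,\,s\ge j}b_{rs}\le\sum_{r\le i,\,s\ge j}a_{rs}$ for all $i<j$, and $\sum_{r\ge i,\,s\le j}b_{rs}\le\sum_{r\ge i,\,s\le j}a_{rs}$ for all $i>j$. The BLM (stably canonical)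 basis consists of the elements $\{A\}$, $A\in\tilde\Theta$, where $\{A\}$ is the unique bar-invariant element of $[A]+\sum_{B\sqsubset A}v^{-1}\mathbb Z[v^{-1}]\,[B]$. Then for every $n\ge 2$ the structure constants of $\dot{\mathbf U}(\mathfrak{gl}_n)$ with respect to the BLM basis do not all lie in $\mathbb N[v,v^{-1}]$: there are $A,B\in\tilde\Theta$ such that in the expansion of $\{A\}*\{B\}$ in the BLM basis some coefficient is not in $\mathbb N[v,v^{-1}]$. Explicitly, for $n=2$, $$\left\{\begin{matrix}0&1\\1&-3\end{matrix}\right\}*\left\{\begin{matrix}0&1\\1&-3\end{matrix}\right\}=(v+v^{-1})^2\left\{\begin{matrix}-1&2\\2&-4\end{matrix}\right\}-(2v^{-2}+1+2v^2)\left\{\begin{matrix}0&1\\1&-3\end{matrix}\right\}-(v^{-4}+v^{-2}+2+v^2+v^4)\left\{\begin{matrix}1&0\\0&-2\end{matrix}\right\}.$$ -/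

import Mathlib

namespace BLM

open Polynomial

noncomputable section

/-- The field `ℚ(v)`. -/
abbrev Qv : Type := RatFunc ℚ

/-- The formal parameter `v`. -/
def v : Qv := RatFunc.X

/-! ### Partial flags and the quantum Schur algebras -/

/-- An `n`-step partial flag `0 = V₀ ⊆ V₁ ⊆ ⋯ ⊆ Vₙ = F ^ d`. -/
structure PFlag (n : ℕ) (F : Type) [Field F] (d : ℕ) where
  V : Fin (n + 1) → Submodule F (Fin d → F)
  mono : Monotone V
  bot : V 0 = ⊥
  top : V (Fin.last n) = ⊤

/-- The relative position of two flags: the matrix whose `(i, j)` entry is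
`dim (Vᵢ₋₁ + Vᵢ ∩ V'ⱼ) / (Vᵢ₋₁ + Vᵢ ∩ V'ⱼ₋₁)` (with `i, j = 1, …, n`).  The truncated subtraction
is harmless, because the second space is contained in the first. -/
def relPos {n : ℕ} {F : Type} [Field F] {d : ℕ} (f f' : PFlag n F d) :
    Matrix (Fin n) (Fin n) ℕ := fun i j =>
  Module.finrank F ↥(f.V i.castSucc ⊔ (f.V i.succ ⊓ f'.V j.succ)) -
    Module.finrank F ↥(f.V i.castSucc ⊔ (f.V i.succ ⊓ f'.V j.castSucc))

/-- `|A|`, the sum of all entries. -/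
def size {n : ℕ} (A : Matrix (Fin n) (Fin n) ℕ) : ℕ := ∑ i, ∑ j, A i j

/-- The finite set `Θ_d` of `n × n` matrices over `ℕ` with sum of entries `d`. -/
def thetaSet (n d : ℕ) : Finset (Matrix (Fin n) (Fin n) ℕ) :=
  (Fintype.piFinset fun _ : Fin n => Fintype.piFinset fun _ : Fin n => Finset.range (d + 1)).filter
    fun A => size A = d

/-- `g` is the structure polynomial of the convolution product of pairs of flags: for each finite
field with `q` elements, and each pair `(f, f'')` in relative position `C`, the number of `f'` such
that `(f, f')` has position `A` and `(f', f'')` has position `B` is `g(q)`. -/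
def IsStructurePoly {n : ℕ} (A B C : Matrix (Fin n) (Fin n) ℕ) (g : ℤ[X]) : Prop :=
  ∀ (F : Type) [Field F] [Fintype F] (f f'' : PFlag n F (size C)), relPos f f'' = C →
    (({f' : PFlag n F (size C) | relPos f f' = A ∧ relPos f' f'' = B}.ncard : ℕ) : ℤ) =
      g.eval (Fintype.card F : ℤ)

open Classical in
/-- The polynomial `g_{A,B,C}` (it is unique, since there are infinitely many prime powers). -/
def structurePoly {n : ℕ} (A B C : Matrix (Fin n) (Fin n) ℕ) : ℤ[X] :=
  if h : ∃ g, IsStructurePoly A B C g then h.choose else 0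

/-- `d_A = ∑_{i ≥ k, j < l} a_{ij} a_{kl}`, so that `[A] = v ^ (-d_A) e_A`. -/
def dimA {n : ℕ} (A : Matrix (Fin n) (Fin n) ℕ) : ℕ :=
  ∑ i, ∑ j, ∑ k, ∑ l, if k ≤ i ∧ j < l then A i j * A k l else 0

/-- The product `[A] [B]` of standard basis elements in `⨁_d S(n, d)`, with coordinates in the
standard basis.  As `e_A e_B = ∑_C g_{A,B,C}(v²) e_C` and `[A] = v ^ (-d_A) e_A`, the coefficient
at `[C]` is `v ^ (d_C - d_A - d_B) g_{A,B,C}(v²)`. -/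
def schurMul {n : ℕ} (A B : Matrix (Fin n) (Fin n) ℕ) : Matrix (Fin n) (Fin n) ℕ →₀ Qv :=
  ∑ C ∈ thetaSet n (size A),
    Finsupp.single C
      (v ^ ((dimA C : ℤ) - (dimA A : ℤ) - (dimA B : ℤ)) * aeval (v ^ 2) (structurePoly A B C))

/-! ### Stabilization: the algebra `K`, identified with modified quantum `gl_n` -/

/-- The set `Θ̃` of integer matrices with nonnegative off-diagonal entries. -/
def Theta (n : ℕ) : Type := {A : Matrix (Fin n) (Fin n) ℤ // ∀ i j, i ≠ j → 0 ≤ A i j}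

/-- The matrix `A + p I`, as a matrix over `ℕ`; only used for large `p`, where no entry is
truncated. -/
def shift {n : ℕ} (p : ℕ) (A : Theta n) : Matrix (Fin n) (Fin n) ℕ := fun i j =>
  (A.1 i j + if i = j then (p : ℤ) else 0).toNat

/-- `G` (a finite family of elements `G_Z(v, v')` of `ℚ(v)[v']`) describes the stable product of
`A` and `B`: one has `[A + pI] [B + pI] = ∑_Z G_Z(v, v ^ (-p)) [Z + pI]` for all large `p`. -/
def IsStableProduct {n : ℕ} (A B : Theta n) (G : Theta n →₀ Qv[X]) : Prop :=
  ∀ᶠ p : ℕ in Filter.atTop,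
    schurMul (shift p A) (shift p B) =
      G.sum fun Z P => Finsupp.single (shift p Z) (P.eval ((v⁻¹) ^ p))

/-- The algebra `U̇(gl_n) = ℚ(v) ⊗ K`: the `ℚ(v)`-vector space with standard basis `[A]`, `A ∈ Θ̃`;
the product is given below. -/
def Udot (n : ℕ) : Type := Theta n →₀ Qv

instance (n : ℕ) : AddCommGroup (Udot n) := inferInstanceAs (AddCommGroup (Theta n →₀ Qv))

instance (n : ℕ) : Module Qv (Udot n) := inferInstanceAs (Module Qv (Theta n →₀ Qv))

/-- The coefficient of `x` at the standard basis element `[A]`. -/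
def Udot.coeff {n : ℕ} (x : Udot n) (A : Theta n) : Qv := (show Theta n →₀ Qv from x) A

/-- The standard basis element `[A]`. -/
def std {n : ℕ} (A : Theta n) : Udot n := (Finsupp.single A 1 : Theta n →₀ Qv)

open Classical in
/-- The product `[A] * [B] = ∑_Z G_Z(v, 1) [Z]`, where the `G_Z` describe the stable product (they
are unique, as the `v ^ (-p)` are pairwise different). -/
def stdMul {n : ℕ} (A B : Theta n) : Udot n :=
  if h : ∃ G, IsStableProduct A B G then h.choose.sum fun Z P => P.eval 1 • std Z else 0

/-- The bilinear extension of the product of standard basis elements. -/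
instance (n : ℕ) : Mul (Udot n) where
  mul x y :=
    (show Theta n →₀ Qv from x).sum fun A a =>
      (show Theta n →₀ Qv from y).sum fun B b => (a * b) • stdMul A B

/-! ### The bar involution -/

theorem aeval_inv_X_injective (k : Type) [Field k] :
    Function.Injective (aeval (R := k) ((RatFunc.X : RatFunc k)⁻¹)) := by
  have h : Transcendental k ((RatFunc.X : RatFunc k)⁻¹) := by
    intro h
    have h2 : IsAlgebraic k (RatFunc.X : RatFunc k) := by simpa using h.inv
    exact RatFunc.transcendental_X h2
  exact transcendental_iff_injective.1 h

/-- The field homomorphism `k(v) → k(v)` over `k` with `v ↦ v⁻¹`. -/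
def barHom (k : Type) [Field k] : RatFunc k →+* RatFunc k :=
  RatFunc.liftRingHom
    ((aeval (R := k) ((RatFunc.X : RatFunc k)⁻¹) : k[X] →ₐ[k] RatFunc k) : k[X] →+* RatFunc k)
    (nonZeroDivisors_le_comap_nonZeroDivisors_of_injective _ (aeval_inv_X_injective k))

/-- The field homomorphism `ℚ(v) → ℚ(v)` with `v ↦ v⁻¹`. -/
def barQv : Qv →+* Qv := barHom ℚ

/-- The diagonal matrix with diagonal `l`; `[diag l]` is the idempotent `1_l`. -/
def diagTheta {n : ℕ} (l : Fin n → ℤ) : Theta n :=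
  ⟨Matrix.diagonal l, fun i j h => by simp [Matrix.diagonal_apply_ne _ h]⟩

/-- The matrix with `(i, j)` entry `1` and diagonal `l - ε_j` (for `i ≠ j`), other entries `0`.
For `(i, j) = (h, h + 1)` this is `E_{h,h+1}(l)`, for `(i, j) = (h + 1, h)` it is `E_{h+1,h}(l)`;
the corresponding basis elements are the Chevalley generators `E_h 1_l` and `F_h 1_l`. -/
def chevTheta {n : ℕ} (i j : Fin n) (l : Fin n → ℤ) : Theta n :=
  ⟨Matrix.diagonal (l - Pi.single j 1) + Matrix.single i j 1, fun r s h => by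
    simp only [Matrix.add_apply, Matrix.diagonal_apply_ne _ h, Matrix.single_apply]
    split_ifs <;> simp⟩

/-- The graph of the bar involution of `U̇(gl_n)`: `IsBar x y` says that `y` is the bar image of
`x`.  The bar involution is the ring endomorphism that is semilinear for `v ↦ v⁻¹` and fixes the
generators `1_l`, `E_h 1_l` and `F_h 1_l`; as these generate the `ℚ(v)`-algebra, its graph consists
of the pairs obtained by the following rules. -/
inductive IsBar {n : ℕ} : Udot n → Udot n → Prop
  | idem (l : Fin n → ℤ) : IsBar (std (diagTheta l)) (std (diagTheta l))
  | add {x x' y y' : Udot n} : IsBar x x' → IsBar y y' → IsBar (x + y) (x' + y')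
  | smul (c : Qv) {x x' : Udot n} : IsBar x x' → IsBar (c • x) (barQv c • x')
  | gen_mul (i j : Fin n) (hij : (i : ℕ) + 1 = j ∨ (j : ℕ) + 1 = i) (l : Fin n → ℤ)
      {x x' : Udot n} : IsBar x x' →
      IsBar (std (chevTheta i j l) * x) (std (chevTheta i j l) * x')

/-! ### The BLM (stably canonical) basis -/

/-- The partial order `B ⊑ A` on `Θ̃`: equal row sums, equal column sums, and all sums of entries
over the north-east and south-west corner regions off the diagonal are at most those of `A`. -/
def Below {n : ℕ} (B A : Theta n) : Prop :=
  (∀ i, ∑ j, B.1 i j = ∑ j, A.1 i j) ∧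
  (∀ j, ∑ i, B.1 i j = ∑ i, A.1 i j) ∧
  (∀ i j, i < j →
    ∑ r ∈ Finset.Iic i, ∑ s ∈ Finset.Ici j, B.1 r s ≤
      ∑ r ∈ Finset.Iic i, ∑ s ∈ Finset.Ici j, A.1 r s) ∧
  (∀ i j, j < i →
    ∑ r ∈ Finset.Ici i, ∑ s ∈ Finset.Iic j, B.1 r s ≤
      ∑ r ∈ Finset.Ici i, ∑ s ∈ Finset.Iic j, A.1 r s)

/-- The defining property of the BLM basis element `{A}`: it is bar-invariant and lies in
`[A] + ∑_{B ⊏ A} v⁻¹ ℤ[v⁻¹] [B]`. -/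
def IsBLM {n : ℕ} (A : Theta n) (x : Udot n) : Prop :=
  IsBar x x ∧ x.coeff A = 1 ∧
    ∀ B, B ≠ A → (∃ y ∈ Subring.closure {v⁻¹}, x.coeff B = v⁻¹ * y) ∧
      (x.coeff B ≠ 0 → Below B A)

open Classical in
/-- The BLM basis element `{A}`. -/
def blm {n : ℕ} (A : Theta n) : Udot n :=
  if h : ∃! x, IsBLM A x then h.choose else 0

/-- `ℕ[v, v⁻¹]` inside `ℚ(v)`. -/
def NLaurent : Subsemiring Qv := Subsemiring.closure {v, v⁻¹}

/-- The `2 × 2` matrix with rows `(a, b)` and `(c, d)`, as an element of `Θ̃`. -/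
def theta2 (a : ℤ) (b c : ℕ) (d : ℤ) : Theta 2 :=
  ⟨!![a, (b : ℤ); (c : ℤ), d], fun i j h => by fin_cases i <;> fin_cases j <;> simp at h ⊢⟩

end

end BLM

namespace BLM

open Polynomial

noncomputable section

/-! ### Rank matrices of pairs of flags -/

section Rank

variable {n d : ℕ} {F : Type} [Field F]

/-! The negative sign comes from quantum integers at negative arguments. Counting flags shows that a
Chevalley generator acts on `[B]` by moving one unit within a column; the entry `m` that receives
the unit contributes a power of `v` times the quantum integer `[m]` (`schur_chevNat`). Under
diagonal shifts this coefficient is a polynomial in `v'` (`eval_chevPoly`), and in the stable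
algebra a diagonal entry `m` may be negative. For `l = -ε_2` one finds that `F_1` times `E_1 1_l` is
`[Z] - 1_l`, because `[-1] = -1`. All four standard elements occurring here are their own BLM
elements, and `-1` is not in `ℕ[v, v⁻¹]` (`exists_blm_mul`, `neg_one_notMem_NLaurent`).

The bar involution enters only as the inductively generated relation `IsBar`; that it is a function
is never shown. Uniqueness of `{A}` is needed for a few `A` only. The difference of two candidates
is supported on a chain of matrices below `A` (`Below.exists_shear`), where the relation acts on
coefficients by `v ↦ v⁻¹`, up to a correction from one matrix higher in the chain
(`IsBar.coeff_of_col`, `IsBar.coeff_col`). A bar-fixed coefficient in `v⁻¹ℤ[v⁻¹]` is zero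
(`eq_zero_of_bar`).

For the explicit formula let `A = [[0, 1], [1, -3]]` and `λ = (1, -2)`. Then `{A} = F E 1_λ + 1_λ =
[A] - v⁻² 1_λ`, and expanding `F E {A}` shows that the standard element of `[[-1, 2], [2, -4]]` is
bar-invariant. No factor of `[A] * [A]` is a generator, so this product is computed in the Schur
algebras. There convolution is multiplication of the indicator matrices of positions, hence
associative, and the shifted `A` can be replaced by `F E` minus a multiple of an idempotent
(`posMat_sq`). -/

theorem PFlag.ext' {f g : PFlag n F d} (h : ∀ t, f.V t = g.V t) : f = g := by
  cases f; cases g; congr; exact funext h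

/-- The dimension of `Vᵢ ∩ V'ⱼ`. -/
def rk (f f' : PFlag n F d) (i j : Fin (n + 1)) : ℕ := Module.finrank F ↥(f.V i ⊓ f'.V j)

theorem finrank_sup_add_rk (f f' : PFlag n F d) (i : Fin n) (t : Fin (n + 1)) :
    Module.finrank F ↥(f.V i.castSucc ⊔ (f.V i.succ ⊓ f'.V t)) + rk f f' i.castSucc t =
      Module.finrank F (f.V i.castSucc) + rk f f' i.succ t := by
  have h := Submodule.finrank_sup_add_finrank_inf_eq (f.V i.castSucc) (f.V i.succ ⊓ f'.V t)
  rwa [← inf_assoc, inf_eq_left.2 (f.mono (Fin.castSucc_le_succ i))] at h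

/-- The position is the mixed second difference of the rank matrix. Later arguments about positions
go through ranks, where no subtraction is truncated and linear arithmetic applies. -/
theorem relPos_cast (f f' : PFlag n F d) (i j : Fin n) :
    (relPos f f' i j : ℤ) = (rk f f' i.succ j.succ - rk f f' i.castSucc j.succ) -
      (rk f f' i.succ j.castSucc - rk f f' i.castSucc j.castSucc) := by
  have h1 := finrank_sup_add_rk f f' i j.succ
  have h2 := finrank_sup_add_rk f f' i j.castSucc
  have h3 : Module.finrank F ↥(f.V i.castSucc ⊔ (f.V i.succ ⊓ f'.V j.castSucc)) ≤
      Module.finrank F ↥(f.V i.castSucc ⊔ (f.V i.succ ⊓ f'.V j.succ)) :=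
    Submodule.finrank_mono (sup_le_sup_left (inf_le_inf_left _
      (f'.mono (Fin.castSucc_le_succ j))) _)
  unfold relPos
  omega

theorem rk_zero_left (f f' : PFlag n F d) (j : Fin (n + 1)) : rk f f' 0 j = 0 := by
  simp [rk, f.bot]

theorem rk_zero_right (f f' : PFlag n F d) (j : Fin (n + 1)) : rk f f' j 0 = 0 := by
  simp [rk, f'.bot]

theorem rk_last_left (f f' : PFlag n F d) (j : Fin (n + 1)) :
    rk f f' (Fin.last n) j = Module.finrank F (f'.V j) := by
  rw [rk, f.top, top_inf_eq]

theorem rk_last_right (f f' : PFlag n F d) (j : Fin (n + 1)) :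
    rk f f' j (Fin.last n) = Module.finrank F (f.V j) := by
  rw [rk, f'.top, inf_top_eq]

/-- The sum of the entries of `M` in the rows before `i` and the columns before `j`. -/
def cum (M : Matrix (Fin n) (Fin n) ℕ) (i j : Fin (n + 1)) : ℕ :=
  ∑ a, ∑ b, if a.castSucc < i ∧ b.castSucc < j then M a b else 0

theorem eq_sum_diff (g : Fin (n + 1) → ℤ) (h0 : g 0 = 0) (j : Fin (n + 1)) :
    g j = ∑ b : Fin n, if b.castSucc < j then g b.succ - g b.castSucc else 0 := by
  induction j using Fin.induction with
  | zero => simp [h0]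
  | succ j ih =>
    have h : ∀ b : Fin n, (if b.castSucc < j.succ then g b.succ - g b.castSucc else 0) =
        (if b.castSucc < j.castSucc then g b.succ - g b.castSucc else 0) +
          if b = j then g b.succ - g b.castSucc else 0 := by
      intro b
      rcases lt_trichotomy b j with hb | hb | hb
      · rw [if_pos (Fin.castSucc_lt_succ_iff.2 hb.le), if_pos (Fin.castSucc_lt_castSucc_iff.2 hb),
          if_neg hb.ne, add_zero]
      · subst hb; simp
      · rw [if_neg (by simpa [Fin.castSucc_lt_succ_iff] using hb),
          if_neg (by simpa using hb.le), if_neg hb.ne', add_zero]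
    rw [Finset.sum_congr rfl fun b _ => h b, Finset.sum_add_distrib, ← ih]
    simp

/-- Inverts `relPos_cast`: ranks vanish in row and column `0`, so summing the second differences
twice recovers them. A position therefore determines all the dimensions. -/
theorem rk_eq_cum (f f' : PFlag n F d) (i j : Fin (n + 1)) :
    rk f f' i j = cum (relPos f f') i j := by
  have h1 := eq_sum_diff (fun t => (rk f f' t j : ℤ)) (by simp [rk_zero_left]) i
  have h2 : ∀ a : Fin n, (rk f f' a.succ j : ℤ) - rk f f' a.castSucc j =
      ∑ b : Fin n, if b.castSucc < j then (relPos f f' a b : ℤ) else 0 := by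
    intro a
    rw [eq_sum_diff (fun t => (rk f f' a.succ t : ℤ) - rk f f' a.castSucc t)
      (by simp [rk_zero_right]) j]
    simp_rw [relPos_cast]
  have h3 : (rk f f' i j : ℤ) = cum (relPos f f') i j := by
    rw [h1]
    unfold cum
    push_cast
    refine Finset.sum_congr rfl fun a _ => ?_
    by_cases ha : a.castSucc < i
    · simp only [ha, if_true, true_and]
      exact h2 a
    · simp [ha]
  exact_mod_cast h3

theorem finrank_left (f f' : PFlag n F d) (i : Fin (n + 1)) :
    Module.finrank F (f.V i) = cum (relPos f f') i (Fin.last n) := by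
  rw [← rk_eq_cum, rk_last_right]

theorem finrank_right (f f' : PFlag n F d) (i : Fin (n + 1)) :
    Module.finrank F (f'.V i) = cum (relPos f f') (Fin.last n) i := by
  rw [← rk_eq_cum, rk_last_left]

theorem size_relPos (f f' : PFlag n F d) : size (relPos f f') = d := by
  have h := finrank_left f f' (Fin.last n)
  rw [f.top, finrank_top, Module.finrank_fin_fun] at h
  refine Eq.trans ?_ h.symm
  simp [size, cum, Fin.castSucc_lt_last]

theorem sum_row_relPos (f f' : PFlag n F d) (i : Fin n) :
    (∑ b, relPos f f' i b) + Module.finrank F (f.V i.castSucc) = Module.finrank F (f.V i.succ) := by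
  have h := eq_sum_diff (fun t => (rk f f' i.succ t : ℤ) - rk f f' i.castSucc t)
    (by simp [rk_zero_right]) (Fin.last n)
  simp only [Fin.castSucc_lt_last, if_true] at h
  have h2 : ∀ b, (rk f f' i.succ b.succ : ℤ) - rk f f' i.castSucc b.succ -
      (rk f f' i.succ b.castSucc - rk f f' i.castSucc b.castSucc) = relPos f f' i b :=
    fun b => (relPos_cast f f' i b).symm
  simp only [h2, rk_last_right] at h
  have : ((∑ b, relPos f f' i b : ℕ) : ℤ) = ∑ b, (relPos f f' i b : ℤ) := by push_cast; rfl
  omega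

theorem sum_col_relPos (f f' : PFlag n F d) (j : Fin n) :
    (∑ a, relPos f f' a j) + Module.finrank F (f'.V j.castSucc) =
      Module.finrank F (f'.V j.succ) := by
  have h := eq_sum_diff (fun t => (rk f f' t j.succ : ℤ) - rk f f' t j.castSucc)
    (by simp [rk_zero_left]) (Fin.last n)
  simp only [Fin.castSucc_lt_last, if_true] at h
  have h2 : ∀ a, (rk f f' a.succ j.succ : ℤ) - rk f f' a.succ j.castSucc -
      (rk f f' a.castSucc j.succ - rk f f' a.castSucc j.castSucc) = relPos f f' a j :=
    fun a => by rw [relPos_cast]; ring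
  simp only [h2, rk_last_left] at h
  have : ((∑ a, relPos f f' a j : ℕ) : ℤ) = ∑ a, (relPos f f' a j : ℤ) := by push_cast; rfl
  omega

/-- The position already forces the dimension (`size_relPos`). Quantifying over `d` avoids
transporting flags along `size C = d`. -/
theorem isStructurePoly_iff {A B C : Matrix (Fin n) (Fin n) ℕ} {g : ℤ[X]} :
    IsStructurePoly A B C g ↔ ∀ (F : Type) [Field F] [Fintype F] (d : ℕ) (f f'' : PFlag n F d),
      relPos f f'' = C →
        (({f' : PFlag n F d | relPos f f' = A ∧ relPos f' f'' = B}.ncard : ℕ) : ℤ) =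
          g.eval (Fintype.card F : ℤ) := by
  constructor
  · intro h F _ _ d f f'' hC
    obtain rfl : size C = d := by rw [← hC, size_relPos]
    exact h F f f'' hC
  · intro h F _ _ f f'' hC
    exact h F _ f f'' hC

/-! ### Existence of flags in every relative position -/

/-- The subspace of vectors with support in `S`. -/
def coordSub (F : Type) [Field F] (S : Set (Fin d)) : Submodule F (Fin d → F) :=
  ⨅ i ∈ Sᶜ, LinearMap.ker (LinearMap.proj i : (Fin d → F) →ₗ[F] F)

theorem mem_coordSub {S : Set (Fin d)} {x : Fin d → F} :
    x ∈ coordSub F S ↔ ∀ i, i ∉ S → x i = 0 := by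
  simp [coordSub, Submodule.mem_iInf]

theorem finrank_coordSub (S : Set (Fin d)) : Module.finrank F (coordSub F S) = S.ncard := by
  classical
  rw [coordSub, (LinearMap.iInfKerProjEquiv F (fun _ : Fin d => F) (I := S) (J := Sᶜ) disjoint_compl_right
    (by simp)).finrank_eq, Module.finrank_pi, Fintype.card_eq_nat_card, Set.ncard_def,
    Nat.card_coe_set_eq, Set.ncard_def]

theorem coordSub_inf (S T : Set (Fin d)) : coordSub F S ⊓ coordSub F T = coordSub F (S ∩ T) := by
  ext x
  simp only [Submodule.mem_inf, mem_coordSub, Set.mem_inter_iff]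
  constructor
  · rintro ⟨h1, h2⟩ i hi
    by_cases h : i ∈ S
    · exact h2 i fun h' => hi ⟨h, h'⟩
    · exact h1 i h
  · exact fun h => ⟨fun i hi => h i fun h' => hi h'.1, fun i hi => h i fun h' => hi h'.2⟩

/-- The coordinate flag given by a function from the coordinates to the steps. -/
def coordFlag (F : Type) [Field F] (c : Fin d → Fin n) : PFlag n F d where
  V t := coordSub F {u | (c u).castSucc < t}
  mono s t hst x hx := mem_coordSub.2 fun i hi =>
    mem_coordSub.1 hx i fun h => hi (lt_of_lt_of_le h hst)
  bot := by
    refine (Submodule.eq_bot_iff _).2 fun x hx => funext fun i => mem_coordSub.1 hx i ?_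
    simp
  top := by
    refine Submodule.eq_top_iff'.2 fun x => mem_coordSub.2 fun i hi => absurd ?_ hi
    simp [Fin.castSucc_lt_last]

theorem relPos_coordFlag (c c' : Fin d → Fin n) (i j : Fin n) :
    relPos (coordFlag F c) (coordFlag F c') i j = {u | c u = i ∧ c' u = j}.ncard := by
  have h : ∀ s t, rk (coordFlag F c) (coordFlag F c') s t =
      (∑ u : Fin d, if (c u).castSucc < s ∧ (c' u).castSucc < t then 1 else 0 : ℕ) := by
    intro s t
    rw [rk, coordFlag, coordFlag, coordSub_inf, finrank_coordSub, Finset.sum_boole,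
      Set.ncard_eq_toFinset_card']
    simp [Finset.filter_and]
  have h3 : ((relPos (coordFlag F c) (coordFlag F c') i j : ℕ) : ℤ) =
      ({u | c u = i ∧ c' u = j}.ncard : ℕ) := by
    rw [relPos_cast, h, h, h, h, Set.ncard_eq_toFinset_card']
    simp only [Set.toFinset_ofPred, Finset.card_filter]
    push_cast
    rw [← Finset.sum_sub_distrib, ← Finset.sum_sub_distrib, ← Finset.sum_sub_distrib]
    refine Finset.sum_congr rfl fun u _ => ?_
    simp only [Fin.lt_def, Fin.ext_iff, Fin.val_castSucc, Fin.val_succ]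
    split_ifs <;> omega
  exact_mod_cast h3

/-- One coordinate vector is taken for each unit of each entry of `C`. Without such pairs the
condition defining the structure polynomial would be vacuous and its uniqueness would fail. -/
theorem exists_relPos (F : Type) [Field F] (C : Matrix (Fin n) (Fin n) ℕ) :
    ∃ (d : ℕ) (f f' : PFlag n F d), relPos f f' = C := by
  let e := Fintype.equivFin (Σ ab : Fin n × Fin n, Fin (C ab.1 ab.2))
  refine ⟨_, coordFlag F fun u => (e.symm u).1.1, coordFlag F fun u => (e.symm u).1.2, ?_⟩
  ext i j
  rw [relPos_coordFlag, ← Set.ncard_image_of_injective _ e.symm.injective]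
  have : e.symm '' {u | (e.symm u).1.1 = i ∧ (e.symm u).1.2 = j} =
      Set.range (fun t : Fin (C i j) => (⟨(i, j), t⟩ : Σ ab : Fin n × Fin n, Fin (C ab.1 ab.2))) := by
    ext ⟨⟨a, b⟩, t⟩
    simp only [Set.mem_image, Set.mem_ofPred_eq, Set.mem_range]
    constructor
    · rintro ⟨u, ⟨h1, h2⟩, h3⟩
      rw [h3] at h1 h2
      obtain rfl := h1
      obtain rfl := h2
      exact ⟨t, rfl⟩
    · rintro ⟨t', h⟩
      obtain ⟨h1, h2⟩ := Sigma.mk.inj h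
      obtain ⟨rfl, rfl⟩ := Prod.mk.inj h1
      exact ⟨e ⟨(i, j), t⟩, by simp, by simp⟩
  rw [this, Set.ncard_def, Set.encard,
    ENat.card_congr (Equiv.ofInjective _ (fun a b h => by simpa using h)).symm]
  simp

/-- The prime fields alone fix the value of the polynomial at every prime, since position `C` occurs
over each of them. This removes the choice from `structurePoly`. -/
theorem IsStructurePoly.structurePoly_eq {A B C : Matrix (Fin n) (Fin n) ℕ} {g : ℤ[X]}
    (h : IsStructurePoly A B C g) : structurePoly A B C = g := by
  have hex : ∃ g, IsStructurePoly A B C g := ⟨g, h⟩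
  have h' : IsStructurePoly A B C (structurePoly A B C) := by
    rw [structurePoly, dif_pos hex]
    exact hex.choose_spec
  rw [isStructurePoly_iff] at h h'
  refine Polynomial.eq_of_infinite_eval_eq _ _ ?_
  refine (Set.infinite_of_injective_forall_mem (f := fun p : Nat.Primes => ((p : ℕ) : ℤ))
    (fun p q hpq => Subtype.ext (by simpa using hpq)) ?_)
  rintro ⟨p, hp⟩
  have : Fact p.Prime := ⟨hp⟩
  obtain ⟨d, f, f', hC⟩ := exists_relPos (ZMod p) C
  have h1 := h (ZMod p) d f f' hC
  have h2 := h' (ZMod p) d f f' hC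
  rw [ZMod.card] at h1 h2
  exact h2.symm.trans h1

end Rank

/-! ### Counting intermediate subspaces -/

section Count

variable {F : Type} [Field F]

/-- Each vector `x` of `Q` outside `P` gives the cover `P + ⟨x⟩`, and each cover arises from
`q^(r+1) - q^r` vectors, where `r = dim P`. Dividing `q^(r+m) - q^r` by this number leaves the
geometric sum. -/
theorem ncard_covers [Fintype F] {V : Type} [AddCommGroup V] [Module F V] [Finite V]
    (P Q : Submodule F V) (hPQ : P ≤ Q) (m : ℕ)
    (hm : Module.finrank F Q = Module.finrank F P + m) :
    {W : Submodule F V | P ≤ W ∧ W ≤ Q ∧ Module.finrank F W = Module.finrank F P + 1}.ncard =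
      ∑ t ∈ Finset.range m, Fintype.card F ^ t := by
  classical
  have := Fintype.ofFinite V
  have := Fintype.ofFinite (Submodule F V)
  have hcard : ∀ W : Submodule F V, P ≤ W →
      (Finset.univ.filter fun x : V => x ∈ W ∧ x ∉ P).card =
        Fintype.card F ^ Module.finrank F W - Fintype.card F ^ Module.finrank F P := by
    intro W hW
    have h1 : ∀ U : Submodule F V, (Finset.univ.filter fun x : V => x ∈ U).card =
        Fintype.card F ^ Module.finrank F U := by
      intro U
      rw [← Fintype.card_subtype, Fintype.card_eq_nat_card, Fintype.card_eq_nat_card]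
      exact Module.natCard_eq_pow_finrank
    rw [← h1, ← h1, ← Finset.card_sdiff_of_subset]
    · congr 1
      ext x
      simp
    · intro x hx
      simp only [Finset.mem_filter_univ] at hx ⊢
      exact hW hx
  set N := Finset.univ.filter fun W : Submodule F V =>
    P ≤ W ∧ W ≤ Q ∧ Module.finrank F W = Module.finrank F P + 1 with hN
  have hmaps : ∀ x ∈ (Finset.univ.filter fun x : V => x ∈ Q ∧ x ∉ P),
      P ⊔ Submodule.span F {x} ∈ N := by
    intro x hx
    simp only [Finset.mem_filter_univ] at hx
    simp only [hN, Finset.mem_filter_univ]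
    refine ⟨le_sup_left, sup_le hPQ (by simpa using hx.1), ?_⟩
    have h := Submodule.finrank_sup_add_finrank_inf_eq P (Submodule.span F {x})
    have hx0 : x ≠ 0 := fun h => hx.2 (h ▸ P.zero_mem)
    have hinf : P ⊓ Submodule.span F {x} = ⊥ := by
      rw [Submodule.eq_bot_iff]
      rintro y ⟨hy, hy'⟩
      obtain ⟨c, rfl⟩ := Submodule.mem_span_singleton.1 hy'
      by_contra hne
      have hc : c ≠ 0 := fun h => hne (by simp [h])
      exact hx.2 ((Submodule.smul_mem_iff P hc).1 hy)
    rwa [hinf, finrank_bot, add_zero, finrank_span_singleton hx0] at h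
  have hfib := Finset.card_eq_sum_card_fiberwise hmaps
  have hfib' : ∀ W ∈ N, (Finset.filter (fun x => P ⊔ Submodule.span F {x} = W)
      (Finset.univ.filter fun x : V => x ∈ Q ∧ x ∉ P)).card =
        Fintype.card F ^ (Module.finrank F P + 1) - Fintype.card F ^ Module.finrank F P := by
    intro W hW
    have hW' := hW
    simp only [hN, Finset.mem_filter_univ] at hW
    rw [← hW.2.2, ← hcard W hW.1]
    congr 1
    ext x
    simp only [Finset.mem_filter, Finset.mem_univ, true_and]
    constructor
    · rintro ⟨⟨_, h2⟩, h3⟩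
      refine ⟨?_, h2⟩
      rw [← h3]
      exact (le_sup_right : _ ≤ P ⊔ Submodule.span F {x}) (Submodule.mem_span_singleton_self x)
    · rintro ⟨h1, h2⟩
      refine ⟨⟨hW.2.1 h1, h2⟩, ?_⟩
      have h3 := hmaps x (by simp [hW.2.1 h1, h2])
      simp only [hN, Finset.mem_filter_univ] at h3
      refine Submodule.eq_of_le_of_finrank_eq (sup_le hW.1 (by simpa using h1)) ?_
      rw [h3.2.2, hW.2.2]
  rw [Finset.sum_congr rfl hfib', hcard Q hPQ, Finset.sum_const, smul_eq_mul, hm] at hfib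
  have hq : 1 < Fintype.card F := Fintype.one_lt_card
  have hgeom := Nat.geomSum_eq hq m
  have hset : {W : Submodule F V |
      P ≤ W ∧ W ≤ Q ∧ Module.finrank F W = Module.finrank F P + 1}.ncard = N.card := by
    rw [Set.ncard_eq_toFinset_card']
    congr 1
    ext W
    simp [hN]
  rw [hset, hgeom]
  set q := Fintype.card F
  have hq0 : 0 < q ^ Module.finrank F P := pow_pos (by omega) _
  have e1 : q ^ (Module.finrank F P + m) - q ^ Module.finrank F P =
      q ^ Module.finrank F P * (q ^ m - 1) := by rw [pow_add, Nat.mul_sub, mul_one]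
  have e2 : q ^ (Module.finrank F P + 1) - q ^ Module.finrank F P =
      q ^ Module.finrank F P * (q - 1) := by rw [pow_add, Nat.mul_sub, mul_one, pow_one]
  rw [e1, e2, mul_left_comm] at hfib
  have h3 := Nat.eq_of_mul_eq_mul_left hq0 hfib
  rw [h3, Nat.mul_div_cancel _ (by omega)]

variable {n d : ℕ}

theorem finrank_step (f f'' : PFlag n F d) (i p : Fin n) :
    Module.finrank F ↥(f.V i.castSucc ⊔ (f.V i.succ ⊓ f''.V p.castSucc)) =
      Module.finrank F (f.V i.castSucc) + ∑ b ∈ Finset.Iio p, relPos f f'' i b := by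
  have h := eq_sum_diff (fun t => (rk f f'' i.succ t : ℤ) - rk f f'' i.castSucc t)
    (by simp [rk_zero_right]) p.castSucc
  have h1 := finrank_sup_add_rk f f'' i p.castSucc
  simp only [← relPos_cast, Fin.castSucc_lt_castSucc_iff] at h
  rw [← Finset.sum_filter, show Finset.univ.filter (· < p) = Finset.Iio p by ext; simp] at h
  have h3 : ((∑ b ∈ Finset.Iio p, relPos f f'' i b : ℕ) : ℤ) =
    ∑ b ∈ Finset.Iio p, (relPos f f'' i b : ℤ) := by push_cast; rfl
  omega

theorem finrank_step_succ (f f'' : PFlag n F d) (i p : Fin n) :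
    Module.finrank F ↥(f.V i.castSucc ⊔ (f.V i.succ ⊓ f''.V p.succ)) =
      Module.finrank F (f.V i.castSucc) +
        (∑ b ∈ Finset.Iio p, relPos f f'' i b + relPos f f'' i p) := by
  have h1 := finrank_sup_add_rk f f'' i p.castSucc
  have h2 := finrank_sup_add_rk f f'' i p.succ
  have h3 := relPos_cast f f'' i p
  have h4 := finrank_step f f'' i p
  omega

/-- The subspaces covering the step before `i` of `f`, inside the step after `i`, whose
intersection with the flag `f''` leaves that step of `f` at `p`. -/
def coverSet (f f'' : PFlag n F d) (i p : Fin n) : Set (Submodule F (Fin d → F)) :=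
  {W | f.V i.castSucc ≤ W ∧ W ≤ f.V i.succ ∧
    Module.finrank F W = Module.finrank F (f.V i.castSucc) + 1 ∧
    W ⊓ f''.V p.castSucc ≤ f.V i.castSucc ∧ ¬ W ⊓ f''.V p.succ ≤ f.V i.castSucc}

/-- As `P` has codimension one in `W`, the intersection `W ⊓ T` leaves `P` exactly when `P` and `W ⊓
T` together span `W`. The converse direction is the modular law. -/
theorem not_inf_le_iff {V : Type} [AddCommGroup V] [Module F V] [FiniteDimensional F V]
    {P Q W T : Submodule F V} (hP : P ≤ W) (hQ : W ≤ Q)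
    (hW : Module.finrank F W = Module.finrank F P + 1) :
    ¬ W ⊓ T ≤ P ↔ W ≤ P ⊔ (Q ⊓ T) := by
  constructor
  · intro h
    have h1 : P < P ⊔ (W ⊓ T) := lt_of_le_of_ne le_sup_left
      fun h' => h (h' ▸ le_sup_right)
    have h2 : P ⊔ (W ⊓ T) ≤ W := sup_le hP inf_le_left
    have h3 := Submodule.finrank_lt_finrank_of_lt h1
    have h4 : P ⊔ (W ⊓ T) = W := Submodule.eq_of_le_of_finrank_le h2 (by omega)
    calc W = P ⊔ (W ⊓ T) := h4.symm
      _ ≤ _ := sup_le_sup_left (inf_le_inf_right _ hQ) _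
  · intro h h'
    have h1 : W = P ⊔ (Q ⊓ T) ⊓ W := by
      rw [← sup_inf_assoc_of_le _ hP]
      exact (inf_eq_right.2 h).symm
    have h2 : W ≤ P := by
      rw [h1]
      refine sup_le le_rfl (le_trans ?_ h')
      exact le_inf inf_le_right (inf_le_left.trans inf_le_right)
    have := Submodule.finrank_mono h2
    omega

/-- By `not_inf_le_iff` these are the covers inside `P + (Q ∩ V''_p)` but not inside `P + (Q ∩
V''_{p-1})`, where `P` and `Q` are the two steps of `f`. The difference of two nested geometric sums
is a power of `q` times a geometric sum. -/
theorem ncard_coverSet [Fintype F] (f f'' : PFlag n F d) (i p : Fin n) :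
    (coverSet f f'' i p).ncard = Fintype.card F ^ (∑ b ∈ Finset.Iio p, relPos f f'' i b) *
      ∑ t ∈ Finset.range (relPos f f'' i p), Fintype.card F ^ t := by
  have hV : Finite (Submodule F (Fin d → F)) :=
    Finite.of_injective _ (SetLike.coe_injective (A := Submodule F (Fin d → F)))
  let T : Fin (n + 1) → Set (Submodule F (Fin d → F)) := fun s =>
    {W | f.V i.castSucc ≤ W ∧ W ≤ f.V i.castSucc ⊔ (f.V i.succ ⊓ f''.V s) ∧
      Module.finrank F W = Module.finrank F (f.V i.castSucc) + 1}
  have hle : ∀ s, f.V i.castSucc ⊔ (f.V i.succ ⊓ f''.V s) ≤ f.V i.succ := fun s =>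
    sup_le (f.mono (Fin.castSucc_le_succ i)) inf_le_left
  have hsub : T p.castSucc ⊆ T p.succ := fun W hW => ⟨hW.1, hW.2.1.trans
    (sup_le_sup_left (inf_le_inf_left _ (f''.mono (Fin.castSucc_le_succ p))) _), hW.2.2⟩
  have h1 : coverSet f f'' i p = T p.succ \ T p.castSucc := by
    ext W
    constructor
    · rintro ⟨a, b, c, d, e⟩
      refine ⟨⟨a, (not_inf_le_iff a b c).1 e, c⟩, fun h => ?_⟩
      exact (not_inf_le_iff a b c).2 h.2.1 d
    · rintro ⟨⟨a, b, c⟩, e⟩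
      have b' := b.trans (hle _)
      refine ⟨a, b', c, ?_, (not_inf_le_iff a b' c).2 b⟩
      by_contra h
      exact e ⟨a, (not_inf_le_iff a b' c).1 h, c⟩
  rw [h1, Set.ncard_sdiff hsub, ncard_covers _ _ le_sup_left _ (finrank_step f f'' i p),
    ncard_covers _ _ le_sup_left _ (finrank_step_succ f f'' i p), Finset.sum_range_add,
    Nat.add_sub_cancel_left, Finset.mul_sum]
  simp_rw [pow_add]

end Count

/-! ### Flags in the position of a Chevalley generator. -/

section Chevalley

variable {n d : ℕ} {F : Type} [Field F]

/-- The matrix `diag(m) + E_{ij}` over `ℕ`. -/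
def chevNat (i j : Fin n) (m : Fin n → ℕ) : Matrix (Fin n) (Fin n) ℕ :=
  Matrix.diagonal m + Matrix.single i j 1

theorem chevNat_apply (i j : Fin n) (m : Fin n → ℕ) (a b : Fin n) :
    chevNat i j m a b = (if a = b then m a else 0) + if a = i ∧ b = j then 1 else 0 := by
  simp only [chevNat, Matrix.add_apply, Matrix.diagonal_apply, Matrix.single_apply, eq_comm]

theorem cum_chevNat (i j : Fin n) (m : Fin n → ℕ) (s t : Fin (n + 1)) :
    cum (chevNat i j m) s t = (∑ a, if a.castSucc < s ∧ a.castSucc < t then m a else 0) +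
      if i.castSucc < s ∧ j.castSucc < t then 1 else 0 := by
  have h : ∀ a b : Fin n, (if a.castSucc < s ∧ b.castSucc < t then chevNat i j m a b else 0) =
      (if a = b then if a.castSucc < s ∧ a.castSucc < t then m a else 0 else 0) +
        (if a = i then if b = j then if i.castSucc < s ∧ j.castSucc < t then 1 else 0 else 0
          else 0) := by
    intro a b
    rw [chevNat_apply]
    by_cases h1 : a = b <;> by_cases h2 : a = i <;> by_cases h3 : b = j <;> subst_vars <;> simp_all
    all_goals split_ifs <;> simp
  unfold cum
  simp_rw [h, Finset.sum_add_distrib]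
  simp

theorem PFlag.eq_of_rk {f f' : PFlag n F d} {s t : Fin (n + 1)}
    (h1 : rk f f' s t = Module.finrank F (f.V s)) : f.V s ≤ f'.V t := by
  have : f.V s ⊓ f'.V t = f.V s := Submodule.eq_of_le_of_finrank_eq inf_le_left h1
  exact inf_eq_left.1 this

/-- The description of the flags in position `diag(m) + E_{i,i-1}` to a given flag. -/
theorem of_relPos_eq_chevNat {i j : Fin n} (hij : (j : ℕ) + 1 = i) {m : Fin n → ℕ}
    {f f' : PFlag n F d} (h : relPos f f' = chevNat i j m) :
    (∀ t, t ≠ i.castSucc → f'.V t = f.V t) ∧ f.V i.castSucc ≤ f'.V i.castSucc ∧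
      Module.finrank F (f'.V i.castSucc) = Module.finrank F (f.V i.castSucc) + 1 := by
  have hl := fun t => finrank_left f f' t
  have hr := fun t => finrank_right f f' t
  have hk := fun s t => rk_eq_cum f f' s t
  simp only [h, cum_chevNat, Fin.castSucc_lt_last, and_true, true_and] at hl hr hk
  have hlt : ∀ t : Fin (n + 1), t ≠ i.castSucc → (i.castSucc < t ↔ j.castSucc < t) := by
    intro t ht
    simp only [Fin.lt_def, Fin.val_castSucc, ne_eq, Fin.ext_iff] at ht ⊢
    omega
  refine ⟨fun t ht => ?_, ?_, ?_⟩
  · have h1 : Module.finrank F (f.V t) = Module.finrank F (f'.V t) := by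
      rw [hl, hr, if_congr (hlt t ht) rfl rfl]
    have h2 : f.V t ≤ f'.V t := PFlag.eq_of_rk (by
      rw [hk, hl]; simp only [and_self, hlt t ht])
    exact (Submodule.eq_of_le_of_finrank_eq h2 h1).symm
  · refine PFlag.eq_of_rk ?_
    rw [hk, hl]
    simp
  · rw [hl, hr]
    have : j.castSucc < i.castSucc := by simp only [Fin.lt_def, Fin.val_castSucc]; omega
    simp [this]

theorem rk_self (f : PFlag n F d) (s t : Fin (n + 1)) :
    rk f f s t = Module.finrank F (f.V (min s t)) := by
  rcases le_total s t with h | h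
  · rw [rk, min_eq_left h, inf_eq_left.2 (f.mono h)]
  · rw [rk, min_eq_right h, inf_eq_right.2 (f.mono h)]

/-- Converse of `of_relPos_eq_chevNat`. Replacing one step by a cover raises the rank by one exactly
where that step meets a strictly later step of `f`; the position follows by taking second
differences. -/
theorem relPos_eq_chevNat {i j : Fin n} (hij : (j : ℕ) + 1 = i) {m : Fin n → ℕ}
    {f f' : PFlag n F d} (h1 : ∀ t, t ≠ i.castSucc → f'.V t = f.V t)
    (h2 : f.V i.castSucc ≤ f'.V i.castSucc)
    (h3 : Module.finrank F (f'.V i.castSucc) = Module.finrank F (f.V i.castSucc) + 1)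
    (hm : ∀ a : Fin n, m a + (if a = i then 1 else 0) + Module.finrank F (f.V a.castSucc) =
      Module.finrank F (f.V a.succ)) : relPos f f' = chevNat i j m := by
  have hk : ∀ s t, rk f f' s t = Module.finrank F (f.V (min s t)) +
      if t = i.castSucc ∧ i.castSucc < s then 1 else 0 := by
    intro s t
    by_cases ht : t = i.castSucc
    · subst ht
      by_cases hs : i.castSucc < s
      · have h4 : f'.V i.castSucc ≤ f.V s := by
          rw [← h1 s hs.ne']
          exact f'.mono hs.le
        rw [rk, inf_eq_right.2 h4, h3, min_eq_right hs.le]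
        simp [hs]
      · have h4 : f.V s ≤ f'.V i.castSucc := (f.mono (not_lt.1 hs)).trans h2
        rw [rk, inf_eq_left.2 h4, min_eq_left (not_lt.1 hs)]
        simp [hs]
    · rw [rk, h1 t ht, ← rk, rk_self]
      simp [ht]
  ext a b
  have h5 := relPos_cast f f' a b
  simp only [hk] at h5
  rw [chevNat_apply]
  have h6 := hm a
  have h7 := hm b
  rcases lt_trichotomy a b with hab | hab | hab
  · have e1 : min a.succ b.succ = a.succ := min_eq_left (Fin.succ_le_succ_iff.2 hab.le)
    have e2 : min a.castSucc b.succ = a.castSucc :=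
      min_eq_left ((Fin.castSucc_le_castSucc_iff.2 hab.le).trans (Fin.castSucc_le_succ b))
    have e3 : min a.succ b.castSucc = a.succ := min_eq_left (Fin.succ_le_castSucc_iff.2 hab)
    have e4 : min a.castSucc b.castSucc = a.castSucc :=
      min_eq_left (Fin.castSucc_le_castSucc_iff.2 hab.le)
    rw [e1, e2, e3, e4] at h5
    simp only [Fin.lt_def, Fin.ext_iff, Fin.val_castSucc, Fin.val_succ] at h5 h6 h7 hab ⊢
    split_ifs at h5 h6 h7 ⊢ <;> omega
  · subst hab
    have e2 : min a.castSucc a.succ = a.castSucc := min_eq_left (Fin.castSucc_le_succ a)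
    have e3 : min a.succ a.castSucc = a.castSucc := min_eq_right (Fin.castSucc_le_succ a)
    rw [min_self, min_self, e2, e3] at h5
    simp only [Fin.lt_def, Fin.ext_iff, Fin.val_castSucc, Fin.val_succ] at h5 h6 h7 ⊢
    split_ifs at h5 h6 h7 ⊢ <;> omega
  · have e1 : min a.succ b.succ = b.succ := min_eq_right (Fin.succ_le_succ_iff.2 hab.le)
    have e2 : min a.castSucc b.succ = b.succ := min_eq_right (Fin.succ_le_castSucc_iff.2 hab)
    have e3 : min a.succ b.castSucc = b.castSucc :=
      min_eq_right ((Fin.castSucc_le_castSucc_iff.2 hab.le).trans (Fin.castSucc_le_succ a))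
    have e4 : min a.castSucc b.castSucc = b.castSucc :=
      min_eq_right (Fin.castSucc_le_castSucc_iff.2 hab.le)
    rw [e1, e2, e3, e4] at h5
    simp only [Fin.lt_def, Fin.ext_iff, Fin.val_castSucc, Fin.val_succ] at h5 h6 h7 hab ⊢
    split_ifs at h5 h6 h7 ⊢ <;> omega

theorem exists_mem_coverSet {i : Fin n} {f f'' : PFlag n F d} {W : Submodule F (Fin d → F)}
    (h1 : f.V i.castSucc ≤ W) (h2 : W ≤ f.V i.succ)
    (h3 : Module.finrank F W = Module.finrank F (f.V i.castSucc) + 1) :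
    ∃ p, W ∈ coverSet f f'' i p := by
  by_contra hne
  have hall : ∀ t, W ⊓ f''.V t ≤ f.V i.castSucc := by
    intro t
    induction t using Fin.induction with
    | zero => simp [f''.bot]
    | succ p ih =>
      by_contra h
      exact hne ⟨p, h1, h2, h3, ih, h⟩
  have h4 := hall (Fin.last n)
  rw [f''.top, inf_top_eq] at h4
  have := Submodule.finrank_mono h4
  omega

/-- Enlarging the step raises its rank against `f''` by one beyond column `p` only. This moves a
unit of column `p` from row `i` to row `j`; writing the relation with sums avoids subtraction over
`ℕ`. -/
theorem relPos_add_single {i j : Fin n} (hij : (j : ℕ) + 1 = i) {p : Fin n}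
    {f f' f'' : PFlag n F d} (h1 : ∀ t, t ≠ i.castSucc → f'.V t = f.V t)
    (h2 : f'.V i.castSucc ∈ coverSet f f'' i p) :
    relPos f' f'' + Matrix.single i p 1 = relPos f f'' + Matrix.single j p 1 := by
  obtain ⟨a1, a2, a3, a4, a5⟩ := h2
  have hk : ∀ s t, rk f' f'' s t = rk f f'' s t +
      if s = i.castSucc ∧ p.castSucc < t then 1 else 0 := by
    intro s t
    by_cases hs : s = i.castSucc
    · subst hs
      by_cases ht : p.castSucc < t
      · have h4 : ¬ f'.V i.castSucc ⊓ f''.V t ≤ f.V i.castSucc := fun h =>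
          a5 ((inf_le_inf_left _ (f''.mono (Fin.castSucc_lt_iff_succ_le.1 ht))).trans h)
        have h5 := (not_inf_le_iff a1 le_rfl a3).1 h4
        have h6 := le_antisymm (sup_le a1 inf_le_left) h5
        have h7 := Submodule.finrank_sup_add_finrank_inf_eq (f.V i.castSucc)
          (f'.V i.castSucc ⊓ f''.V t)
        rw [h6, a3, ← inf_assoc, inf_eq_left.2 a1] at h7
        simp only [rk, ht, and_self, if_true]
        omega
      · have h4 : f'.V i.castSucc ⊓ f''.V t = f.V i.castSucc ⊓ f''.V t := by
          refine le_antisymm (le_inf ?_ inf_le_right) (inf_le_inf_right _ a1)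
          exact (inf_le_inf_left _ (f''.mono (not_lt.1 ht))).trans a4
        rw [rk, h4, ← rk]
        simp [ht]
    · rw [rk, h1 s hs, ← rk]
      simp [hs]
  ext a b
  have h5 := relPos_cast f' f'' a b
  have h6 := relPos_cast f f'' a b
  simp only [hk] at h5
  simp only [Matrix.add_apply, Matrix.single_apply]
  simp only [Fin.lt_def, Fin.ext_iff, Fin.val_castSucc, Fin.val_succ] at h5 ⊢
  split_ifs at h5 ⊢ <;> omega

/-- The flag `f` with the step before `i` replaced by `W`. -/
def PFlag.modify (f : PFlag n F d) {i j : Fin n} (hij : (j : ℕ) + 1 = i)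
    (W : Submodule F (Fin d → F)) (h1 : f.V i.castSucc ≤ W) (h2 : W ≤ f.V i.succ) :
    PFlag n F d where
  V t := if t = i.castSucc then W else f.V t
  mono s t hst := by
    dsimp only
    split_ifs with hs ht ht
    · exact le_rfl
    · exact h2.trans (f.mono (Fin.castSucc_lt_iff_succ_le.1
        (lt_of_le_of_ne (hs ▸ hst) (Ne.symm ht))))
    · refine (f.mono ?_).trans h1
      rwa [← ht]
    · exact f.mono hst
  bot := by
    rw [if_neg, f.bot]
    simp only [Fin.ext_iff, Fin.val_castSucc, Fin.val_zero]
    omega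
  top := by
    rw [if_neg, f.top]
    simp only [Fin.ext_iff, Fin.val_castSucc, Fin.val_last]
    have := i.isLt
    omega

theorem single_shift_unique {i j p p' : Fin n} (hij : i ≠ j) {B C : Matrix (Fin n) (Fin n) ℕ}
    (h : B + Matrix.single i p 1 = C + Matrix.single j p 1)
    (h' : B + Matrix.single i p' 1 = C + Matrix.single j p' 1) : p' = p := by
  have h1 := congrFun (congrFun h i) p
  have h2 := congrFun (congrFun h' i) p
  simp only [Matrix.add_apply, Matrix.single_apply, hij.symm, false_and, if_false, true_and,
    and_self, if_true] at h1 h2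
  by_contra hne
  rw [if_neg hne] at h2
  omega

/-- The structure polynomial of the product of `diag(m) + E_{i,i-1}` and `B`. -/
theorem isStructurePoly_lower {i j : Fin n} (hij : (j : ℕ) + 1 = i) (m : Fin n → ℕ)
    (B C : Matrix (Fin n) (Fin n) ℕ)
    (hm : ∀ a, m a + (if a = j then 1 else 0) = ∑ b, B a b) :
    IsStructurePoly (chevNat i j m) B C
      (∑ p, if B + Matrix.single i p 1 = C + Matrix.single j p 1 then
        X ^ (∑ b ∈ Finset.Iio p, C i b) * ∑ t ∈ Finset.range (C i p), X ^ t else 0) := by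
  have hne : i ≠ j := by rintro rfl; omega
  rw [isStructurePoly_iff]
  intro F _ _ d f f'' hC
  have hV : Finite (Submodule F (Fin d → F)) :=
    Finite.of_injective _ (SetLike.coe_injective (A := Submodule F (Fin d → F)))
  -- `B` and `C` determine `p`, so at most one summand survives. For that `p`, sending `f'` to its
  -- only altered step is a bijection onto `coverSet f f'' i p`.
  by_cases hex : ∃ p, B + Matrix.single i p 1 = C + Matrix.single j p 1
  · obtain ⟨p, hp⟩ := hex
    rw [Finset.sum_eq_single p (fun b _ hb => if_neg fun h =>
      hb (single_shift_unique hne hp h)) (by simp), if_pos hp]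
    have hcard : {f' : PFlag n F d | relPos f f' = chevNat i j m ∧ relPos f' f'' = B}.ncard =
        (coverSet f f'' i p).ncard := by
      refine Set.ncard_congr (fun f' _ => f'.V i.castSucc) ?_ ?_ ?_
      · rintro f' ⟨h1, h2⟩
        obtain ⟨a1, a2, a3⟩ := of_relPos_eq_chevNat hij h1
        have a4 : f'.V i.castSucc ≤ f.V i.succ := by
          rw [← a1 i.succ (by simp [Fin.ext_iff])]
          exact f'.mono (Fin.castSucc_le_succ i)
        obtain ⟨p', hp'⟩ := exists_mem_coverSet (f'' := f'') a2 a4 a3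
        have h3 := relPos_add_single hij a1 hp'
        rw [h2, hC] at h3
        rwa [← single_shift_unique hne hp h3]
      · rintro f' g' ⟨h1, _⟩ ⟨h2, _⟩ h
        refine PFlag.ext' fun t => ?_
        by_cases ht : t = i.castSucc
        · rw [ht]; exact h
        · rw [(of_relPos_eq_chevNat hij h1).1 t ht, (of_relPos_eq_chevNat hij h2).1 t ht]
      · intro W hW
        have hmod : ∀ t, t ≠ i.castSucc → (f.modify hij W hW.1 hW.2.1).V t = f.V t :=
          fun t ht => if_neg ht
        have hmod' : (f.modify hij W hW.1 hW.2.1).V i.castSucc = W := if_pos rfl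
        refine ⟨f.modify hij W hW.1 hW.2.1, ⟨?_, ?_⟩, hmod'⟩
        · refine relPos_eq_chevNat hij hmod (by rw [hmod']; exact hW.1)
            (by rw [hmod']; exact hW.2.2.1) fun a => ?_
          rw [← sum_row_relPos f f'' a, hC]
          have h1 : ∑ b, (B + Matrix.single i p 1 : Matrix (Fin n) (Fin n) ℕ) a b =
              ∑ b, (C + Matrix.single j p 1 : Matrix (Fin n) (Fin n) ℕ) a b := by
            rw [hp]
          simp only [Matrix.add_apply, Finset.sum_add_distrib, Matrix.single_apply, ← hm a] at h1
          have h2 : ∀ k : Fin n, (∑ b, if k = a ∧ p = b then 1 else 0) = if a = k then 1 else 0 := by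
            intro k
            by_cases hk : k = a
            · simp [hk]
            · simp [hk, Ne.symm hk]
          rw [h2, h2] at h1
          omega
        · have h3 := relPos_add_single (p := p) (f'' := f'') hij hmod (by rw [hmod']; exact hW)
          rw [hC, ← hp] at h3
          exact add_right_cancel h3
    rw [hcard, ncard_coverSet, hC]
    simp [eval_finsetSum]
  · rw [Finset.sum_eq_zero (fun p _ => if_neg fun h => hex ⟨p, h⟩)]
    have : {f' : PFlag n F d | relPos f f' = chevNat i j m ∧ relPos f' f'' = B} = ∅ := by
      refine Set.eq_empty_iff_forall_notMem.2 ?_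
      rintro f' ⟨h1, h2⟩
      obtain ⟨a1, a2, a3⟩ := of_relPos_eq_chevNat hij h1
      have a4 : f'.V i.castSucc ≤ f.V i.succ := by
        rw [← a1 i.succ (by simp [Fin.ext_iff])]
        exact f'.mono (Fin.castSucc_le_succ i)
      obtain ⟨p', hp'⟩ := exists_mem_coverSet (f'' := f'') a2 a4 a3
      have h3 := relPos_add_single hij a1 hp'
      rw [h2, hC] at h3
      exact hex ⟨p', h3⟩
    rw [this]
    simp

end Chevalley

/-! ### Orthogonal flags, which exchange the raising and lowering generators. -/

section Duality

variable {n d : ℕ} {F : Type} [Field F]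

/-- The standard symmetric bilinear form on `F ^ d`. -/
def dotForm (F : Type) [Field F] (d : ℕ) : LinearMap.BilinForm F (Fin d → F) :=
  Matrix.toBilin' (1 : Matrix (Fin d) (Fin d) F)

theorem dotForm_nondegenerate : (dotForm F d).Nondegenerate :=
  Matrix.Nondegenerate.toBilin' (Matrix.nondegenerate_of_det_ne_zero (by simp))

theorem dotForm_isRefl : (dotForm F d).IsRefl := by
  refine LinearMap.BilinForm.IsSymm.isRefl ⟨fun x y => ?_⟩
  simp [dotForm, Matrix.toBilin'_apply', dotProduct_comm]

/-- The flag of the orthogonal spaces of the steps of `f`. -/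
def PFlag.dual (f : PFlag n F d) : PFlag n F d where
  V t := (dotForm F d).orthogonal (f.V t.rev)
  mono s t hst := LinearMap.BilinForm.orthogonal_le (f.mono (Fin.rev_le_rev.2 hst))
  bot := by
    rw [Fin.rev_zero, f.top]
    exact LinearMap.BilinForm.orthogonal_top_eq_bot dotForm_nondegenerate
  top := by
    rw [Fin.rev_last, f.bot]
    exact LinearMap.BilinForm.orthogonal_bot

theorem PFlag.dual_dual (f : PFlag n F d) : f.dual.dual = f := by
  refine PFlag.ext' fun t => ?_
  simp only [PFlag.dual, Fin.rev_rev]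
  exact LinearMap.BilinForm.orthogonal_orthogonal dotForm_nondegenerate dotForm_isRefl _

theorem rk_dual (f f' : PFlag n F d) (s t : Fin (n + 1)) :
    rk f.dual f'.dual s t + Module.finrank F (f.V s.rev) + Module.finrank F (f'.V t.rev) =
      d + rk f f' s.rev t.rev := by
  have h1 : (dotForm F d).orthogonal (f.V s.rev) ⊓ (dotForm F d).orthogonal (f'.V t.rev) =
      (dotForm F d).orthogonal (f.V s.rev ⊔ f'.V t.rev) := by
    refine le_antisymm ?_ (le_inf (LinearMap.BilinForm.orthogonal_le le_sup_left)
      (LinearMap.BilinForm.orthogonal_le le_sup_right))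
    rintro x ⟨hx, hx'⟩ y hy
    obtain ⟨y1, hy1, y2, hy2, rfl⟩ := Submodule.mem_sup.1 hy
    have e1 := hx y1 hy1
    have e2 := hx' y2 hy2
    change dotForm F d y1 x = 0 at e1
    change dotForm F d y2 x = 0 at e2
    change dotForm F d (y1 + y2) x = 0
    rw [map_add, LinearMap.add_apply, e1, e2, add_zero]
  have h2 := Submodule.finrank_sup_add_finrank_inf_eq (f.V s.rev) (f'.V t.rev)
  have h3 := LinearMap.BilinForm.finrank_orthogonal (dotForm_nondegenerate (F := F) (d := d))
    (f.V s.rev ⊔ f'.V t.rev)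
  have h4 := Submodule.finrank_le (f.V s.rev ⊔ f'.V t.rev)
  rw [Module.finrank_fin_fun] at h3 h4
  rw [rk, rk, PFlag.dual, PFlag.dual, h1]
  omega

/-- The matrix with the order of the rows and of the columns reversed. -/
def revMat {R : Type} (M : Matrix (Fin n) (Fin n) R) : Matrix (Fin n) (Fin n) R :=
  M.submatrix Fin.rev Fin.rev

theorem revMat_revMat {R : Type} (M : Matrix (Fin n) (Fin n) R) : revMat (revMat M) = M := by
  ext i j; simp [revMat]

/-- In `rk_dual` the terms that depend on a single flag cancel in the second difference. What
remains is the reversed rank matrix. -/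
theorem relPos_dual (f f' : PFlag n F d) : relPos f.dual f'.dual = revMat (relPos f f') := by
  ext i j
  have h := relPos_cast f.dual f'.dual i j
  have h' := relPos_cast f f' i.rev j.rev
  have e1 := rk_dual f f' i.succ j.succ
  have e2 := rk_dual f f' i.castSucc j.succ
  have e3 := rk_dual f f' i.succ j.castSucc
  have e4 := rk_dual f f' i.castSucc j.castSucc
  simp only [Fin.rev_succ, Fin.rev_castSucc] at e1 e2 e3 e4
  simp only [revMat, Matrix.submatrix_apply]
  omega

/-- Taking orthogonal spaces is an involution on flags, so it matches the two sets that are counted.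
It yields the count for one kind of generator from the count for the other. -/
theorem IsStructurePoly.rev {A B C : Matrix (Fin n) (Fin n) ℕ} {g : ℤ[X]}
    (h : IsStructurePoly A B C g) : IsStructurePoly (revMat A) (revMat B) (revMat C) g := by
  rw [isStructurePoly_iff] at h ⊢
  intro F _ _ d f f'' hC
  rw [← h F d f.dual f''.dual (by rw [relPos_dual, hC, revMat_revMat])]
  congr 1
  refine Set.ncard_congr (fun f' _ => f'.dual) ?_ ?_ ?_
  · rintro f' ⟨h1, h2⟩
    exact ⟨by rw [relPos_dual, h1, revMat_revMat], by rw [relPos_dual, h2, revMat_revMat]⟩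
  · intro f' g' _ _ h
    rw [← f'.dual_dual, h, g'.dual_dual]
  · rintro f' ⟨h1, h2⟩
    refine ⟨f'.dual, ⟨?_, ?_⟩, f'.dual_dual⟩
    · rw [← f.dual_dual, relPos_dual, h1]
    · rw [← f''.dual_dual, relPos_dual, h2]

/-- `i` and `j` are adjacent. -/
def Adjacent (i j : Fin n) : Prop := (i : ℕ) + 1 = j ∨ (j : ℕ) + 1 = i

/-- The columns which contribute to the exponent of `v` at the column `p`. -/
def side (i j p : Fin n) : Finset (Fin n) := if j < i then Finset.Iio p else Finset.Ioi p

theorem revMat_single (i j : Fin n) :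
    revMat (Matrix.single i j 1 : Matrix (Fin n) (Fin n) ℕ) = Matrix.single i.rev j.rev 1 := by
  ext a b
  simp only [revMat, Matrix.submatrix_apply, Matrix.single_apply, Fin.rev_eq_iff]

theorem revMat_chevNat (i j : Fin n) (m : Fin n → ℕ) :
    revMat (chevNat i j m) = chevNat i.rev j.rev (m ∘ Fin.rev) := by
  ext a b
  simp only [revMat, Matrix.submatrix_apply, chevNat_apply, Function.comp, Fin.rev_eq_iff,
    Fin.rev_rev]

theorem revMat_add (M N : Matrix (Fin n) (Fin n) ℕ) : revMat (M + N) = revMat M + revMat N := rfl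

/-- The case `i < j` is the reversal of `isStructurePoly_lower`. Reversal turns the columns before
`p` into the columns after `p`, whence the two cases of `side`. -/
theorem isStructurePoly_chevNat {i j : Fin n} (hij : Adjacent i j) (m : Fin n → ℕ)
    (B C : Matrix (Fin n) (Fin n) ℕ)
    (hm : ∀ a, m a + (if a = j then 1 else 0) = ∑ b, B a b) :
    IsStructurePoly (chevNat i j m) B C
      (∑ p, if B + Matrix.single i p 1 = C + Matrix.single j p 1 then
        X ^ (∑ b ∈ side i j p, C i b) * ∑ t ∈ Finset.range (C i p), X ^ t else 0) := by
  rcases hij with hij | hij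
  · have h := (isStructurePoly_lower (i := i.rev) (j := j.rev)
      (by have := i.isLt; have := j.isLt; simp only [Fin.val_rev]; omega) (m ∘ Fin.rev)
      (revMat B) (revMat C) (fun a => by
        have h1 := hm a.rev
        simp only [Fin.rev_eq_iff] at h1
        simp only [Function.comp, revMat, Matrix.submatrix_apply]
        rw [h1]
        exact (Equiv.sum_comp Fin.revPerm fun b => B a.rev b).symm)).rev
    rw [revMat_revMat, revMat_revMat, revMat_chevNat, Fin.rev_rev, Fin.rev_rev] at h
    have hm' : (m ∘ Fin.rev) ∘ Fin.rev = m := by ext; simp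
    rw [hm'] at h
    convert h using 1
    rw [← Equiv.sum_comp Fin.revPerm]
    refine Finset.sum_congr rfl fun p _ => ?_
    rw [Fin.revPerm_apply]
    have hlt : ¬ j < i := by simp only [Fin.lt_def]; omega
    refine if_congr ?_ ?_ rfl
    · rw [← Fin.rev_rev p, ← revMat_single, ← revMat_single, ← revMat_add, ← revMat_add,
        Fin.rev_rev]
      constructor
      · intro h; rw [h]
      · intro h
        have := congrArg revMat h
        rwa [revMat_revMat, revMat_revMat] at this
    · simp only [revMat, Matrix.submatrix_apply, Fin.rev_rev, side, if_neg hlt]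
      congr 2
      refine Finset.sum_bij' (fun b _ => b.rev) (fun b _ => b.rev) ?_ ?_ ?_ ?_ ?_
      · intro a ha
        simp only [Finset.mem_Ioi, Finset.mem_Iio] at ha ⊢
        exact Fin.rev_lt_iff.2 (by simpa using ha)
      · intro a ha
        simp only [Finset.mem_Ioi, Finset.mem_Iio] at ha ⊢
        exact Fin.lt_rev_iff.2 (by simpa using ha)
      · simp
      · simp
      · simp
  · have h := isStructurePoly_lower hij m B C hm
    have hlt : j < i := by simp only [Fin.lt_def]; omega
    simpa only [side, if_pos hlt] using h

/-- Both sums would be the dimension of the same quotient of consecutive steps of `f'`, so no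
intermediate flag exists. -/
theorem isStructurePoly_zero {A B C : Matrix (Fin n) (Fin n) ℕ} (k : Fin n)
    (h : ∑ a, A a k ≠ ∑ b, B k b) : IsStructurePoly A B C 0 := by
  rw [isStructurePoly_iff]
  intro F _ _ d f f'' hC
  have : {f' : PFlag n F d | relPos f f' = A ∧ relPos f' f'' = B} = ∅ := by
    refine Set.eq_empty_iff_forall_notMem.2 ?_
    rintro f' ⟨h1, h2⟩
    have e1 := sum_col_relPos f f' k
    have e2 := sum_row_relPos f' f'' k
    rw [h1] at e1
    rw [h2] at e2
    omega
  rw [this]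
  simp

end Duality

/-! ### The exponents of `v` -/

section Exponent

variable {n : ℕ}

/-- The bilinear form behind `dimA`. -/
def dimQ (M N : Matrix (Fin n) (Fin n) ℤ) : ℤ :=
  ∑ i, ∑ j, ∑ k, ∑ l, if k ≤ i ∧ j < l then M i j * N k l else 0

/-- The coefficients of a matrix over `ℕ` as integers. -/
def toZ (M : Matrix (Fin n) (Fin n) ℕ) : Matrix (Fin n) (Fin n) ℤ := fun a b => M a b

theorem dimA_cast (A : Matrix (Fin n) (Fin n) ℕ) : (dimA A : ℤ) = dimQ (toZ A) (toZ A) := by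
  simp [dimA, dimQ, toZ]

theorem dimQ_add_left (M M' N : Matrix (Fin n) (Fin n) ℤ) :
    dimQ (M + M') N = dimQ M N + dimQ M' N := by
  simp only [dimQ, ← Finset.sum_add_distrib, Matrix.add_apply]
  refine Finset.sum_congr rfl fun i _ => Finset.sum_congr rfl fun j _ => Finset.sum_congr rfl
    fun k _ => Finset.sum_congr rfl fun l _ => ?_
  split_ifs <;> ring

theorem dimQ_add_right (M N N' : Matrix (Fin n) (Fin n) ℤ) :
    dimQ M (N + N') = dimQ M N + dimQ M N' := by
  simp only [dimQ, ← Finset.sum_add_distrib, Matrix.add_apply]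
  refine Finset.sum_congr rfl fun i _ => Finset.sum_congr rfl fun j _ => Finset.sum_congr rfl
    fun k _ => Finset.sum_congr rfl fun l _ => ?_
  split_ifs <;> ring

theorem dimQ_single_left (i p : Fin n) (N : Matrix (Fin n) (Fin n) ℤ) :
    dimQ (Matrix.single i p 1) N = ∑ l ∈ Finset.Ioi p, ∑ k ∈ Finset.Iic i, N k l := by
  simp only [dimQ, Matrix.single_apply, ite_mul, one_mul, zero_mul]
  rw [Finset.sum_eq_single i, Finset.sum_eq_single p]
  · rw [Finset.sum_comm, ← Finset.sum_filter_add_sum_filter_not Finset.univ (fun l => p < l),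
      Finset.sum_eq_zero (s := Finset.univ.filter fun l => ¬ p < l), add_zero]
    · refine Finset.sum_congr (by ext; simp) fun l hl => ?_
      rw [← Finset.sum_filter_add_sum_filter_not Finset.univ (fun k => k ≤ i),
        Finset.sum_eq_zero (s := Finset.univ.filter fun l => ¬ l ≤ i), add_zero]
      · refine Finset.sum_congr (by ext; simp) fun k hk => ?_
        simp_all
      · simp +contextual
    · intro l hl
      rw [Finset.mem_filter_univ] at hl
      simp [hl]
  · intro b _ hb; simp [hb.symm]
  · simp
  · intro b _ hb; simp [hb.symm]
  · simp

theorem dimQ_single_right (i p : Fin n) (N : Matrix (Fin n) (Fin n) ℤ) :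
    dimQ N (Matrix.single i p 1) = ∑ b ∈ Finset.Iio p, ∑ a ∈ Finset.Ici i, N a b := by
  have h : ∀ a b : Fin n, (∑ k, ∑ l, if k ≤ a ∧ b < l then
      N a b * (Matrix.single i p 1 : Matrix (Fin n) (Fin n) ℤ) k l else 0) =
      if i ≤ a ∧ b < p then N a b else 0 := by
    intro a b
    rw [Finset.sum_eq_single i, Finset.sum_eq_single p]
    · simp
    · intro l _ hl; simp [hl.symm]
    · simp
    · intro l _ hl; simp [hl.symm]
    · simp
  simp only [dimQ, h]
  rw [Finset.sum_comm, ← Finset.sum_filter_add_sum_filter_not Finset.univ (fun l => l < p),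
    Finset.sum_eq_zero (s := Finset.univ.filter fun l => ¬ l < p), add_zero]
  · refine Finset.sum_congr (by ext; simp) fun l hl => ?_
    rw [← Finset.sum_filter_add_sum_filter_not Finset.univ (fun k => i ≤ k),
      Finset.sum_eq_zero (s := Finset.univ.filter fun l => ¬ i ≤ l), add_zero]
    · refine Finset.sum_congr (by ext; simp) fun k hk => ?_
      simp_all
    · simp +contextual
  · intro l hl
    rw [Finset.mem_filter_univ] at hl
    simp [hl]

theorem dimQ_diagonal_diagonal (m m' : Fin n → ℤ) :
    dimQ (Matrix.diagonal m) (Matrix.diagonal m') = 0 := by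
  refine Finset.sum_eq_zero fun i _ => Finset.sum_eq_zero fun j _ => Finset.sum_eq_zero
    fun k _ => Finset.sum_eq_zero fun l _ => ?_
  split_ifs with h
  · by_cases h1 : i = j
    · by_cases h2 : k = l
      · subst h1 h2; exact absurd h.2 (not_lt.2 h.1)
      · rw [Matrix.diagonal_apply_ne _ h2, mul_zero]
    · rw [Matrix.diagonal_apply_ne _ h1, zero_mul]
  · rfl

theorem toZ_add (M N : Matrix (Fin n) (Fin n) ℕ) : toZ (M + N) = toZ M + toZ N := by
  ext a b; simp [toZ]

theorem toZ_single (i p : Fin n) :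
    toZ (Matrix.single i p 1 : Matrix (Fin n) (Fin n) ℕ) = Matrix.single i p 1 := by
  ext a b; simp [toZ, Matrix.single_apply]

theorem toZ_diagonal (m : Fin n → ℕ) :
    toZ (Matrix.diagonal m) = Matrix.diagonal fun a => (m a : ℤ) := by
  ext a b; simp [toZ, Matrix.diagonal_apply]

/-- Reversing all four indices exchanges the roles of the two factors in each term. -/
theorem dimA_revMat (A : Matrix (Fin n) (Fin n) ℕ) : dimA (revMat A) = dimA A := by
  let f : Fin n → Fin n → Fin n → Fin n → ℕ := fun i j k l =>
    if i ≤ k ∧ l < j then A i j * A k l else 0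
  have h1 : dimA (revMat A) = ∑ i, ∑ j, ∑ k, ∑ l, f (Fin.revPerm i) (Fin.revPerm j)
      (Fin.revPerm k) (Fin.revPerm l) := by
    simp [dimA, f, revMat, Fin.rev_le_rev, Fin.rev_lt_rev]
  have h2 : ∑ i, ∑ j, ∑ k, ∑ l, f (Fin.revPerm i) (Fin.revPerm j)
      (Fin.revPerm k) (Fin.revPerm l) = ∑ i, ∑ j, ∑ k, ∑ l, f i j k l := by
    rw [Equiv.sum_comp Fin.revPerm fun i => ∑ j, ∑ k, ∑ l,
      f i (Fin.revPerm j) (Fin.revPerm k) (Fin.revPerm l)]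
    refine Finset.sum_congr rfl fun i _ => ?_
    rw [Equiv.sum_comp Fin.revPerm fun j => ∑ k, ∑ l, f i j (Fin.revPerm k) (Fin.revPerm l)]
    refine Finset.sum_congr rfl fun j _ => ?_
    rw [Equiv.sum_comp Fin.revPerm fun k => ∑ l, f i j k (Fin.revPerm l)]
    refine Finset.sum_congr rfl fun k _ => ?_
    rw [Equiv.sum_comp Fin.revPerm fun l => f i j k l]
  rw [h1, h2]
  calc ∑ i, ∑ j, ∑ k, ∑ l, f i j k l
      = ∑ i, ∑ k, ∑ j, ∑ l, f i j k l := Finset.sum_congr rfl fun i _ => Finset.sum_comm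
    _ = ∑ k, ∑ i, ∑ j, ∑ l, f i j k l := Finset.sum_comm
    _ = ∑ k, ∑ i, ∑ l, ∑ j, f i j k l :=
        Finset.sum_congr rfl fun k _ => Finset.sum_congr rfl fun i _ => Finset.sum_comm
    _ = ∑ k, ∑ l, ∑ i, ∑ j, f i j k l := Finset.sum_congr rfl fun k _ => Finset.sum_comm
    _ = dimA A := by
      simp only [dimA, f]
      refine Finset.sum_congr rfl fun i _ => Finset.sum_congr rfl fun j _ =>
        Finset.sum_congr rfl fun k _ => Finset.sum_congr rfl fun l _ => ?_
      split_ifs <;> ring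

/-- The doubled sum on the left comes from the factor `q ^ ∑` at `q = v²`. The final `-(C i p - 1)`
is the power that symmetrizes `1 + q + ⋯` to a quantum integer in `zpow_mul_geom_sum`. -/
theorem dimA_lower {i j : Fin n} (hij : (j : ℕ) + 1 = i) {m : Fin n → ℕ}
    {B C : Matrix (Fin n) (Fin n) ℕ} {p : Fin n}
    (hm : ∀ a, m a + (if a = j then 1 else 0) = ∑ b, B a b)
    (h : B + Matrix.single i p 1 = C + Matrix.single j p 1) :
    (dimA C : ℤ) - dimA (chevNat i j m) - dimA B + 2 * ∑ b ∈ Finset.Iio p, (C i b : ℤ) =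
      ∑ b ∈ Finset.Iio p, ((C i b : ℤ) - C j b) - ((C i p : ℤ) - 1) := by
  have hne : i ≠ j := by rintro rfl; omega
  have hlt : j < i := by simp only [Fin.lt_def]; omega
  have hIic : Finset.Iic i = insert i (Finset.Iic j) := by
    ext a
    simp only [Finset.mem_Iic, Finset.mem_insert, Fin.le_def, Fin.ext_iff]
    omega
  have hIci : Finset.Ici j = insert j (Finset.Ici i) := by
    ext a
    simp only [Finset.mem_Ici, Finset.mem_insert, Fin.le_def, Fin.ext_iff]
    omega
  -- Only the unit at `(i, j)` paired with the diagonal entry at `(i, i)` contributes.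
  have hX : (dimA (chevNat i j m) : ℤ) = m i := by
    rw [dimA_cast, chevNat, toZ_add, toZ_single, toZ_diagonal]
    rw [dimQ_add_left, dimQ_add_right, dimQ_add_right, dimQ_diagonal_diagonal,
      dimQ_single_right, dimQ_single_left, dimQ_single_right]
    have e1 : ∑ b ∈ Finset.Iio j, ∑ a ∈ Finset.Ici i,
        (Matrix.diagonal fun a => (m a : ℤ)) a b = 0 := by
      refine Finset.sum_eq_zero fun b hb => Finset.sum_eq_zero fun a ha => ?_
      rw [Finset.mem_Iio] at hb
      rw [Finset.mem_Ici] at ha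
      exact Matrix.diagonal_apply_ne _ (hb.trans (hlt.trans_le ha)).ne'
    have e2 : ∑ b ∈ Finset.Iio j, ∑ a ∈ Finset.Ici i,
        (Matrix.single i j 1 : Matrix (Fin n) (Fin n) ℤ) a b = 0 := by
      refine Finset.sum_eq_zero fun b hb => Finset.sum_eq_zero fun a ha => ?_
      rw [Finset.mem_Iio] at hb
      simp [hb.ne']
    have e3 : ∑ l ∈ Finset.Ioi j, ∑ k ∈ Finset.Iic i,
        (Matrix.diagonal fun a => (m a : ℤ)) k l = m i := by
      rw [Finset.sum_eq_single i, Finset.sum_eq_single i]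
      · simp
      · exact fun b _ hb => Matrix.diagonal_apply_ne _ hb
      · simp
      · intro b hb hbi
        refine Finset.sum_eq_zero fun a ha => Matrix.diagonal_apply_ne _ ?_
        simp only [Finset.mem_Iic, Finset.mem_Ioi, Fin.lt_def, Fin.le_def, ne_eq,
          Fin.ext_iff] at ha hb hbi ⊢
        omega
      · simp [hlt]
    rw [e1, e2, e3]
    simp
  have hmi := hm i
  rw [if_neg hne, add_zero] at hmi
  have hB : toZ B + Matrix.single i p 1 = toZ C + Matrix.single j p 1 := by
    rw [← toZ_single, ← toZ_single, ← toZ_add, ← toZ_add, h]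
  have hrow : (m i : ℤ) + 1 = ∑ b, (C i b : ℤ) := by
    have h1 : ∑ b, (toZ B + Matrix.single i p 1 : Matrix (Fin n) (Fin n) ℤ) i b =
        ∑ b, (toZ C + Matrix.single j p 1 : Matrix (Fin n) (Fin n) ℤ) i b := by rw [hB]
    simp only [Matrix.add_apply, Finset.sum_add_distrib, Matrix.single_apply, hne.symm,
      false_and, if_false, add_zero, true_and, Finset.sum_ite_eq,
      Finset.mem_univ, if_true, toZ] at h1
    rw [← h1, hmi]
    push_cast
    rfl
  -- The relation between `B` and `C` is expanded in the quadratic form and paired with `E_{ip}` on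
  -- either side. Units in the same column pair to zero, so these equations express `dimA B` through
  -- corner sums of `C`.
  have q1 : dimQ (toZ B + Matrix.single i p 1) (toZ B + Matrix.single i p 1) =
    dimQ (toZ C + Matrix.single j p 1) (toZ C + Matrix.single j p 1) := by rw [hB]
  have q2 : dimQ (Matrix.single i p 1) (toZ B + Matrix.single i p 1) =
    dimQ (Matrix.single i p 1) (toZ C + Matrix.single j p 1) := by rw [hB]
  have q3 : dimQ (toZ B + Matrix.single i p 1) (Matrix.single i p 1) =
    dimQ (toZ C + Matrix.single j p 1) (Matrix.single i p 1) := by rw [hB]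
  have z : ∀ a b : Fin n, dimQ (Matrix.single a p 1) (Matrix.single b p 1) = 0 := by
    intro a b
    rw [dimQ_single_left]
    refine Finset.sum_eq_zero fun l hl => Finset.sum_eq_zero fun k _ => ?_
    rw [Finset.mem_Ioi] at hl
    simp [hl.ne]
  simp only [dimQ_add_left, dimQ_add_right, z, add_zero] at q1 q2 q3
  have r1 : dimQ (Matrix.single i p 1) (toZ C) - dimQ (Matrix.single j p 1) (toZ C) =
      ∑ l ∈ Finset.Ioi p, (C i l : ℤ) := by
    rw [dimQ_single_left, dimQ_single_left, ← Finset.sum_sub_distrib]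
    refine Finset.sum_congr rfl fun l _ => ?_
    rw [hIic, Finset.sum_insert (by simp [hlt]), add_sub_cancel_right, toZ]
  have r2 : dimQ (toZ C) (Matrix.single i p 1) - dimQ (toZ C) (Matrix.single j p 1) =
      - ∑ l ∈ Finset.Iio p, (C j l : ℤ) := by
    rw [dimQ_single_right, dimQ_single_right, ← Finset.sum_sub_distrib, ← Finset.sum_neg_distrib]
    refine Finset.sum_congr rfl fun l _ => ?_
    rw [hIci, Finset.sum_insert (by simp [hlt]), toZ]
    ring
  have hsplit : ∑ b, (C i b : ℤ) = ∑ b ∈ Finset.Iio p, (C i b : ℤ) + C i p +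
      ∑ b ∈ Finset.Ioi p, (C i b : ℤ) := by
    have : (Finset.univ : Finset (Fin n)) = insert p (Finset.Iio p ∪ Finset.Ioi p) := by
      ext a; simp only [Finset.mem_univ, Finset.mem_insert, Finset.mem_union, Finset.mem_Iio,
        Finset.mem_Ioi, true_iff]; exact (lt_trichotomy a p).elim (fun h => Or.inr (Or.inl h))
          fun h => h.elim Or.inl fun h => Or.inr (Or.inr h)
    rw [this, Finset.sum_insert (by simp), Finset.sum_union (by
      rw [Finset.disjoint_left]; intro a ha hb
      exact lt_asymm (Finset.mem_Iio.1 ha) (Finset.mem_Ioi.1 hb))]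
    ring
  rw [Finset.sum_sub_distrib, dimA_cast, dimA_cast B, hX]
  linarith

theorem dimA_chevNat {i j : Fin n} (hij : Adjacent i j) {m : Fin n → ℕ}
    {B C : Matrix (Fin n) (Fin n) ℕ} {p : Fin n}
    (hm : ∀ a, m a + (if a = j then 1 else 0) = ∑ b, B a b)
    (h : B + Matrix.single i p 1 = C + Matrix.single j p 1) :
    (dimA C : ℤ) - dimA (chevNat i j m) - dimA B + 2 * ∑ b ∈ side i j p, (C i b : ℤ) =
      ∑ b ∈ side i j p, ((C i b : ℤ) - C j b) - ((C i p : ℤ) - 1) := by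
  rcases hij with hij | hij
  · have hlt : ¬ j < i := by simp only [Fin.lt_def]; omega
    have h1 := dimA_lower (i := i.rev) (j := j.rev) (p := p.rev)
      (B := revMat B) (C := revMat C) (m := m ∘ Fin.rev)
      (by have := i.isLt; have := j.isLt; simp only [Fin.val_rev]; omega)
      (fun a => by
        have h1 := hm a.rev
        simp only [Fin.rev_eq_iff] at h1
        simp only [Function.comp, revMat, Matrix.submatrix_apply]
        rw [h1]
        exact (Equiv.sum_comp Fin.revPerm fun b => B a.rev b).symm)
      (by rw [← revMat_single, ← revMat_single, ← revMat_add, ← revMat_add, h])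
    rw [← revMat_chevNat, dimA_revMat, dimA_revMat, dimA_revMat] at h1
    have hs : ∀ g : Fin n → ℤ, ∑ b ∈ Finset.Iio p.rev, g b.rev = ∑ b ∈ side i j p, g b := by
      intro g
      rw [side, if_neg hlt]
      refine Finset.sum_bij' (fun b _ => b.rev) (fun b _ => b.rev) ?_ ?_ ?_ ?_ ?_
      · intro a ha
        simp only [Finset.mem_Ioi, Finset.mem_Iio] at ha ⊢
        exact Fin.lt_rev_iff.1 ha
      · intro a ha
        simp only [Finset.mem_Ioi, Finset.mem_Iio] at ha ⊢
        exact Fin.rev_lt_rev.2 ha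
      · simp
      · simp
      · simp
    simp only [revMat, Matrix.submatrix_apply, Fin.rev_rev] at h1
    rw [← hs, ← hs]
    exact h1
  · have hlt : j < i := by simp only [Fin.lt_def]; omega
    simpa only [side, if_pos hlt] using dimA_lower hij hm h

end Exponent

/-! ### Quantum integers -/

theorem v_ne_zero : v ≠ 0 := RatFunc.X_ne_zero

theorem v_pow_injective : Function.Injective fun k : ℕ => v ^ k := by
  intro a b h
  have h1 : algebraMap ℚ[X] Qv (X ^ a) = algebraMap ℚ[X] Qv (X ^ b) := by
    simpa [v, RatFunc.algebraMap_X] using h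
  have h2 := congrArg natDegree (RatFunc.algebraMap_injective ℚ h1)
  simpa using h2

theorem v_sq_ne_one : v ^ 2 ≠ 1 := fun h => by
  have := v_pow_injective (a₁ := 2) (a₂ := 0) (by simpa using h)
  omega

theorem v_sub_inv_ne_zero : v - v⁻¹ ≠ 0 := by
  intro h
  refine v_sq_ne_one ?_
  rw [sq]
  nth_rewrite 1 [sub_eq_zero.1 h]
  exact inv_mul_cancel₀ v_ne_zero

/-- The symmetric quantum integer `[m]`. -/
def qint (m : ℤ) : Qv := (v ^ m - v ^ (-m)) / (v - v⁻¹)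

theorem qint_zero : qint 0 = 0 := by simp [qint]

theorem qint_one : qint 1 = 1 := by
  simp only [qint, zpow_one, zpow_neg]
  exact div_self v_sub_inv_ne_zero

theorem qint_neg (m : ℤ) : qint (-m) = -qint m := by
  simp only [qint, neg_neg]
  ring

theorem v_sq_sub_one_ne_zero : v ^ 2 - 1 ≠ 0 := sub_ne_zero.2 v_sq_ne_one

theorem zpow_mul_geom_sum (c : ℕ) :
    v ^ (-((c : ℤ) - 1)) * ∑ t ∈ Finset.range c, (v ^ 2) ^ t = qint c := by
  have h0 := v_ne_zero
  have h1 := v_sq_sub_one_ne_zero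
  have h3 : v - v⁻¹ = v⁻¹ * (v ^ 2 - 1) := by field_simp
  rw [geom_sum_eq v_sq_ne_one, qint, h3, neg_sub, zpow_sub₀ h0, zpow_one, zpow_neg, zpow_natCast]
  field_simp
  ring

/-! ### Products in the Schur algebras -/

section Schur

variable {n : ℕ}

theorem mem_thetaSet {d : ℕ} {A : Matrix (Fin n) (Fin n) ℕ} : A ∈ thetaSet n d ↔ size A = d := by
  refine ⟨fun h => (Finset.mem_filter.1 h).2, ?_⟩
  rintro rfl
  refine Finset.mem_filter.2 ⟨Fintype.mem_piFinset.2 fun i => Fintype.mem_piFinset.2 fun j =>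
    Finset.mem_range.2 (Nat.lt_succ_of_le ?_), rfl⟩
  calc A i j ≤ ∑ j, A i j := Finset.single_le_sum (f := fun j => A i j) (by simp) (by simp)
    _ ≤ size A := Finset.single_le_sum (f := fun i => ∑ j, A i j) (by simp) (by simp)

theorem schurMul_apply (A B C : Matrix (Fin n) (Fin n) ℕ) :
    schurMul A B C = if size C = size A then
      v ^ ((dimA C : ℤ) - (dimA A : ℤ) - (dimA B : ℤ)) * aeval (v ^ 2) (structurePoly A B C)
      else 0 := by
  classical
  simp only [schurMul, Finsupp.finsetSum_apply, Finsupp.single_apply, Finset.sum_ite_eq',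
    mem_thetaSet]

/-- The coefficient with which the entry at `(i, p)` contributes to the action of a Chevalley
generator, in terms of the resulting matrix. -/
def chevCoeff (i j p : Fin n) (C : Matrix (Fin n) (Fin n) ℤ) : Qv :=
  v ^ (∑ b ∈ side i j p, (C i b - C j b)) * qint (C i p)

/-- The multiplication formula for generators: the flag count at `q = v²` combined with the
normalization of `[A]`. Writing the coefficient through the result `C` makes its dependence on
diagonal shifts visible. -/
theorem schur_chevNat {i j : Fin n} (hij : Adjacent i j) {m : Fin n → ℕ}
    {B : Matrix (Fin n) (Fin n) ℕ} (hm : ∀ a, m a + (if a = j then 1 else 0) = ∑ b, B a b)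
    (C : Matrix (Fin n) (Fin n) ℕ) :
    v ^ ((dimA C : ℤ) - (dimA (chevNat i j m) : ℤ) - (dimA B : ℤ)) *
        aeval (v ^ 2) (structurePoly (chevNat i j m) B C) =
      ∑ p, if B + Matrix.single i p 1 = C + Matrix.single j p 1 then
        chevCoeff i j p (toZ C) else 0 := by
  rw [(isStructurePoly_chevNat hij m B C hm).structurePoly_eq, map_sum, Finset.mul_sum]
  refine Finset.sum_congr rfl fun p _ => ?_
  split_ifs with h
  · have h1 := dimA_chevNat hij hm h
    simp only [chevCoeff, toZ]
    rw [← zpow_mul_geom_sum, map_mul, map_pow, map_sum, aeval_X]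
    simp only [map_pow, aeval_X]
    rw [← mul_assoc, ← mul_assoc, ← pow_mul, ← zpow_natCast, ← zpow_add₀ v_ne_zero,
      ← zpow_add₀ v_ne_zero]
    congr 2
    push_cast
    linarith
  · simp

theorem size_chevNat (i j : Fin n) (m : Fin n → ℕ) : size (chevNat i j m) = ∑ a, m a + 1 := by
  simp only [size, chevNat_apply, Finset.sum_add_distrib]
  simp [ite_and]

theorem schurMul_eq_zero {A B : Matrix (Fin n) (Fin n) ℕ} (k : Fin n)
    (h : ∑ a, A a k ≠ ∑ b, B k b) : schurMul A B = 0 := by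
  ext C
  rw [schurMul_apply, (isStructurePoly_zero k h).structurePoly_eq]
  simp

end Schur

/-! ### Stable products -/

section Stable

variable {n : ℕ}

theorem Theta.ext' {A B : Theta n} (h : A.1 = B.1) : A = B := Subtype.ext h

theorem eventually_pos (A : Theta n) (c : ℤ) :
    ∀ᶠ s : ℕ in Filter.atTop, ∀ a, c ≤ A.1 a a + s := by
  rw [Filter.eventually_all]
  intro a
  filter_upwards [Filter.eventually_ge_atTop (c - A.1 a a).toNat] with s hs
  have := Int.self_le_toNat (c - A.1 a a)
  omega

theorem toZ_shift {A : Theta n} {s : ℕ} (h : ∀ a, 0 ≤ A.1 a a + s) :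
    toZ (shift s A) = A.1 + Matrix.diagonal fun _ => (s : ℤ) := by
  ext a b
  simp only [toZ, shift, Matrix.add_apply, Matrix.diagonal_apply]
  by_cases hab : a = b
  · subst hab
    simpa using h a
  · simpa [hab] using A.2 a b hab

theorem toZ_injective : Function.Injective (toZ (n := n)) := by
  intro A B h
  ext a b
  have := congrFun (congrFun h a) b
  simpa [toZ] using this

theorem shift_inj {A B : Theta n} {s : ℕ} (hA : ∀ a, 0 ≤ A.1 a a + s)
    (hB : ∀ a, 0 ≤ B.1 a a + s) (h : shift s A = shift s B) : A = B := by
  have h1 := congrArg toZ h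
  rw [toZ_shift hA, toZ_shift hB] at h1
  exact Theta.ext' (add_right_cancel h1)

theorem stable_sum_apply (G : Theta n →₀ Qv[X]) (Z : Theta n) :
    ∀ᶠ s : ℕ in Filter.atTop, (G.sum fun Z P => Finsupp.single (shift s Z) (P.eval ((v⁻¹) ^ s)))
      (shift s Z) = (G Z).eval ((v⁻¹) ^ s) := by
  classical
  have h1 : ∀ᶠ s : ℕ in Filter.atTop, ∀ Z' ∈ G.support, ∀ a, 0 ≤ Z'.1 a a + s :=
    (Filter.eventually_all_finset _).2 fun Z' _ => eventually_pos Z' 0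
  filter_upwards [h1, eventually_pos Z 0] with s h1 h2
  rw [Finsupp.sum, Finsupp.finsetSum_apply, Finset.sum_eq_single Z]
  · simp
  · intro Z' hZ' hne
    exact Finsupp.single_eq_of_ne fun h => hne (shift_inj (h1 Z' hZ') h2 h.symm)
  · intro h
    simp [Finsupp.notMem_support_iff.1 h]

/-- For large `s` the shift is injective on the finite supports, so the coefficients can be compared
one `Z` at a time. Two polynomials agreeing at infinitely many powers of `v⁻¹` coincide. -/
theorem IsStableProduct.unique {A B : Theta n} {G G' : Theta n →₀ Qv[X]}
    (h : IsStableProduct A B G) (h' : IsStableProduct A B G') : G = G' := by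
  ext1 Z
  refine Polynomial.eq_of_infinite_eval_eq _ _ ?_
  have h1 : ∀ᶠ s : ℕ in Filter.atTop,
      (G Z).eval ((v⁻¹) ^ s) = (G' Z).eval ((v⁻¹) ^ s) := by
    filter_upwards [h, h', stable_sum_apply G Z, stable_sum_apply G' Z] with s e1 e2 e3 e4
    rw [← e3, ← e4, ← e1, ← e2]
  obtain ⟨N, hN⟩ := Filter.eventually_atTop.1 h1
  refine Set.infinite_of_injective_forall_mem (f := fun k : ℕ => (v⁻¹) ^ (N + k)) ?_
    fun k => hN (N + k) (by omega)
  intro a b hab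
  simp only [inv_pow, inv_inj] at hab
  have := v_pow_injective hab
  omega

theorem IsStableProduct.stdMul_eq {A B : Theta n} {G : Theta n →₀ Qv[X]}
    (h : IsStableProduct A B G) : stdMul A B = G.sum fun Z P => P.eval 1 • std Z := by
  have hex : ∃ G, IsStableProduct A B G := ⟨G, h⟩
  rw [stdMul, dif_pos hex, hex.choose_spec.unique h]

end Stable

/-! ### Coordinates in the standard basis -/

section Coeff

variable {n : ℕ}

theorem Udot.ext' {x y : Udot n} (h : ∀ A, x.coeff A = y.coeff A) : x = y := Finsupp.ext h

theorem Udot.coeff_add (x y : Udot n) (A : Theta n) :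
    (x + y).coeff A = x.coeff A + y.coeff A := rfl

theorem Udot.coeff_sub (x y : Udot n) (A : Theta n) :
    (x - y).coeff A = x.coeff A - y.coeff A := rfl

theorem Udot.coeff_zero (A : Theta n) : (0 : Udot n).coeff A = 0 := rfl

theorem Udot.coeff_smul (c : Qv) (x : Udot n) (A : Theta n) :
    (c • x).coeff A = c * x.coeff A := rfl

open Classical in
theorem Udot.coeff_std (A B : Theta n) : (std A).coeff B = if A = B then 1 else 0 :=
  Finsupp.single_apply

/-- The coefficient of `x` at `[A]`, as a linear map. -/
def Udot.coeffHom (A : Theta n) : Udot n →ₗ[Qv] Qv where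
  toFun x := x.coeff A
  map_add' x y := Udot.coeff_add x y A
  map_smul' c x := Udot.coeff_smul c x A

theorem Udot.coeff_sum {ι : Type} (s : Finset ι) (f : ι → Udot n) (A : Theta n) :
    (∑ k ∈ s, f k).coeff A = ∑ k ∈ s, (f k).coeff A :=
  map_sum (Udot.coeffHom A) f s

theorem Udot.mul_def (x y : Udot n) : x * y =
    (show Theta n →₀ Qv from x).sum fun A a =>
      (show Theta n →₀ Qv from y).sum fun B b => (a * b) • stdMul A B := rfl

/-- `Udot` carries a bare multiplication without a ring structure. Bilinearity is all that is needed
of it; associativity is only used for the convolution of flags. -/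
theorem Udot.add_mul' (x x' y : Udot n) : (x + x') * y = x * y + x' * y := by
  rw [Udot.mul_def, Udot.mul_def, Udot.mul_def]
  refine Finsupp.sum_add_index' (fun A => ?_) fun A a a' => ?_
  · simp [Finsupp.sum]
  · simp only [add_mul, add_smul]
    exact Finsupp.sum_add

theorem Udot.mul_add' (x y y' : Udot n) : x * (y + y') = x * y + x * y' := by
  rw [Udot.mul_def, Udot.mul_def, Udot.mul_def]
  rw [← Finsupp.sum_add]
  refine Finsupp.sum_congr fun A _ => ?_
  refine Finsupp.sum_add_index' (fun B => by simp) fun B b b' => ?_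
  rw [mul_add, add_smul]

theorem Udot.smul_mul' (c : Qv) (x y : Udot n) : (c • x) * y = c • (x * y) := by
  rw [Udot.mul_def, Udot.mul_def]
  have h := Finsupp.sum_smul_index (g := show Theta n →₀ Qv from x) (b := c)
    (h := fun A a => (show Theta n →₀ Qv from y).sum fun B b => (a * b) • stdMul A B)
    (fun A => by simp [Finsupp.sum])
  refine h.trans ?_
  simp only [Finsupp.sum, Finset.smul_sum, smul_smul, mul_assoc]

theorem Udot.mul_smul' (c : Qv) (x y : Udot n) : x * (c • y) = c • (x * y) := by
  rw [Udot.mul_def, Udot.mul_def, Finsupp.sum, Finsupp.sum, Finset.smul_sum]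
  refine Finset.sum_congr rfl fun A _ => ?_
  refine (Finsupp.sum_smul_index (g := show Theta n →₀ Qv from y) (b := c)
    (fun A => by simp)).trans ?_
  simp only [Finsupp.sum, Finset.smul_sum, smul_smul, mul_left_comm]

theorem Udot.std_mul_std (A B : Theta n) : std A * std B = stdMul A B := by
  rw [Udot.mul_def]
  refine (Finsupp.sum_single_index (by simp [Finsupp.sum])).trans ?_
  refine (Finsupp.sum_single_index (by simp)).trans ?_
  rw [one_mul, one_smul]

theorem Udot.eq_sum_std (x : Udot n) :
    x = ∑ B ∈ (show Theta n →₀ Qv from x).support, x.coeff B • std B := by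
  conv_lhs => rw [← Finsupp.sum_single (show Theta n →₀ Qv from x)]
  refine Finset.sum_congr rfl fun B _ => ?_
  exact (Finsupp.smul_single_one B _).symm

theorem Udot.mul_sum' {ι : Type} (x : Udot n) (s : Finset ι) (f : ι → Udot n) :
    x * ∑ k ∈ s, f k = ∑ k ∈ s, x * f k :=
  map_sum (AddMonoidHom.mk' (fun y => x * y) (Udot.mul_add' x)) f s

end Coeff

/-! ### The action of the Chevalley generators on the standard basis. -/

section Action

variable {n : ℕ}

/-- `M + E_{ip} - E_{jp}`. -/
def moveMat (i j p : Fin n) (M : Matrix (Fin n) (Fin n) ℤ) : Matrix (Fin n) (Fin n) ℤ :=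
  M + Matrix.single i p 1 - Matrix.single j p 1

theorem moveMat_apply (i j p : Fin n) (M : Matrix (Fin n) (Fin n) ℤ) (a b : Fin n) :
    moveMat i j p M a b =
      M a b + (if a = i ∧ b = p then 1 else 0) - if a = j ∧ b = p then 1 else 0 := by
  simp only [moveMat, Matrix.sub_apply, Matrix.add_apply, Matrix.single_apply, eq_comm]

theorem moveMat_moveMat (i j p : Fin n) (M : Matrix (Fin n) (Fin n) ℤ) :
    moveMat i j p (moveMat j i p M) = M := by
  simp only [moveMat]; abel

/-- The off-diagonal entries are nonnegative. -/
def OffNonneg (M : Matrix (Fin n) (Fin n) ℤ) : Prop := ∀ r s, r ≠ s → 0 ≤ M r s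

/-- A matrix with nonnegative off-diagonal entries as an element of `Θ̃`. -/
def mkTheta (M : Matrix (Fin n) (Fin n) ℤ) (h : OffNonneg M) : Theta n := ⟨M, h⟩

theorem mkTheta_val (M : Matrix (Fin n) (Fin n) ℤ) (h : OffNonneg M) : (mkTheta M h).1 = M := rfl

/-- The polynomial in `v' = v ^ (-s)` with value `chevCoeff i j p (Z + sI)`. -/
def chevPoly (i j p : Fin n) (Z : Matrix (Fin n) (Fin n) ℤ) : Qv[X] :=
  if p = i then C (v ^ (∑ b ∈ side i j p, (Z i b - Z j b)) * (v ^ Z i p / (v - v⁻¹))) -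
    C (v ^ (∑ b ∈ side i j p, (Z i b - Z j b)) * (v ^ (-Z i p) / (v - v⁻¹))) * X ^ 2
  else C (chevCoeff i j p Z)

/-- For adjacent `i`, `j`, the set `side i j p` contains both or neither, except that for `p = i` it
contains `j` alone. A diagonal shift thus changes the exponent only for `p = i`, where the quantum
integer changes as well. -/
theorem mem_side_sub {i j : Fin n} (hij : Adjacent i j) (p : Fin n) (s : ℤ) :
    (if i ∈ side i j p then s else 0) - (if j ∈ side i j p then s else 0) =
      if p = i then -s else 0 := by
  unfold side Adjacent at *
  by_cases hlt : j < i
  · rw [if_pos hlt]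
    simp only [Finset.mem_Iio, Fin.lt_def, Fin.ext_iff] at hlt ⊢
    split_ifs <;> omega
  · rw [if_neg hlt]
    simp only [Finset.mem_Ioi, Fin.lt_def, Fin.ext_iff] at hlt ⊢
    split_ifs <;> omega

/-- For `p = i` the factor `v^(-s)` cancels the growing term `v^s` of the quantum integer, leaving a
polynomial in `v' = v^(-s)` with terms of degree `0` and `2`. For the other `p` the coefficient does
not depend on `s`. -/
theorem eval_chevPoly {i j : Fin n} (hij : Adjacent i j) (p : Fin n)
    (Z : Matrix (Fin n) (Fin n) ℤ) (s : ℕ) :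
    (chevPoly i j p Z).eval ((v⁻¹) ^ s) =
      chevCoeff i j p (Z + Matrix.diagonal fun _ => (s : ℤ)) := by
  have hsum : ∑ b ∈ side i j p, ((Z + Matrix.diagonal fun _ => (s : ℤ) : Matrix (Fin n) (Fin n) ℤ) i b -
      (Z + Matrix.diagonal fun _ => (s : ℤ) : Matrix (Fin n) (Fin n) ℤ) j b) =
      ∑ b ∈ side i j p, (Z i b - Z j b) + if p = i then -(s : ℤ) else 0 := by
    rw [← mem_side_sub hij p s]
    simp only [Matrix.add_apply, Matrix.diagonal_apply, Finset.sum_sub_distrib,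
      Finset.sum_add_distrib, Finset.sum_ite_eq]
    ring
  rw [chevCoeff, hsum]
  have h0 := v_ne_zero
  have h2 := v_sub_inv_ne_zero
  by_cases hp : p = i
  · subst hp
    simp only [chevPoly, if_true, Matrix.add_apply, Matrix.diagonal_apply_eq, eval_sub, eval_mul,
      eval_C, eval_pow, eval_X, qint, neg_add]
    rw [zpow_add₀ h0, zpow_add₀ h0, zpow_add₀ h0, zpow_neg, zpow_neg, zpow_natCast, inv_pow]
    field_simp
  · have : ¬ i = p := fun h => hp h.symm
    simp [chevPoly, hp, chevCoeff, this]

theorem eval_one_chevPoly (i j p : Fin n) (Z : Matrix (Fin n) (Fin n) ℤ) :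
    (chevPoly i j p Z).eval 1 = chevCoeff i j p Z := by
  unfold chevPoly
  split_ifs with h
  · simp only [eval_sub, eval_mul, eval_C, eval_pow, eval_X, one_pow, mul_one, chevCoeff, qint]
    ring
  · simp

open Classical in
/-- The stable product of a Chevalley generator and `[B]`. -/
def chevG (i j : Fin n) (B : Theta n) : Theta n →₀ Qv[X] :=
  ∑ p, if h : OffNonneg (moveMat i j p B.1) then
    Finsupp.single (mkTheta (moveMat i j p B.1) h) (chevPoly i j p (moveMat i j p B.1)) else 0

open Classical in
theorem chevG_sum {N : Type} [AddCommMonoid N] (i j : Fin n) (B : Theta n)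
    (f : Theta n → Qv[X] → N) (h0 : ∀ Z, f Z 0 = 0)
    (hadd : ∀ Z P Q, f Z (P + Q) = f Z P + f Z Q) :
    (chevG i j B).sum f = ∑ p, if h : OffNonneg (moveMat i j p B.1) then
      f (mkTheta (moveMat i j p B.1) h) (chevPoly i j p (moveMat i j p B.1)) else 0 := by
  rw [chevG, ← Finsupp.sum_finsetSum_index h0 hadd]
  refine Finset.sum_congr rfl fun p _ => ?_
  split_ifs with h
  · exact Finsupp.sum_single_index (h0 _)
  · exact Finsupp.sum_zero_index

theorem size_shift {B : Theta n} {s : ℕ} (h : ∀ a, 0 ≤ B.1 a a + s) (a : Fin n) :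
    ((∑ b, shift s B a b : ℕ) : ℤ) = ∑ b, B.1 a b + s := by
  have h1 := toZ_shift h
  have h2 : ∑ b, toZ (shift s B) a b =
      ∑ b, (B.1 + Matrix.diagonal fun _ => (s : ℤ) : Matrix (Fin n) (Fin n) ℤ) a b := by rw [h1]
  simp only [toZ, Matrix.add_apply, Finset.sum_add_distrib, Matrix.diagonal_apply,
    Finset.sum_ite_eq, Finset.mem_univ, if_true] at h2
  rw [← h2]
  push_cast
  rfl

theorem isStableProduct_chev {i j : Fin n} (hij : Adjacent i j) (l : Fin n → ℤ) (B : Theta n)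
    (hl : ∀ a, ∑ b, B.1 a b = l a) : IsStableProduct (chevTheta i j l) B (chevG i j B) := by
  classical
  have hne : i ≠ j := by rintro rfl; unfold Adjacent at hij; omega
  unfold IsStableProduct
  filter_upwards [eventually_pos B 1, eventually_pos (diagTheta l) 1] with s hB hl'
  have hB0 : ∀ a, 0 ≤ B.1 a a + s := fun a => by have := hB a; omega
  simp only [diagTheta, Matrix.diagonal_apply_eq] at hl'
  set m : Fin n → ℕ := fun a => (l a - (if a = j then 1 else 0) + s).toNat with hm
  have hmz : ∀ a, (m a : ℤ) = l a - (if a = j then 1 else 0) + s := by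
    intro a
    have := hl' a
    rw [hm, Int.toNat_of_nonneg]
    split_ifs <;> omega
  have hX : shift s (chevTheta i j l) = chevNat i j m := by
    ext a b
    simp only [shift, chevTheta, chevNat_apply, Matrix.add_apply, Matrix.diagonal_apply,
      Matrix.single_apply, Pi.sub_apply, Pi.single_apply]
    have h1 := hmz a
    by_cases hab : a = b
    · subst hab
      have h2 : ¬ (i = a ∧ j = a) := fun h => hne (h.1.trans h.2.symm)
      have h3 : ¬ (a = i ∧ a = j) := fun h => hne (h.1.symm.trans h.2)
      simp only [if_true, if_neg h2, if_neg h3, add_zero, hm]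
    · simp only [if_neg hab, zero_add, add_zero]
      by_cases h2 : a = i ∧ b = j
      · rw [if_pos h2, if_pos ⟨h2.1.symm, h2.2.symm⟩]; rfl
      · rw [if_neg h2, if_neg fun h => h2 ⟨h.1.symm, h.2.symm⟩]; rfl
  have hmB : ∀ a, m a + (if a = j then 1 else 0) = ∑ b, shift s B a b := by
    intro a
    have h1 := size_shift hB0 a
    have h2 := hmz a
    rw [hl a] at h1
    split_ifs at h2 ⊢ <;> omega
  have hsize : size (chevNat i j m) = size (shift s B) := by
    rw [size_chevNat, size, ← Finset.sum_congr rfl fun a _ => hmB a, Finset.sum_add_distrib]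
    simp
  rw [hX, chevG_sum _ _ _ _ (by simp) (by simp)]
  ext1 D
  rw [schurMul_apply, schur_chevNat hij hmB, Finsupp.finsetSum_apply]
  have hsz : ∀ p, shift s B + Matrix.single i p 1 = D + Matrix.single j p 1 →
      size D = size (chevNat i j m) := by
    intro p h
    have h1 : ∀ (k : Fin n), size (Matrix.single k p 1 : Matrix (Fin n) (Fin n) ℕ) = 1 := by
      intro k
      simp [size, Matrix.single_apply, ite_and]
    have h2 : ∀ M N : Matrix (Fin n) (Fin n) ℕ, size (M + N) = size M + size N := by
      intro M N
      simp [size, Finset.sum_add_distrib]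
    have h3 := congrArg size h
    rw [h2, h2, h1, h1] at h3
    omega
  have hL : (if size D = size (chevNat i j m) then
      ∑ p, if shift s B + Matrix.single i p 1 = D + Matrix.single j p 1 then
        chevCoeff i j p (toZ D) else 0 else 0) =
      ∑ p, if shift s B + Matrix.single i p 1 = D + Matrix.single j p 1 then
        chevCoeff i j p (toZ D) else 0 := by
    split_ifs with h
    · rfl
    · exact (Finset.sum_eq_zero fun p _ => if_neg fun h' => h (hsz p h')).symm
  rw [hL]
  refine Finset.sum_congr rfl fun p _ => ?_
  have hiff : shift s B + Matrix.single i p 1 = D + Matrix.single j p 1 ↔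
      moveMat i j p B.1 + Matrix.diagonal (fun _ => (s : ℤ)) = toZ D := by
    rw [← toZ_injective.eq_iff, toZ_add, toZ_add, toZ_single, toZ_single, toZ_shift hB0, moveMat]
    constructor
    · intro h
      rw [← add_sub_cancel_right (toZ D), ← h]
      abel
    · intro h
      rw [← h]
      abel
  by_cases hv : OffNonneg (moveMat i j p B.1)
  · rw [dif_pos hv, eval_chevPoly hij]
    have hZ : ∀ a, 0 ≤ (mkTheta (moveMat i j p B.1) hv).1 a a + s := by
      intro a
      have := hB a
      simp only [mkTheta_val, moveMat_apply]
      split_ifs <;> omega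
    have hsh : shift s (mkTheta _ hv) = D ↔
        moveMat i j p B.1 + Matrix.diagonal (fun _ => (s : ℤ)) = toZ D := by
      rw [← toZ_injective.eq_iff, toZ_shift hZ, mkTheta_val]
    rw [Finsupp.single_apply]
    by_cases h : moveMat i j p B.1 + Matrix.diagonal (fun _ => (s : ℤ)) = toZ D
    · rw [if_pos (hiff.2 h), if_pos (hsh.2 h), h]
    · rw [if_neg (fun h' => h (hiff.1 h')), if_neg (fun h' => h (hsh.1 h'))]
  -- A negative off-diagonal entry is untouched by the shift, so no matrix over `ℕ` can match.
  · rw [dif_neg hv, if_neg]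
    · rfl
    · intro h
      refine hv fun a b hab => ?_
      have h1 := congrFun (congrFun (hiff.1 h) a) b
      rw [Matrix.add_apply, Matrix.diagonal_apply_ne _ hab, add_zero, toZ] at h1
      rw [h1]
      exact Int.natCast_nonneg _

theorem sum_col_chevTheta (i j : Fin n) (l : Fin n → ℤ) (k : Fin n) :
    ∑ a, (chevTheta i j l).1 a k = l k := by
  simp only [chevTheta, Matrix.add_apply, Finset.sum_add_distrib, Matrix.diagonal_apply,
    Matrix.single_apply, Pi.sub_apply, Pi.single_apply]
  by_cases hk : k = j
  · simp [hk]
  · simp [hk, Ne.symm hk]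

theorem shift_col_sum {B : Theta n} {s : ℕ} (h : ∀ a, 0 ≤ B.1 a a + s) (k : Fin n) :
    ((∑ a, shift s B a k : ℕ) : ℤ) = ∑ a, B.1 a k + s := by
  have h1 := toZ_shift h
  have h2 : ∑ a, toZ (shift s B) a k =
      ∑ a, (B.1 + Matrix.diagonal fun _ => (s : ℤ) : Matrix (Fin n) (Fin n) ℤ) a k := by rw [h1]
  simp only [toZ, Matrix.add_apply, Finset.sum_add_distrib, Matrix.diagonal_apply,
    Finset.sum_ite_eq', Finset.mem_univ, if_true] at h2
  rw [← h2]
  push_cast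
  rfl

theorem isStableProduct_zero (A B : Theta n) (k : Fin n)
    (h : ∑ a, A.1 a k ≠ ∑ b, B.1 k b) : IsStableProduct A B 0 := by
  unfold IsStableProduct
  filter_upwards [eventually_pos A 0, eventually_pos B 0] with s hA hB
  rw [schurMul_eq_zero k, Finsupp.sum_zero_index]
  intro h'
  have h1 := shift_col_sum hA k
  have h2 := size_shift hB k
  rw [h'] at h1
  exact h (by omega)

open Classical in
/-- The coefficient of `x` at `[M]`, for a matrix `M` over `ℤ`. -/
def Udot.cf (x : Udot n) (M : Matrix (Fin n) (Fin n) ℤ) : Qv :=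
  if h : OffNonneg M then x.coeff (mkTheta M h) else 0

theorem Udot.cf_theta (x : Udot n) (A : Theta n) : x.cf A.1 = x.coeff A := dif_pos A.2

open Classical in
theorem coeff_stdMul_chev {i j : Fin n} (hij : Adjacent i j) (l : Fin n → ℤ) (B Z : Theta n) :
    (stdMul (chevTheta i j l) B).coeff Z = if ∀ a, ∑ b, B.1 a b = l a then
      ∑ p, if moveMat i j p B.1 = Z.1 then chevCoeff i j p Z.1 else 0 else 0 := by
  have hne : i ≠ j := by rintro rfl; unfold Adjacent at hij; omega
  split_ifs with h
  · rw [(isStableProduct_chev hij l B h).stdMul_eq, chevG_sum _ _ _ _ (by simp)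
      (by simp [add_smul]), Udot.coeff_sum]
    refine Finset.sum_congr rfl fun p _ => ?_
    split_ifs with h1 h2 h2
    · rw [Udot.coeff_smul, Udot.coeff_std, if_pos (Theta.ext' h2), eval_one_chevPoly, mul_one, h2]
    · rw [Udot.coeff_smul, Udot.coeff_std, if_neg (show mkTheta _ h1 ≠ Z from fun h' =>
        h2 (congrArg Subtype.val h')), mul_zero]
    · exact absurd (h2 ▸ Z.2 : OffNonneg (moveMat i j p B.1)) h1
    · rfl
  · obtain ⟨k, hk⟩ := not_forall.1 h
    rw [(isStableProduct_zero _ B k (by rw [sum_col_chevTheta]; exact Ne.symm hk)).stdMul_eq,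
      Finsupp.sum_zero_index]
    rfl

open Classical in
/-- The action of a Chevalley generator in the coordinates of the standard basis. -/
theorem coeff_chev_mul {i j : Fin n} (hij : Adjacent i j) (l : Fin n → ℤ) (x : Udot n)
    (Z : Theta n) :
    (std (chevTheta i j l) * x).coeff Z =
      if ∀ a, ∑ b, Z.1 a b = l a + (if a = i then 1 else 0) - (if a = j then 1 else 0) then
        ∑ p, chevCoeff i j p Z.1 * x.cf (moveMat j i p Z.1) else 0 := by
  have hmove : ∀ (B : Theta n) (p : Fin n), moveMat i j p B.1 = Z.1 →
      ((∀ a, ∑ b, B.1 a b = l a) ↔ ∀ a, ∑ b, Z.1 a b =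
        l a + (if a = i then 1 else 0) - (if a = j then 1 else 0)) := by
    intro B p h
    rw [← h]
    refine forall_congr' fun a => ?_
    have : ∑ b, moveMat i j p B.1 a b =
        ∑ b, B.1 a b + (if a = i then 1 else 0) - (if a = j then 1 else 0) := by
      simp only [moveMat_apply, Finset.sum_sub_distrib, Finset.sum_add_distrib, ite_and]
      congr 1
      · congr 1
        split_ifs <;> simp
      · split_ifs <;> simp
    rw [this]
    constructor
    · intro h; rw [h]
    · intro h; linarith
  have hx : (std (chevTheta i j l) * x).coeff Z =
      ∑ B ∈ (show Theta n →₀ Qv from x).support,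
        x.coeff B * (stdMul (chevTheta i j l) B).coeff Z := by
    conv_lhs => rw [Udot.eq_sum_std x, Udot.mul_sum', Udot.coeff_sum]
    refine Finset.sum_congr rfl fun B _ => ?_
    rw [Udot.mul_smul', Udot.coeff_smul, Udot.std_mul_std]
  rw [hx]
  simp only [coeff_stdMul_chev hij]
  split_ifs with hZ
  -- For `Z` with the right row sums, the row condition on `B` is automatic whenever `B` moves to
  -- `Z`. The sum can then be indexed by the column `p` instead of by `B`.
  · have h1 : ∀ B : Theta n, (if ∀ a, ∑ b, B.1 a b = l a then
        ∑ p, if moveMat i j p B.1 = Z.1 then chevCoeff i j p Z.1 else 0 else 0) =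
        ∑ p, if moveMat i j p B.1 = Z.1 then chevCoeff i j p Z.1 else 0 := by
      intro B
      split_ifs with h
      · rfl
      · exact (Finset.sum_eq_zero fun p _ => if_neg fun h' => h ((hmove B p h').2 hZ)).symm
    simp only [h1, Finset.mul_sum]
    rw [Finset.sum_comm]
    refine Finset.sum_congr rfl fun p _ => ?_
    have h2 : ∀ B : Theta n, moveMat i j p B.1 = Z.1 ↔ B.1 = moveMat j i p Z.1 := by
      intro B
      constructor
      · intro h; rw [← h, moveMat_moveMat]
      · intro h; rw [h, moveMat_moveMat]
    simp only [h2]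
    unfold Udot.cf
    split_ifs with hv
    · rw [Finset.sum_eq_single (mkTheta (moveMat j i p Z.1) hv)]
      · rw [if_pos (mkTheta_val _ hv), mul_comm]
      · intro B _ hB
        have h3 : B.1 ≠ moveMat j i p Z.1 := fun h => hB (Theta.ext' h)
        rw [if_neg h3, mul_zero]
      · intro h
        have h3 : x.coeff (mkTheta (moveMat j i p Z.1) hv) = 0 := Finsupp.notMem_support_iff.1 h
        simp [h3]
    · rw [mul_zero]
      refine Finset.sum_eq_zero fun B _ => ?_
      rw [if_neg fun h => hv (by rw [← h]; exact B.2), mul_zero]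
  · refine Finset.sum_eq_zero fun B _ => ?_
    split_ifs with h
    · rw [Finset.sum_eq_zero fun p _ => if_neg fun h' => hZ ((hmove B p h').1 h), mul_zero]
    · rw [mul_zero]

end Action

/-! ### The bar involution of the scalars -/

theorem barHom_X (k : Type) [Field k] : barHom k RatFunc.X = (RatFunc.X)⁻¹ := by
  have h := congrArg (barHom k) (RatFunc.algebraMap_X (K := k)).symm
  exact h.trans ((RatFunc.liftRingHom_algebraMap _ _ _).trans (aeval_X _))

theorem barQv_v : barQv v = v⁻¹ := barHom_X ℚ

theorem barQv_inv_v : barQv v⁻¹ = v := by rw [map_inv₀, barQv_v, inv_inv]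

theorem barQv_zpow (k : ℤ) : barQv (v ^ k) = v ^ (-k) := by
  rw [map_zpow₀, barQv_v, inv_zpow, zpow_neg]

theorem barQv_qint (m : ℤ) : barQv (qint m) = qint m := by
  rw [qint, map_div₀, map_sub, map_sub, barQv_zpow, barQv_zpow, barQv_v, barQv_inv_v, neg_neg,
    ← neg_div_neg_eq, neg_sub, neg_sub]

theorem intDegree_v : RatFunc.intDegree v = 1 := RatFunc.intDegree_X

theorem intDegree_inv_v : RatFunc.intDegree v⁻¹ = -1 := by
  rw [RatFunc.intDegree_inv, intDegree_v]

theorem intDegree_of_mem_closure {y : Qv} (hy : y ∈ Subring.closure {v⁻¹}) :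
    y = 0 ∨ RatFunc.intDegree y ≤ 0 := by
  induction hy using Subring.closure_induction with
  | mem x hx =>
    rw [Set.mem_singleton_iff] at hx
    rw [hx, intDegree_inv_v]
    right; norm_num
  | zero => exact Or.inl rfl
  | one => right; rw [RatFunc.intDegree_one]
  | add x y _ _ hx hy =>
    by_cases hy0 : y = 0
    · simpa [hy0] using hx
    by_cases hx0 : x = 0
    · simpa [hx0] using hy
    by_cases hxy : x + y = 0
    · exact Or.inl hxy
    · have h1 := RatFunc.intDegree_add_le hy0 hxy
      right
      exact h1.trans (max_le (hx.resolve_left hx0) (hy.resolve_left hy0))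
  | neg x _ hx => simpa [RatFunc.intDegree_neg] using hx
  | mul x y _ _ hx hy =>
    by_cases hy0 : y = 0
    · simp [hy0]
    by_cases hx0 : x = 0
    · simp [hx0]
    right
    rw [RatFunc.intDegree_mul hx0 hy0]
    have := hx.resolve_left hx0
    have := hy.resolve_left hy0
    omega

theorem intDegree_bar_of_mem_closure {y : Qv} (hy : y ∈ Subring.closure {v⁻¹}) :
    ∃ P : ℚ[X], barQv y = algebraMap ℚ[X] Qv P := by
  induction hy using Subring.closure_induction with
  | mem x hx =>
    rw [Set.mem_singleton_iff] at hx
    exact ⟨X, by rw [hx, barQv_inv_v]; exact RatFunc.algebraMap_X.symm⟩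
  | zero => exact ⟨0, by simp⟩
  | one => exact ⟨1, by simp⟩
  | add x y _ _ hx hy =>
    obtain ⟨P, hP⟩ := hx
    obtain ⟨Q, hQ⟩ := hy
    exact ⟨P + Q, by rw [map_add, map_add, hP, hQ]⟩
  | neg x _ hx =>
    obtain ⟨P, hP⟩ := hx
    exact ⟨-P, by rw [map_neg, map_neg, hP]⟩
  | mul x y _ _ hx hy =>
    obtain ⟨P, hP⟩ := hx
    obtain ⟨Q, hQ⟩ := hy
    exact ⟨P * Q, by rw [map_mul, map_mul, hP, hQ]⟩

/-- A bar-invariant element of `v⁻¹ ℤ[v⁻¹]` is zero. -/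
theorem eq_zero_of_bar {c y : Qv} (hy : y ∈ Subring.closure {v⁻¹}) (hc : c = v⁻¹ * y)
    (hbar : barQv c = c) : c = 0 := by
  by_contra hc0
  have hy0 : y ≠ 0 := by rintro rfl; simp at hc; exact hc0 hc
  -- As `v⁻¹ * y` the element has negative degree; being bar-fixed it is also `v` times the
  -- polynomial `barQv y`, of positive degree.
  have h1 := (intDegree_of_mem_closure hy).resolve_left hy0
  have h2 : RatFunc.intDegree c = -1 + RatFunc.intDegree y := by
    rw [hc, RatFunc.intDegree_mul (inv_ne_zero v_ne_zero) hy0, intDegree_inv_v]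
  obtain ⟨P, hP⟩ := intDegree_bar_of_mem_closure hy
  have h3 : c = v * algebraMap ℚ[X] Qv P := by
    rw [← hbar, hc, map_mul, barQv_inv_v, hP]
  have hP0 : algebraMap ℚ[X] Qv P ≠ 0 := by
    intro h; rw [h, mul_zero] at h3; exact hc0 h3
  have h4 : RatFunc.intDegree c = 1 + P.natDegree := by
    rw [h3, RatFunc.intDegree_mul v_ne_zero hP0, intDegree_v, RatFunc.intDegree_polynomial]
  omega

/-! ### The bar relation and its effect on coefficients. -/

section Bar

variable {n : ℕ}

theorem IsBar.sub {x x' y y' : Udot n} (h : IsBar x x') (h' : IsBar y y') :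
    IsBar (x - y) (x' - y') := by
  have h1 := h.add (h'.smul (-1))
  rwa [map_neg, map_one, neg_smul, neg_smul, one_smul, one_smul, ← sub_eq_add_neg,
    ← sub_eq_add_neg] at h1

theorem not_mem_side (i j p : Fin n) : p ∉ side i j p := by
  unfold side; split_ifs <;> simp

/-- On matrices supported in a single column, the bar involution acts on coefficients alone. -/
theorem IsBar.coeff_of_col {x x' : Udot n} (h : IsBar x x') (k : Fin n) (Z : Theta n)
    (hZ : ∀ a b, b ≠ k → Z.1 a b = 0) : x'.coeff Z = barQv (x.coeff Z) := by
  classical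
  induction h generalizing Z with
  | idem l => rw [Udot.coeff_std]; split_ifs <;> simp
  | add _ _ ih ih' => rw [Udot.coeff_add, Udot.coeff_add, ih Z hZ, ih' Z hZ, map_add]
  | smul c _ ih => rw [Udot.coeff_smul, Udot.coeff_smul, ih Z hZ, map_mul]
  | gen_mul i j hij l _ ih =>
    rw [coeff_chev_mul hij, coeff_chev_mul hij]
    split_ifs
    · rw [map_sum]
      refine Finset.sum_congr rfl fun p _ => ?_
      -- In column `k` the exponent only sees the other columns, which vanish, so the coefficient is
      -- a bar-invariant quantum integer. In any other column the coefficient contains `[0] = 0`.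
      by_cases hp : p = k
      · subst hp
        have h1 : chevCoeff i j p Z.1 = qint (Z.1 i p) := by
          rw [chevCoeff, Finset.sum_eq_zero, zpow_zero, one_mul]
          intro b hb
          have hbp : b ≠ p := by rintro rfl; exact not_mem_side _ _ _ hb
          rw [hZ i b hbp, hZ j b hbp, sub_zero]
        rw [map_mul, h1, barQv_qint]
        congr 1
        unfold Udot.cf
        split_ifs with hv
        · refine ih _ fun a b hb => ?_
          simp [mkTheta_val, moveMat_apply, hZ a b hb, hb]
        · simp
      · have h1 : chevCoeff i j p Z.1 = 0 := by
          rw [chevCoeff, hZ i p hp, qint_zero, mul_zero]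
        simp [h1]
    · simp

open Classical in
theorem stdMul_chev {i j : Fin n} (hij : Adjacent i j) (l : Fin n → ℤ) (B : Theta n)
    (hl : ∀ a, ∑ b, B.1 a b = l a) : std (chevTheta i j l) * std B =
      ∑ p, if h : OffNonneg (moveMat i j p B.1) then
        chevCoeff i j p (moveMat i j p B.1) • std (mkTheta _ h) else 0 := by
  rw [Udot.std_mul_std, (isStableProduct_chev hij l B hl).stdMul_eq, chevG_sum _ _ _ _ (by simp)
    (by simp [add_smul])]
  simp only [eval_one_chevPoly]

theorem Adjacent.ne {i j : Fin n} (h : Adjacent i j) : i ≠ j := by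
  rintro rfl; unfold Adjacent at h; omega

theorem chev_mul_diag {i j : Fin n} (hij : Adjacent i j) (l : Fin n → ℤ) :
    std (chevTheta i j l) * std (diagTheta l) = std (chevTheta i j l) := by
  classical
  have hne := hij.ne
  rw [stdMul_chev hij l _ (by simp [diagTheta, Matrix.diagonal_apply]), Finset.sum_eq_single j]
  · have h1 : moveMat i j j (diagTheta l).1 = (chevTheta i j l).1 := by
      ext a b
      simp only [moveMat_apply, diagTheta, chevTheta, Matrix.add_apply, Matrix.diagonal_apply,
        Matrix.single_apply, Pi.sub_apply, Pi.single_apply, eq_comm]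
      split_ifs <;> grind
    have h2 : OffNonneg (moveMat i j j (diagTheta l).1) := by rw [h1]; exact (chevTheta i j l).2
    have h3 : mkTheta _ h2 = chevTheta i j l := Theta.ext' h1
    rw [dif_pos h2, h3, h1]
    have h4 : chevCoeff i j j (chevTheta i j l).1 = 1 := by
      rw [chevCoeff, Finset.sum_eq_zero, zpow_zero, one_mul]
      · simp [chevTheta, Matrix.diagonal_apply_ne _ hne, qint_one]
      · intro b hb
        have hbj : b ≠ j := by rintro rfl; exact not_mem_side _ _ _ hb
        have hbi : b ≠ i := by
          rintro rfl
          unfold side at hb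
          unfold Adjacent at hij
          split_ifs at hb with h
          · exact lt_asymm h (Finset.mem_Iio.1 hb)
          · rw [Finset.mem_Ioi] at hb; simp only [Fin.lt_def] at hb h; omega
        simp [chevTheta, Matrix.diagonal_apply_ne _ hbi.symm, hbj.symm]
    rw [h4, one_smul]
  · intro p _ hp
    rw [dif_neg]
    intro h
    have h1 := h j p hp.symm
    simp [moveMat_apply, diagTheta, Matrix.diagonal_apply_ne _ hp.symm, hne.symm] at h1
  · simp

theorem isBar_chev {i j : Fin n} (hij : Adjacent i j) (l : Fin n → ℤ) :
    IsBar (std (chevTheta i j l)) (std (chevTheta i j l)) := by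
  have h := IsBar.gen_mul i j hij l (IsBar.idem l)
  rwa [chev_mul_diag hij] at h

/-! ### Uniqueness of BLM basis elements -/

/-- An element which measures the failure of uniqueness of `{A}`. -/
def IsDefect (A : Theta n) (z : Udot n) : Prop :=
  IsBar z z ∧ ∀ B, (∃ y ∈ Subring.closure {v⁻¹}, z.coeff B = v⁻¹ * y) ∧
    (z.coeff B ≠ 0 → B ≠ A ∧ Below B A)

theorem IsBLM.isDefect {A : Theta n} {x y : Udot n} (hx : IsBLM A x) (hy : IsBLM A y) :
    IsDefect A (x - y) := by
  refine ⟨hx.1.sub hy.1, fun B => ?_⟩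
  rw [Udot.coeff_sub]
  by_cases hB : B = A
  · subst hB
    rw [hx.2.1, hy.2.1, sub_self]
    exact ⟨⟨0, Subring.zero_mem _, by simp⟩, fun h => absurd rfl h⟩
  · obtain ⟨⟨w, hw, hxw⟩, hx2⟩ := hx.2.2 B hB
    obtain ⟨⟨w', hw', hyw⟩, hy2⟩ := hy.2.2 B hB
    refine ⟨⟨w - w', Subring.sub_mem _ hw hw', by rw [hxw, hyw]; ring⟩, fun h => ⟨hB, ?_⟩⟩
    by_cases h0 : x.coeff B = 0
    · refine hy2 fun h1 => h ?_
      rw [h0, h1, sub_zero]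
    · exact hx2 h0

/-- Reduces uniqueness of `{A}` to the vanishing of its defects, which can be checked coefficient by
coefficient without knowing that `IsBar` is a function. -/
theorem blm_eq {A : Theta n} {x : Udot n} (hx : IsBLM A x) (h : ∀ z, IsDefect A z → z = 0) :
    blm A = x := by
  have hex : ∃! x, IsBLM A x :=
    ⟨x, hx, fun y hy => sub_eq_zero.1 (h _ (hy.isDefect hx))⟩
  rw [blm, dif_pos hex]
  exact hex.unique hex.choose_spec.1 hx

theorem isBLM_std {A : Theta n} (h : IsBar (std A) (std A)) : IsBLM A (std A) := by
  refine ⟨h, by rw [Udot.coeff_std, if_pos rfl], fun B hB => ?_⟩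
  rw [Udot.coeff_std, if_neg hB.symm]
  exact ⟨⟨0, Subring.zero_mem _, by simp⟩, fun h => absurd rfl h⟩

/-- A nonzero value rules out the default `0`, which `blm` takes when unique existence fails. -/
theorem isBLM_of_blm_ne_zero {A : Theta n} (h : blm A ≠ 0) : IsBLM A (blm A) := by
  by_cases hex : ∃! x, IsBLM A x
  · rw [blm, dif_pos hex]
    exact hex.choose_spec.1
  · rw [blm, dif_neg hex] at h
    exact absurd rfl h

theorem IsDefect.coeff_eq_zero_of_bar {A : Theta n} {z : Udot n} (h : IsDefect A z) (B : Theta n)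
    (hB : barQv (z.coeff B) = z.coeff B) : z.coeff B = 0 := by
  obtain ⟨⟨y, hy, hc⟩, _⟩ := h.2 B
  exact eq_zero_of_bar hy hc hB

/-! ### The order on `Θ̃` -/

theorem Below.trans {A B D : Theta n} (h : Below A B) (h' : Below B D) : Below A D :=
  ⟨fun i => (h.1 i).trans (h'.1 i), fun i => (h.2.1 i).trans (h'.2.1 i),
    fun i j hij => (h.2.2.1 i j hij).trans (h'.2.2.1 i j hij),
    fun i j hij => (h.2.2.2 i j hij).trans (h'.2.2.2 i j hij)⟩

/-- Induction starting from the north-east corner: the sum at `(i, j)` consists of that entry and of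
entries strictly nearer to the corner. -/
theorem eq_zero_of_upper_corners (M : Matrix (Fin n) (Fin n) ℤ)
    (h : ∀ i j, i < j → ∑ r ∈ Finset.Iic i, ∑ s ∈ Finset.Ici j, M r s = 0) (i j : Fin n)
    (hij : i < j) : M i j = 0 := by
  induction hk : (i : ℕ) + (n - j) using Nat.strong_induction_on generalizing i j with
  | _ k ih =>
    have h1 := h i j hij
    rw [Finset.sum_eq_single i, Finset.sum_eq_single j] at h1
    · exact h1
    · intro s hs hsj
      rw [Finset.mem_Ici] at hs
      have hs' : j < s := lt_of_le_of_ne hs hsj.symm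
      refine ih _ ?_ i s (hij.trans hs') rfl
      have := s.isLt
      simp only [Fin.lt_def] at hs'
      omega
    · simp
    · intro r hr hri
      rw [Finset.mem_Iic] at hr
      have hr' : r < i := lt_of_le_of_ne hr hri
      refine Finset.sum_eq_zero fun s hs => ?_
      rw [Finset.mem_Ici] at hs
      refine ih _ ?_ r s (hr'.trans (hij.trans_le hs)) rfl
      simp only [Fin.lt_def, Fin.le_def] at hr' hs
      omega
    · simp

/-- Equal corner sums force equal off-diagonal entries, and the row sums then force equal diagonals.
-/
theorem Below.antisymm {A B : Theta n} (h : Below A B) (h' : Below B A) : A = B := by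
  have hup : ∀ i j, i < j → A.1 i j = B.1 i j := fun i j hij => by
    have := eq_zero_of_upper_corners (A.1 - B.1) (fun i j hij => by
      simp only [Matrix.sub_apply, Finset.sum_sub_distrib]
      have := h.2.2.1 i j hij
      have := h'.2.2.1 i j hij
      omega) i j hij
    rw [Matrix.sub_apply] at this
    omega
  have hlow : ∀ i j, j < i → A.1 i j = B.1 i j := fun i j hij => by
    have := eq_zero_of_upper_corners (A.1 - B.1).transpose (fun j i hij => by
      simp only [Matrix.transpose_apply, Matrix.sub_apply, Finset.sum_sub_distrib]
      rw [Finset.sum_comm, Finset.sum_comm (s := Finset.Iic j)]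
      have := h.2.2.2 i j hij
      have := h'.2.2.2 i j hij
      omega) j i hij
    rw [Matrix.transpose_apply, Matrix.sub_apply] at this
    omega
  refine Theta.ext' ?_
  ext i j
  rcases lt_trichotomy i j with hij | hij | hij
  · exact hup i j hij
  · subst hij
    have h1 := h.1 i
    rw [← Finset.add_sum_erase _ _ (Finset.mem_univ i),
      ← Finset.add_sum_erase _ (fun j => B.1 i j) (Finset.mem_univ i)] at h1
    have h2 : ∑ j ∈ Finset.univ.erase i, A.1 i j = ∑ j ∈ Finset.univ.erase i, B.1 i j := by
      refine Finset.sum_congr rfl fun j hj => ?_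
      rcases lt_or_gt_of_ne (Finset.ne_of_mem_erase hj) with hlt | hlt
      · exact hlow i j hlt
      · exact hup i j hlt
    omega
  · exact hlow i j hij

/-- The nonzero elements `{A}` are linearly independent. -/
theorem blm_independent (c : Theta n →₀ Qv) (h : (c.sum fun Z a => a • blm Z) = 0) (Z : Theta n)
    (hZ : blm Z ≠ 0) : c Z = 0 := by
  classical
  by_contra hc
  let T : Finset (Theta n) := c.support.filter fun Z => blm Z ≠ 0
  have hT : Z ∈ T := Finset.mem_filter.2 ⟨Finsupp.mem_support_iff.2 hc, hZ⟩
  let P : PartialOrder (Theta n) :=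
    { le := fun A B => Below A B
      le_refl := fun A => ⟨fun _ => rfl, fun _ => rfl, fun _ _ _ => le_rfl, fun _ _ _ => le_rfl⟩
      le_trans := fun _ _ _ => Below.trans
      le_antisymm := fun _ _ => Below.antisymm }
  -- By triangularity and the maximality of `M`, no other nonzero `{D}` in the sum has a coefficient
  -- at `[M]`, so `c M` can be read off there.
  obtain ⟨M, hM, hmax⟩ := T.exists_maximal ⟨Z, hT⟩
  have hM' := Finset.mem_filter.1 hM
  have h1 : (c.sum fun Z a => a • blm Z).coeff M = 0 := by rw [h]; rfl
  rw [Finsupp.sum, Udot.coeff_sum, Finset.sum_eq_single M] at h1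
  · rw [Udot.coeff_smul, (isBLM_of_blm_ne_zero hM'.2).2.1, mul_one] at h1
    exact Finsupp.mem_support_iff.1 hM'.1 h1
  · intro D hD hne
    rw [Udot.coeff_smul]
    by_cases h0 : blm D = 0
    · rw [h0, Udot.coeff_zero, mul_zero]
    · by_cases h2 : (blm D).coeff M = 0
      · rw [h2, mul_zero]
      · have h3 : Below M D := ((isBLM_of_blm_ne_zero h0).2.2 M hne.symm).2 h2
        have h4 : Below D M := hmax (Finset.mem_filter.2 ⟨hD, h0⟩) h3
        exact absurd (Below.antisymm h4 h3) hne
  · intro h2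
    exact absurd hM'.1 h2

end Bar

/-! ### Nonpositive scalars -/

theorem exists_natPoly_of_mem_NLaurent {x : Qv} (hx : x ∈ NLaurent) :
    ∃ (k : ℕ) (Q : ℕ[X]), x * v ^ k = algebraMap ℚ[X] Qv (Q.map (Nat.castRingHom ℚ)) := by
  have hv : algebraMap ℚ[X] Qv X = v := RatFunc.algebraMap_X
  induction hx using Subsemiring.closure_induction with
  | mem x hx =>
    rcases hx with rfl | hx
    · exact ⟨0, X, by simp [hv]⟩
    · rw [Set.mem_singleton_iff] at hx
      exact ⟨1, 1, by simp [hx, v_ne_zero]⟩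
  | zero => exact ⟨0, 0, by simp⟩
  | one => exact ⟨0, 1, by simp⟩
  | add x y _ _ hx hy =>
    obtain ⟨k, Q, hQ⟩ := hx
    obtain ⟨m, R, hR⟩ := hy
    refine ⟨k + m, Q * X ^ m + R * X ^ k, ?_⟩
    simp only [Polynomial.map_add, Polynomial.map_mul, Polynomial.map_pow, map_X, map_add, map_mul,
      map_pow, ← hQ, ← hR, hv]
    ring
  | mul x y _ _ hx hy =>
    obtain ⟨k, Q, hQ⟩ := hx
    obtain ⟨m, R, hR⟩ := hy
    refine ⟨k + m, Q * R, ?_⟩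
    simp only [Polynomial.map_mul, map_mul, ← hQ, ← hR]
    ring

theorem neg_one_notMem_NLaurent : (-1 : Qv) ∉ NLaurent := by
  intro h
  obtain ⟨k, Q, hQ⟩ := exists_natPoly_of_mem_NLaurent h
  have hv : algebraMap ℚ[X] Qv X = v := RatFunc.algebraMap_X
  have h1 : algebraMap ℚ[X] Qv (-X ^ k) = algebraMap ℚ[X] Qv (Q.map (Nat.castRingHom ℚ)) := by
    rw [← hQ, map_neg, map_pow, hv]
    ring
  have h2 := congrArg (fun P => P.coeff k) (RatFunc.algebraMap_injective ℚ h1)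
  simp only [coeff_neg, coeff_X_pow, if_true, coeff_map, eq_natCast] at h2
  have h3 : (0 : ℚ) ≤ (Q.coeff k : ℚ) := Nat.cast_nonneg _
  rw [← h2] at h3
  norm_num at h3

section Block

variable {n : ℕ}

/-! ### Matrices that are diagonal outside a two by two block -/

/-- The off-diagonal entries other than those at `(i, j)` and `(j, i)` vanish. -/
def TwoBlock (i j : Fin n) (M : Matrix (Fin n) (Fin n) ℤ) : Prop :=
  ∀ r s, r ≠ s → ¬ (r = i ∧ s = j) → ¬ (r = j ∧ s = i) → M r s = 0

/-- The matrix obtained by moving `t` from the off-diagonal to the diagonal entries of a block. -/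
def shear (i j : Fin n) (t : ℤ) (M : Matrix (Fin n) (Fin n) ℤ) : Matrix (Fin n) (Fin n) ℤ :=
  fun a b => M a b + (if a = b ∧ (a = i ∨ a = j) then t else 0) -
    if (a = i ∧ b = j) ∨ (a = j ∧ b = i) then t else 0

theorem TwoBlock.sum_row {i j : Fin n} (hij : i ≠ j) {M : Matrix (Fin n) (Fin n) ℤ}
    (h : TwoBlock i j M) : ∑ b, M i b = M i i + M i j :=
  Fintype.sum_eq_add _ _ hij fun _ hb =>
    h _ _ hb.1.symm (fun h => hb.2 h.2) fun h => hij h.1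

theorem TwoBlock.symm {i j : Fin n} {M : Matrix (Fin n) (Fin n) ℤ} (h : TwoBlock i j M) :
    TwoBlock j i M := fun r s h1 h2 h3 => h r s h1 h3 h2

theorem TwoBlock.transpose {i j : Fin n} {M : Matrix (Fin n) (Fin n) ℤ} (h : TwoBlock i j M) :
    TwoBlock i j M.transpose := fun r s h1 h2 h3 =>
  h s r h1.symm (fun h => h3 h.symm) fun h => h2 h.symm

theorem TwoBlock.sum_row_other {i j k : Fin n} {M : Matrix (Fin n) (Fin n) ℤ}
    (h : TwoBlock i j M) (hi : k ≠ i) (hj : k ≠ j) : ∑ b, M k b = M k k :=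
  Fintype.sum_eq_single _ fun _ hb =>
    h _ _ hb.symm (fun h => hi h.1) fun h => hj h.1

theorem le_corner {M : Matrix (Fin n) (Fin n) ℤ} (hM : OffNonneg M) {r s : Fin n} (hrs : r < s) :
    M r s ≤ ∑ r' ∈ Finset.Iic r, ∑ s' ∈ Finset.Ici s, M r' s' := by
  have hpos : ∀ r' ∈ Finset.Iic r, ∀ s' ∈ Finset.Ici s, 0 ≤ M r' s' := fun r' hr s' hs =>
    hM _ _ (ne_of_lt (lt_of_le_of_lt (Finset.mem_Iic.1 hr)
      (lt_of_lt_of_le hrs (Finset.mem_Ici.1 hs))))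
  calc M r s ≤ ∑ s' ∈ Finset.Ici s, M r s' :=
        Finset.single_le_sum (f := fun s' => M r s') (hpos r (by simp)) (by simp)
    _ ≤ _ := Finset.single_le_sum (f := fun r' => ∑ s' ∈ Finset.Ici s, M r' s')
        (fun r' hr => Finset.sum_nonneg (hpos r' hr)) (by simp)

/-- With the block in the first two rows and columns, the only corner region `r < s` that meets it
above the diagonal is the one at `(0, 1)`. -/
theorem corner_twoBlock {i j : Fin n} (hi : (i : ℕ) = 0) (hj : (j : ℕ) = 1)
    {M : Matrix (Fin n) (Fin n) ℤ} (h : TwoBlock i j M) {r s : Fin n} (hrs : r < s) :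
    ∑ r' ∈ Finset.Iic r, ∑ s' ∈ Finset.Ici s, M r' s' =
      if r = i ∧ s = j then M i j else 0 := by
  have hz : ∀ r' ∈ Finset.Iic r, ∀ s' ∈ Finset.Ici s,
      M r' s' = if r = i ∧ s = j then (if r' = i ∧ s' = j then M i j else 0) else 0 := by
    intro r' hr s' hs
    rw [Finset.mem_Iic] at hr
    rw [Finset.mem_Ici] at hs
    have hlt := lt_of_le_of_lt hr (lt_of_lt_of_le hrs hs)
    by_cases h1 : r' = i ∧ s' = j
    · rw [if_pos h1, if_pos, h1.1, h1.2]
      obtain ⟨rfl, rfl⟩ := h1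
      simp only [Fin.le_def, Fin.lt_def, Fin.ext_iff] at *
      omega
    · rw [if_neg h1, ite_self]
      refine h _ _ hlt.ne h1 fun h2 => ?_
      obtain ⟨rfl, rfl⟩ := h2
      simp only [Fin.lt_def] at hlt
      omega
  rw [Finset.sum_congr rfl fun r' hr => Finset.sum_congr rfl fun s' hs => hz r' hr s' hs]
  split_ifs with h1
  · obtain ⟨rfl, rfl⟩ := h1
    simp [ite_and]
  · simp

theorem upper_of_corner_le {i j : Fin n} (hi : (i : ℕ) = 0) (hj : (j : ℕ) = 1)
    {M N : Matrix (Fin n) (Fin n) ℤ} (hN : OffNonneg N) (h : TwoBlock i j M)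
    (hc : ∀ r s, r < s → ∑ r' ∈ Finset.Iic r, ∑ s' ∈ Finset.Ici s, N r' s' ≤
      ∑ r' ∈ Finset.Iic r, ∑ s' ∈ Finset.Ici s, M r' s') (r s : Fin n) (hrs : r < s) :
    N r s ≤ if r = i ∧ s = j then M i j else 0 := by
  rw [← corner_twoBlock hi hj h hrs]
  exact (le_corner hN hrs).trans (hc r s hrs)

/-- All corner sums of `A` outside the block vanish, so nonnegativity makes `B` diagonal outside the
block too. Equal row and column sums leave one free parameter, and the matrices below `A` form a
chain. -/
theorem Below.exists_shear {i j : Fin n} (hi : (i : ℕ) = 0) (hj : (j : ℕ) = 1) {A B : Theta n}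
    (hA : TwoBlock i j A.1) (h : Below B A) :
    ∃ t, 0 ≤ t ∧ t ≤ A.1 i j ∧ t ≤ A.1 j i ∧ B.1 = shear i j t A.1 := by
  have hne : i ≠ j := by rintro rfl; omega
  have hlt : i < j := by simp only [Fin.lt_def]; omega
  have hup := upper_of_corner_le hi hj (N := B.1) B.2 hA h.2.2.1
  have hlow := upper_of_corner_le hi hj (N := B.1.transpose)
    (fun r s hrs => B.2 s r hrs.symm) hA.transpose (fun r s hrs => by
      simp only [Matrix.transpose_apply]
      rw [Finset.sum_comm, Finset.sum_comm (s := Finset.Iic r)]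
      exact h.2.2.2 s r hrs)
  have hB : TwoBlock i j B.1 := by
    intro r s hrs h1 h2
    refine le_antisymm ?_ (B.2 r s hrs)
    rcases lt_or_gt_of_ne hrs with h3 | h3
    · simpa [h1] using hup r s h3
    · have h4 := hlow s r h3
      rwa [if_neg fun h => h2 h.symm] at h4
  have e1 := hup i j hlt
  have e2 := hlow i j hlt
  simp only [and_self, if_true, Matrix.transpose_apply] at e1 e2
  have r1 := h.1 i
  have r2 := h.1 j
  have r3 := h.2.1 i
  rw [hA.sum_row hne, hB.sum_row hne] at r1
  rw [hA.symm.sum_row hne.symm, hB.symm.sum_row hne.symm] at r2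
  have s1 := hA.transpose.sum_row hne
  have s2 := hB.transpose.sum_row hne
  simp only [Matrix.transpose_apply] at s1 s2
  rw [s1, s2] at r3
  have p1 := B.2 i j hne
  have p2 := B.2 j i hne.symm
  refine ⟨A.1 i j - B.1 i j, by omega, by omega, by omega, ?_⟩
  ext a b
  unfold shear
  by_cases hab : a = b
  · subst hab
    by_cases hai : a = i
    · subst hai
      simp only [hne, and_true, and_false, true_or, or_self, if_true, if_false]
      omega
    · by_cases haj : a = j
      · subst haj
        simp only [hne.symm, and_true, and_false, or_true, or_self, if_true, if_false]
        omega
      · have r4 := h.1 a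
        rw [hA.sum_row_other hai haj, hB.sum_row_other hai haj] at r4
        simp [hai, haj, r4]
  · simp only [hab, false_and, if_false]
    by_cases h1 : a = i ∧ b = j
    · obtain ⟨rfl, rfl⟩ := h1
      simp
    · by_cases h2 : a = j ∧ b = i
      · obtain ⟨rfl, rfl⟩ := h2
        simp only [and_self, or_true, if_true]
        omega
      · rw [if_neg (by tauto), hA a b hab h1 h2, hB a b hab h1 h2]
        simp

theorem shear_moveMat {i j : Fin n} (hij : i ≠ j) (M : Matrix (Fin n) (Fin n) ℤ) :
    shear i j 1 (moveMat j i i M) = moveMat j i j M := by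
  ext a b
  simp only [shear, moveMat_apply]
  by_cases h1 : a = i <;> by_cases h2 : a = j <;> by_cases h3 : b = i <;> by_cases h4 : b = j <;>
    subst_vars <;> simp_all [eq_comm]

theorem shear_zero (i j : Fin n) (M : Matrix (Fin n) (Fin n) ℤ) : shear i j 0 M = M := by
  ext a b; simp [shear]

theorem IsDefect.eq_zero_of_twoBlock {i j : Fin n} (hi : (i : ℕ) = 0) (hj : (j : ℕ) = 1)
    {A : Theta n} (hA : TwoBlock i j A.1) {z : Udot n} (hz : IsDefect A z)
    (h : ∀ (t : ℤ) (B : Theta n), 0 < t → t ≤ A.1 i j → t ≤ A.1 j i → B.1 = shear i j t A.1 →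
      z.coeff B = 0) : z = 0 := by
  refine Udot.ext' fun B => ?_
  rw [Udot.coeff_zero]
  by_contra hB
  obtain ⟨h1, h2⟩ := (hz.2 B).2 hB
  obtain ⟨t, t0, t1, t2, ht⟩ := h2.exists_shear hi hj hA
  rcases t0.eq_or_lt with rfl | t0
  · rw [shear_zero] at ht
    exact h1 (Theta.ext' ht)
  · exact hB (h t B t0 t1 t2 ht)

/-- A bar-invariant standard basis element with vanishing upper or lower part of its block is a
BLM basis element. -/
theorem blm_eq_std {i j : Fin n} (hi : (i : ℕ) = 0) (hj : (j : ℕ) = 1) {A : Theta n}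
    (hA : TwoBlock i j A.1) (hbar : IsBar (std A) (std A)) (h0 : A.1 i j ≤ 0 ∨ A.1 j i ≤ 0) :
    blm A = std A :=
  blm_eq (isBLM_std hbar) fun _ hz => hz.eq_zero_of_twoBlock hi hj hA fun t B t0 t1 t2 _ => by
    exfalso; omega

theorem twoBlock_diagTheta (i j : Fin n) (l : Fin n → ℤ) : TwoBlock i j (diagTheta l).1 :=
  fun _ _ h _ _ => Matrix.diagonal_apply_ne _ h

theorem chevTheta_apply (i j : Fin n) (l : Fin n → ℤ) (a b : Fin n) :
    (chevTheta i j l).1 a b = (if a = b then l a - (if a = j then 1 else 0) else 0) +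
      if a = i ∧ b = j then 1 else 0 := by
  simp only [chevTheta, Matrix.add_apply, Matrix.diagonal_apply, Matrix.single_apply,
    Pi.sub_apply, Pi.single_apply, eq_comm]

theorem twoBlock_chevTheta (i j : Fin n) (l : Fin n → ℤ) : TwoBlock i j (chevTheta i j l).1 := by
  intro a b h1 h2 _
  simp [chevTheta_apply, h1, h2]

/-- For every `n ≥ 2` there is a product of two BLM basis elements with coefficients `1`
and `-1`. -/
theorem exists_blm_mul (hn : 2 ≤ n) : ∃ A B Z D : Theta n, Z ≠ D ∧ blm D ≠ 0 ∧
    blm A * blm B = blm Z - blm D := by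
  obtain ⟨i, hi⟩ : ∃ i : Fin n, (i : ℕ) = 0 := ⟨⟨0, by omega⟩, rfl⟩
  obtain ⟨j, hj⟩ : ∃ j : Fin n, (j : ℕ) = 1 := ⟨⟨1, by omega⟩, rfl⟩
  have hne : i ≠ j := by rintro rfl; omega
  have hlt : i < j := by simp only [Fin.lt_def]; omega
  have hadj : Adjacent i j := Or.inl (by omega)
  have hadj' : Adjacent j i := Or.inr (by omega)
  -- The entry `-1` is the diagonal entry of the result to which the second move leads; it produces
  -- the coefficient `[-1] = -1`.
  let l : Fin n → ℤ := fun a => if a = j then -1 else 0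
  let l' : Fin n → ℤ := fun a => l a + (if a = i then 1 else 0) - (if a = j then 1 else 0)
  let E := chevTheta i j l
  let G := chevTheta j i l'
  let D := diagTheta l
  have hE : ∀ a, ∑ b, E.1 a b = l' a := by
    intro a
    simp only [E, l', chevTheta_apply, Finset.sum_add_distrib, ite_and]
    split_ifs <;> simp
  have hZ : OffNonneg (moveMat j i i E.1) := by
    intro a b hab
    simp only [E, moveMat_apply, chevTheta_apply, if_neg hab]
    split_ifs <;> grind
  have hD : moveMat j i j E.1 = D.1 := by
    ext a b
    simp only [E, D, moveMat_apply, chevTheta_apply, diagTheta, Matrix.diagonal_apply, l]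
    split_ifs <;> grind
  have hD' : OffNonneg (moveMat j i j E.1) := by rw [hD]; exact D.2
  let Z := mkTheta _ hZ
  have hZij : Z.1 i j = 1 := by
    simp [Z, mkTheta_val, E, moveMat_apply, chevTheta_apply, hne, hne.symm]
  have hZji : Z.1 j i = 1 := by
    simp [Z, mkTheta_val, E, moveMat_apply, chevTheta_apply, hne, hne.symm]
  have hDij : D.1 i j = 0 := Matrix.diagonal_apply_ne _ hne
  have hZD : Z ≠ D := fun h => by rw [h, hDij] at hZij; omega
  have hprod : std G * std E = std Z - std D := by
    classical
    rw [stdMul_chev hadj' l' E hE, Fintype.sum_eq_add i j hne, dif_pos hZ, dif_pos hD']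
    · have c1 : chevCoeff j i i Z.1 = 1 := by
        rw [chevCoeff, Finset.sum_eq_zero, zpow_zero, one_mul, hZji, qint_one]
        intro b hb
        rw [side, if_pos hlt, Finset.mem_Iio, Fin.lt_def] at hb
        omega
      have c2 : chevCoeff j i j D.1 = -1 := by
        rw [chevCoeff, Finset.sum_eq_zero, zpow_zero, one_mul]
        · simp [D, diagTheta, l, qint_neg, qint_one]
        · intro b hb
          rw [side, if_pos hlt, Finset.mem_Iio] at hb
          have hbi : b = i := by simp only [Fin.lt_def, Fin.ext_iff] at hb ⊢; omega
          subst hbi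
          simp [D, diagTheta, l, hne, hne.symm]
      have e2 : mkTheta _ hD' = D := Theta.ext' hD
      rw [e2, hD, c2, neg_one_smul, ← sub_eq_add_neg]
      have e1 : chevCoeff j i i (moveMat j i i E.1) = 1 := c1
      rw [e1, one_smul]
    -- Any other column would need a unit at `(i, p)`, where `E` has entry `0`.
    · rintro p ⟨hpi, hpj⟩
      rw [dif_neg]
      intro h
      have h1 := h i p hpi.symm
      simp [E, moveMat_apply, chevTheta_apply, hpi.symm, hpj, hne] at h1
  -- `[Z]` is the product plus `1_l`, a sum of two bar-invariant elements.
  have hbarZ : IsBar (std Z) (std Z) := by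
    have h1 := (IsBar.gen_mul j i hadj' l' (isBar_chev hadj l)).add (IsBar.idem l)
    have h2 : std G * std E + std D = std Z := by rw [hprod, sub_add_cancel]
    rwa [h2] at h1
  have hZblock : TwoBlock i j Z.1 := by
    intro a b h1 h2 h3
    simp only [Z, E, mkTheta_val, moveMat_apply, chevTheta_apply, if_neg h1, if_neg h2]
    split_ifs <;> grind
  have bD : blm D = std D := blm_eq_std hi hj (twoBlock_diagTheta i j l) (IsBar.idem l)
    (Or.inl hDij.le)
  have bE : blm E = std E := by
    refine blm_eq_std hi hj (twoBlock_chevTheta i j l) (isBar_chev hadj l) (Or.inr ?_)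
    simp [E, chevTheta_apply, hne.symm]
  have bG : blm G = std G := by
    refine blm_eq_std hi hj (twoBlock_chevTheta j i l').symm (isBar_chev hadj' l') (Or.inl ?_)
    simp [G, chevTheta_apply, hne]
  have bZ : blm Z = std Z := by
    refine blm_eq (isBLM_std hbarZ) fun z hz => hz.eq_zero_of_twoBlock hi hj hZblock ?_
    intro t B t0 t1 _ ht
    -- The only matrix strictly below `Z` is `D`, whose single nonzero entry lies in column `j`;
    -- there the relation acts on the coefficient by `barQv` alone.
    obtain rfl : t = 1 := by omega
    refine hz.coeff_eq_zero_of_bar B (hz.1.coeff_of_col j B fun a b hb => ?_).symm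
    rw [ht, mkTheta_val, shear_moveMat hne, hD]
    simp only [D, diagTheta, Matrix.diagonal_apply, l]
    split_ifs with h1 h2
    · exact absurd (h1.symm.trans h2) hb
    · rfl
    · rfl
  refine ⟨G, E, Z, D, hZD, ?_, by rw [bG, bE, hprod, bZ, bD]⟩
  rw [bD]
  intro h
  have h1 : (std D).coeff D = 0 := by rw [h]; rfl
  rw [Udot.coeff_std, if_pos rfl] at h1
  exact one_ne_zero h1

/-- An expansion need not be unique where `blm` takes its default value. Since `{D}` is nonzero,
independence still fixes the coefficient at `D`, which is `-1`. -/
theorem exists_structure_constant_notMem_NLaurent (hn : 2 ≤ n) : ∃ A B : Theta n,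
    (∃ c : Theta n →₀ Qv, blm A * blm B = c.sum fun Z a => a • blm Z) ∧
      ∀ c : Theta n →₀ Qv, (blm A * blm B = c.sum fun Z a => a • blm Z) →
        ∃ Z, c Z ∉ NLaurent := by
  classical
  obtain ⟨A, B, Z, D, hne, hD, h⟩ := exists_blm_mul hn
  let c₀ : Theta n →₀ Qv := Finsupp.single Z 1 - Finsupp.single D 1
  have hsub : ∀ c c' : Theta n →₀ Qv, (c - c').sum (fun Z a => a • blm Z) =
      (c.sum fun Z a => a • blm Z) - c'.sum fun Z a => a • blm Z := fun c c' =>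
    Finsupp.sum_sub_index fun Z a b => sub_smul a b (blm Z)
  have hsingle : ∀ W : Theta n, (Finsupp.single W (1 : Qv)).sum (fun Z a => a • blm Z) = blm W :=
    fun W => (Finsupp.sum_single_index (h := fun Z a => a • blm Z) (zero_smul _ _)).trans
      (one_smul _ _)
  have hc₀ : (c₀.sum fun Z a => a • blm Z) = blm Z - blm D := by
    rw [hsub, hsingle, hsingle]
  refine ⟨A, B, ⟨c₀, by rw [h, hc₀]⟩, fun c hc => ⟨D, ?_⟩⟩
  have h1 := blm_independent (c - c₀) (by rw [hsub, ← hc, h, hc₀, sub_self]) D hD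
  have h2 : c D = -1 := by
    rw [Finsupp.sub_apply, sub_eq_zero] at h1
    rw [h1]
    simp [c₀, Finsupp.single_eq_of_ne hne.symm]
  rw [h2]
  exact neg_one_notMem_NLaurent

end Block

/-! ### The rank two case: uniqueness -/

theorem adjacent_zero_one : Adjacent (0 : Fin 2) 1 := Or.inl rfl

theorem adjacent_one_zero : Adjacent (1 : Fin 2) 0 := Or.inr rfl

theorem side_zero_one_zero : side (0 : Fin 2) 1 0 = {1} := by decide
theorem side_zero_one_one : side (0 : Fin 2) 1 1 = ∅ := by decide
theorem side_one_zero_zero : side (1 : Fin 2) 0 0 = ∅ := by decide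
theorem side_one_zero_one : side (1 : Fin 2) 0 1 = {0} := by decide

theorem theta2_val (a : ℤ) (b c : ℕ) (d : ℤ) : (theta2 a b c d).1 = !![a, (b : ℤ); (c : ℤ), d] :=
  rfl

/-- The coefficient of `E_1` at a two by two matrix. -/
theorem coeff_raise (l : Fin 2 → ℤ) (x : Udot 2) (a : ℤ) (b c : ℕ) (d : ℤ) :
    (std (chevTheta 0 1 l) * x).coeff (theta2 a b c d) =
      if a + b = l 0 + 1 ∧ c + d = l 1 - 1 then
        v ^ ((b : ℤ) - d) * qint a * x.coeff (theta2 (a - 1) b (c + 1) d) +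
          qint b * x.coeff (theta2 a (b - 1) c (d + 1)) else 0 := by
  classical
  rw [coeff_chev_mul adjacent_zero_one]
  have hc : (∀ r, ∑ s, (theta2 a b c d).1 r s =
      l r + (if r = 0 then 1 else 0) - (if r = 1 then 1 else 0)) ↔
      (a + b = l 0 + 1 ∧ c + d = l 1 - 1) := by
    simp [theta2_val, Fin.forall_fin_two]
  simp only [hc]
  split_ifs
  · rw [Fin.sum_univ_two]
    have h1 : moveMat 1 0 0 (theta2 a b c d).1 = (theta2 (a - 1) b (c + 1) d).1 := by
      ext r s
      fin_cases r <;> fin_cases s <;> simp [moveMat_apply, theta2_val]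
    rw [h1, Udot.cf_theta]
    have h2 : chevCoeff 0 1 0 (theta2 a b c d).1 = v ^ ((b : ℤ) - d) * qint a := by
      simp [chevCoeff, side_zero_one_zero, theta2_val]
    have h3 : chevCoeff 0 1 1 (theta2 a b c d).1 = qint b := by
      simp [chevCoeff, side_zero_one_one, theta2_val]
    rw [h2, h3]
    congr 1
    -- For `b = 0` the truncated `b - 1` is harmless, because its term carries the factor `[0] = 0`.
    rcases Nat.eq_zero_or_pos b with rfl | hb
    · simp [qint_zero]
    · have h4 : moveMat 1 0 1 (theta2 a b c d).1 = (theta2 a (b - 1) c (d + 1)).1 := by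
        ext r s
        fin_cases r <;> fin_cases s <;> simp [moveMat_apply, theta2_val]
        omega
      rw [h4, Udot.cf_theta]
  · rfl

/-- The coefficient of `F_1` at a two by two matrix. -/
theorem coeff_lower (l : Fin 2 → ℤ) (x : Udot 2) (a : ℤ) (b c : ℕ) (d : ℤ) :
    (std (chevTheta 1 0 l) * x).coeff (theta2 a b c d) =
      if a + b = l 0 - 1 ∧ c + d = l 1 + 1 then
        qint c * x.coeff (theta2 (a + 1) b (c - 1) d) +
          v ^ ((c : ℤ) - a) * qint d * x.coeff (theta2 a (b + 1) c (d - 1)) else 0 := by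
  classical
  rw [coeff_chev_mul adjacent_one_zero]
  have hc : (∀ r, ∑ s, (theta2 a b c d).1 r s =
      l r + (if r = 1 then 1 else 0) - (if r = 0 then 1 else 0)) ↔
      (a + b = l 0 - 1 ∧ c + d = l 1 + 1) := by
    simp [theta2_val, Fin.forall_fin_two]
  simp only [hc]
  split_ifs
  · rw [Fin.sum_univ_two]
    have h1 : moveMat 0 1 1 (theta2 a b c d).1 = (theta2 a (b + 1) c (d - 1)).1 := by
      ext r s
      fin_cases r <;> fin_cases s <;> simp [moveMat_apply, theta2_val]
    rw [h1, Udot.cf_theta]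
    have h2 : chevCoeff 1 0 1 (theta2 a b c d).1 = v ^ ((c : ℤ) - a) * qint d := by
      simp [chevCoeff, side_one_zero_one, theta2_val]
    have h3 : chevCoeff 1 0 0 (theta2 a b c d).1 = qint c := by
      simp [chevCoeff, side_one_zero_zero, theta2_val]
    rw [h2, h3]
    congr 1
    rcases Nat.eq_zero_or_pos c with rfl | hb
    · simp [qint_zero]
    · have h4 : moveMat 0 1 0 (theta2 a b c d).1 = (theta2 (a + 1) b (c - 1) d).1 := by
        ext r s
        fin_cases r <;> fin_cases s <;> simp [moveMat_apply, theta2_val]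
        omega
      rw [h4, Udot.cf_theta]
  · rfl

/-- The matrices with columns `(1, 0)` and `(k, -2 - k)`. -/
def colE (k : ℕ) : Theta 2 := theta2 1 k 0 (-2 - k)

/-- The matrices with columns `(0, 1)` and `(k, -2 - k)`. -/
def colF (k : ℕ) : Theta 2 := theta2 0 k 1 (-2 - k)

/-- Coefficients of a product at `colE` and `colF` depend only on those of `x` at `colE` and `colF`.
The bar relation can therefore be followed on these two families by themselves. -/
theorem coeff_raise_colE (l : Fin 2 → ℤ) (x : Udot 2) (k : ℕ) :
    (std (chevTheta 0 1 l) * x).coeff (colE k) = if 1 + (k : ℤ) = l 0 + 1 ∧ -2 - k = l 1 - 1 then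
      v ^ (2 * (k : ℤ) + 2) * x.coeff (colF k) + qint k * x.coeff (colE (k - 1)) else 0 := by
  rw [colE, coeff_raise]
  refine if_congr (by simp) ?_ rfl
  have h1 : (k : ℤ) - (-2 - k) = 2 * k + 2 := by ring
  have h2 : qint k * x.coeff (theta2 1 (k - 1) 0 (-2 - k + 1)) =
      qint k * x.coeff (colE (k - 1)) := by
    rcases Nat.eq_zero_or_pos k with rfl | hk
    · rw [Nat.cast_zero, qint_zero, zero_mul, zero_mul]
    · have h3 : -2 - (k : ℤ) + 1 = -2 - ((k - 1 : ℕ) : ℤ) := by omega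
      rw [h3, colE]
  rw [qint_one, mul_one, h1, h2, sub_self, zero_add]
  rfl

theorem coeff_raise_colF (l : Fin 2 → ℤ) (x : Udot 2) (k : ℕ) :
    (std (chevTheta 0 1 l) * x).coeff (colF k) = if (k : ℤ) = l 0 + 1 ∧ -1 - k = l 1 - 1 then
      qint k * x.coeff (colF (k - 1)) else 0 := by
  rw [colF, coeff_raise]
  refine if_congr (by rw [zero_add]; push_cast; constructor <;> rintro ⟨h1, h2⟩ <;>
    exact ⟨h1, by omega⟩) ?_ rfl
  rw [qint_zero, mul_zero, zero_mul, zero_add]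
  rcases Nat.eq_zero_or_pos k with rfl | hk
  · simp [qint_zero]
  · have : ((k - 1 : ℕ) : ℤ) = k - 1 := by omega
    rw [colF, this]
    congr 3
    ring

theorem coeff_lower_colE (l : Fin 2 → ℤ) (x : Udot 2) (k : ℕ) :
    (std (chevTheta 1 0 l) * x).coeff (colE k) = if 1 + (k : ℤ) = l 0 - 1 ∧ -2 - k = l 1 + 1 then
      v⁻¹ * qint (-2 - k) * x.coeff (colE (k + 1)) else 0 := by
  rw [colE, coeff_lower]
  refine if_congr (by simp) ?_ rfl
  simp only [Nat.cast_zero, qint_zero, zero_mul, zero_add, zero_sub, zpow_neg, zpow_one]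
  congr 2
  rw [colE]
  congr 1
  push_cast
  ring

theorem coeff_lower_colF (l : Fin 2 → ℤ) (x : Udot 2) (k : ℕ) :
    (std (chevTheta 1 0 l) * x).coeff (colF k) = if (k : ℤ) = l 0 - 1 ∧ -1 - k = l 1 + 1 then
      x.coeff (colE k) + v * qint (-2 - k) * x.coeff (colF (k + 1)) else 0 := by
  rw [colF, coeff_lower]
  refine if_congr (by rw [zero_add]; push_cast; constructor <;> rintro ⟨h1, h2⟩ <;>
    exact ⟨h1, by omega⟩) ?_ rfl
  simp only [Nat.cast_one, qint_one, one_mul, sub_zero, zpow_one, zero_add, Nat.sub_self]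
  congr 3
  rw [colF]
  congr 1
  push_cast
  ring

theorem coeff_std_diag_colE (l : Fin 2 → ℤ) (k : ℕ) :
    barQv ((std (diagTheta l)).coeff (colE k)) = (std (diagTheta l)).coeff (colE k) := by
  classical
  rw [Udot.coeff_std]
  split_ifs <;> simp

theorem coeff_std_diag_colF (l : Fin 2 → ℤ) (k : ℕ) : (std (diagTheta l)).coeff (colF k) = 0 := by
  classical
  rw [Udot.coeff_std, if_neg]
  intro h
  have h1 := congrFun (congrFun (congrArg Subtype.val h) 1) 0
  simp [diagTheta, colF, theta2_val] at h1

theorem zpow_affine (k a b : ℤ) : v ^ (a * k + b) = (v ^ k) ^ a * v ^ b := by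
  rw [zpow_add₀ v_ne_zero, mul_comm a k, zpow_mul]

theorem sub_inv_mul_qint (m : ℤ) : (v - v⁻¹) * qint m = v ^ m - v ^ (-m) :=
  mul_div_cancel₀ _ v_sub_inv_ne_zero

/-- This identity and `scalar_lower` express that the correction term in `IsBar.coeff_col` is
compatible with `E_1` and `F_1`. -/
theorem scalar_raise (k : ℤ) :
    v ^ (2 * (k + 1) + 2) + qint (k + 1) * (v ^ (k + 2) - v ^ (-(k + 2))) =
      v ^ (-(2 * (k + 1) + 2)) + qint (k + 2) * (v ^ (k + 3) - v ^ (-(k + 3))) := by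
  have h0 := v_ne_zero
  refine mul_left_cancel₀ v_sub_inv_ne_zero ?_
  rw [mul_add (v - v⁻¹), mul_add (v - v⁻¹), ← mul_assoc, ← mul_assoc, sub_inv_mul_qint,
    sub_inv_mul_qint]
  have e1 : v ^ (2 * (k + 1) + 2) = (v ^ k) ^ (2 : ℤ) * v ^ (4 : ℤ) := by
    rw [← zpow_affine]; congr 1; ring
  have e2 : v ^ (-(2 * (k + 1) + 2)) = (v ^ k) ^ (-2 : ℤ) * v ^ (-4 : ℤ) := by
    rw [← zpow_affine]; congr 1; ring
  have e3 : ∀ b, v ^ (k + b) = v ^ k * v ^ b := fun b => zpow_add₀ h0 _ _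
  have e4 : ∀ b, v ^ (-(k + b)) = (v ^ k)⁻¹ * v ^ (-b) := fun b => by
    rw [neg_add, zpow_add₀ h0, zpow_neg]
  rw [e1, e2, e3, e3, e3, e4, e4, e4]
  have hw0 : v ^ k ≠ 0 := zpow_ne_zero _ h0
  generalize v ^ k = w at *
  field_simp
  ring

theorem scalar_lower (k : ℤ) : v⁻¹ * qint (-2 - k) - v * qint (-2 - k) =
    v ^ (k + 2) - v ^ (-(k + 2)) := by
  rw [← sub_inv_mul_qint, show -2 - k = -(k + 2) by ring, qint_neg]
  ring

/-- The bar involution on the coefficients at the matrices `colE k` and `colF k`. -/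
theorem IsBar.coeff_col {x x' : Udot 2} (h : IsBar x x') (k : ℕ) :
    x'.coeff (colF k) = barQv (x.coeff (colF k)) ∧
    x'.coeff (colE k) = barQv (x.coeff (colE k)) +
      (v ^ ((k : ℤ) + 2) - v ^ (-((k : ℤ) + 2))) * barQv (x.coeff (colF (k + 1))) := by
  -- `colE k` is the shear by one of `colF (k + 1)`, which explains the single correction term.
  induction h generalizing k with
  | idem l => simp [coeff_std_diag_colF, coeff_std_diag_colE]
  | add _ _ ih ih' =>
    simp only [Udot.coeff_add, (ih _).1, (ih' _).1, (ih _).2, (ih' _).2, map_add, true_and]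
    ring
  | smul c _ ih =>
    simp only [Udot.coeff_smul, (ih _).1, (ih _).2, map_mul, true_and]
    ring
  | @gen_mul i j hij l x x' _ ih =>
    have hcase : (i = 0 ∧ j = 1) ∨ (i = 1 ∧ j = 0) := by
      have := i.isLt
      have := j.isLt
      simp only [Fin.ext_iff, Fin.val_zero, Fin.val_one]
      omega
    rcases hcase with ⟨rfl, rfl⟩ | ⟨rfl, rfl⟩
    · refine ⟨?_, ?_⟩
      · rw [coeff_raise_colF, coeff_raise_colF]
        split_ifs
        · rw [(ih _).1, map_mul, barQv_qint]
        · simp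
      · rw [coeff_raise_colE, coeff_raise_colE, coeff_raise_colF]
        have hc : ((k + 1 : ℕ) : ℤ) = l 0 + 1 ∧ -1 - ((k + 1 : ℕ) : ℤ) = l 1 - 1 ↔
            1 + (k : ℤ) = l 0 + 1 ∧ -2 - (k : ℤ) = l 1 - 1 := by
          push_cast
          constructor <;> rintro ⟨h1, h2⟩ <;> exact ⟨by omega, by omega⟩
        simp only [hc]
        split_ifs
        · simp only [map_add, map_mul, barQv_qint, barQv_zpow, (ih _).1, (ih _).2,
            Nat.add_sub_cancel]
          -- For `k = 0` the index `k - 1` is a truncated value whose term has the factor `[0]`.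
          rcases k with _ | k
          · simp only [qint_zero, zero_mul, Nat.cast_zero, mul_zero, zero_add, qint_one,
              Nat.cast_one]
            ring
          · have h1 := scalar_raise k
            have h2 : ((k + 1 : ℕ) : ℤ) = (k : ℤ) + 1 := by push_cast; ring
            have h3 : ((k + 1 + 1 : ℕ) : ℤ) = (k : ℤ) + 2 := by push_cast; ring
            have h4 : (k : ℤ) + 1 + 2 = (k : ℤ) + 3 := by ring
            simp only [Nat.add_sub_cancel, h3]
            simp only [h2, h4]
            linear_combination barQv (x.coeff (colF (k + 1))) * h1
        · simp
    · refine ⟨?_, ?_⟩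
      · rw [coeff_lower_colF, coeff_lower_colF]
        split_ifs
        · simp only [map_add, map_mul, barQv_qint, barQv_v, (ih _).1, (ih _).2]
          linear_combination (-barQv (x.coeff (colF (k + 1)))) * scalar_lower k
        · simp
      · rw [coeff_lower_colE, coeff_lower_colE, coeff_lower_colF]
        have hc : ((k + 1 : ℕ) : ℤ) = l 0 - 1 ∧ -1 - ((k + 1 : ℕ) : ℤ) = l 1 + 1 ↔
            1 + (k : ℤ) = l 0 - 1 ∧ -2 - (k : ℤ) = l 1 + 1 := by
          push_cast
          constructor <;> rintro ⟨h1, h2⟩ <;> exact ⟨by omega, by omega⟩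
        simp only [hc]
        split_ifs
        · simp only [map_add, map_mul, barQv_qint, barQv_v, barQv_inv_v, (ih _).2]
          have h1 := scalar_lower k
          have h2 := scalar_lower (k + 1 : ℕ)
          linear_combination barQv (x.coeff (colE (k + 1))) * h1 +
            v⁻¹ * barQv (x.coeff (colF (k + 1 + 1))) *
              (qint (-2 - (k + 1 : ℕ)) * h1 - qint (-2 - k) * h2)
        · simp

/-! ### The rank two case: the BLM basis elements -/

theorem moveMat_raise_zero (a : ℤ) (b c : ℕ) (d : ℤ) :
    moveMat 0 1 0 (theta2 a b (c + 1) d).1 = (theta2 (a + 1) b c d).1 := by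
  ext r s
  fin_cases r <;> fin_cases s <;> simp [moveMat_apply, theta2_val]

theorem moveMat_raise_one (a : ℤ) (b c : ℕ) (d : ℤ) :
    moveMat 0 1 1 (theta2 a b c d).1 = (theta2 a (b + 1) c (d - 1)).1 := by
  ext r s
  fin_cases r <;> fin_cases s <;> simp [moveMat_apply, theta2_val]

theorem moveMat_lower_zero (a : ℤ) (b c : ℕ) (d : ℤ) :
    moveMat 1 0 0 (theta2 a b c d).1 = (theta2 (a - 1) b (c + 1) d).1 := by
  ext r s
  fin_cases r <;> fin_cases s <;> simp [moveMat_apply, theta2_val]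

theorem moveMat_lower_one (a : ℤ) (b c : ℕ) (d : ℤ) :
    moveMat 1 0 1 (theta2 a (b + 1) c d).1 = (theta2 a b c (d + 1)).1 := by
  ext r s
  fin_cases r <;> fin_cases s <;> simp [moveMat_apply, theta2_val]

theorem sum_row_theta2 (a : ℤ) (b c : ℕ) (d : ℤ) (r : Fin 2) :
    ∑ s, (theta2 a b c d).1 r s = ![a + b, c + d] r := by
  fin_cases r <;> simp [theta2_val]

theorem dite_offNonneg {n : ℕ} {M : Matrix (Fin n) (Fin n) ℤ} {Z : Theta n} (h : M = Z.1) (c : Qv)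
    [Decidable (OffNonneg M)] :
    (if h : OffNonneg M then c • std (mkTheta M h) else 0) = c • std Z := by
  subst h
  exact dif_pos Z.2

/-- The action of `E_1` on a standard basis element. -/
theorem raise_mul_std (a : ℤ) (b c : ℕ) (d : ℤ) :
    std (chevTheta 0 1 ![a + b, (c + 1 : ℕ) + d]) * std (theta2 a b (c + 1) d) =
      (v ^ ((b : ℤ) - d) * qint (a + 1)) • std (theta2 (a + 1) b c d) +
        qint (b + 1) • std (theta2 a (b + 1) (c + 1) (d - 1)) := by
  classical
  rw [stdMul_chev adjacent_zero_one _ _ (sum_row_theta2 _ _ _ _), Fin.sum_univ_two,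
    dite_offNonneg (moveMat_raise_zero a b c d), dite_offNonneg (moveMat_raise_one a b (c + 1) d),
    moveMat_raise_zero, moveMat_raise_one]
  simp [chevCoeff, side_zero_one_zero, side_zero_one_one, theta2_val]

/-- The action of `E_1` on an upper triangular standard basis element. -/
theorem raise_mul_std_upper (a : ℤ) (b : ℕ) (d : ℤ) :
    std (chevTheta 0 1 ![a + b, d]) * std (theta2 a b 0 d) =
        qint (b + 1) • std (theta2 a (b + 1) 0 (d - 1)) := by
  classical
  have h0 : ¬ OffNonneg (moveMat 0 1 0 (theta2 a b 0 d).1) := fun h => by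
    have := h 1 0 (by decide)
    simp [moveMat_apply, theta2_val] at this
  rw [stdMul_chev adjacent_zero_one _ _ (fun r => (sum_row_theta2 _ _ _ _ _).trans (by simp)),
    Fin.sum_univ_two, dif_neg h0, dite_offNonneg (moveMat_raise_one a b 0 d), moveMat_raise_one,
    zero_add]
  simp [chevCoeff, side_zero_one_one, theta2_val]

/-- The action of `F_1` on a standard basis element. -/
theorem lower_mul_std (a : ℤ) (b c : ℕ) (d : ℤ) :
    std (chevTheta 1 0 ![a + (b + 1 : ℕ), c + d]) * std (theta2 a (b + 1) c d) =
      qint (c + 1) • std (theta2 (a - 1) (b + 1) (c + 1) d) +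
        (v ^ ((c : ℤ) - a) * qint (d + 1)) • std (theta2 a b c (d + 1)) := by
  classical
  rw [stdMul_chev adjacent_one_zero _ _ (sum_row_theta2 _ _ _ _), Fin.sum_univ_two,
    dite_offNonneg (moveMat_lower_zero a (b + 1) c d), dite_offNonneg (moveMat_lower_one a b c d),
    moveMat_lower_zero, moveMat_lower_one]
  simp [chevCoeff, side_one_zero_zero, side_one_zero_one, theta2_val]

theorem qint_two : qint 2 = v + v⁻¹ := by
  refine mul_left_cancel₀ v_sub_inv_ne_zero ?_
  rw [sub_inv_mul_qint, zpow_neg]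
  have h0 := v_ne_zero
  field_simp
  ring

theorem qint_three : qint 3 = v ^ 2 + 1 + v⁻¹ ^ 2 := by
  refine mul_left_cancel₀ v_sub_inv_ne_zero ?_
  rw [sub_inv_mul_qint, zpow_neg]
  have h0 := v_ne_zero
  field_simp
  ring

theorem theta2_eq_diagTheta : theta2 1 0 0 (-2) = diagTheta ![1, -2] := by
  refine Theta.ext' ?_
  ext r s
  fin_cases r <;> fin_cases s <;> simp [theta2_val, diagTheta]

theorem theta2_eq_chevTheta : theta2 1 1 0 (-3) = chevTheta 0 1 ![1, -2] := by
  refine Theta.ext' ?_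
  ext r s
  fin_cases r <;> fin_cases s <;> simp [theta2_val, chevTheta_apply]

theorem isBar_diag : IsBar (std (theta2 1 0 0 (-2))) (std (theta2 1 0 0 (-2))) := by
  rw [theta2_eq_diagTheta]
  exact IsBar.idem _

theorem twoBlock_fin_two (M : Matrix (Fin 2) (Fin 2) ℤ) : TwoBlock 0 1 M := by
  intro r s h1 h2 h3
  fin_cases r <;> fin_cases s <;> simp at h1 h2 h3

theorem blm_diag : blm (theta2 1 0 0 (-2)) = std (theta2 1 0 0 (-2)) :=
  blm_eq_std (i := 0) (j := 1) rfl rfl (twoBlock_fin_two _) isBar_diag (Or.inl (by simp [theta2_val]))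

theorem lower_mul_raise :
    std (chevTheta 1 0 ![2, -3]) * std (theta2 1 1 0 (-3)) =
      std (theta2 0 1 1 (-3)) - (1 + v⁻¹ ^ 2) • std (theta2 1 0 0 (-2)) := by
  have h := lower_mul_std 1 0 0 (-3)
  norm_num at h
  rw [h, show ((-2 : ℤ)) = -(2 : ℤ) from rfl, qint_neg, qint_one, qint_two, one_smul, sub_eq_add_neg,
    ← neg_smul]
  congr 2
  have h0 := v_ne_zero
  field_simp

/-- `F E 1_λ` is bar-invariant and equals `[A] - (1 + v⁻²) 1_λ`. Adding `1_λ` removes the constant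
`1` and leaves a coefficient in `v⁻¹ℤ[v⁻¹]`. -/
theorem isBar_sub :
    IsBar (std (theta2 0 1 1 (-3)) - v⁻¹ ^ 2 • std (theta2 1 0 0 (-2)))
      (std (theta2 0 1 1 (-3)) - v⁻¹ ^ 2 • std (theta2 1 0 0 (-2))) := by
  have h := (IsBar.gen_mul 1 0 adjacent_one_zero ![2, -3]
    (isBar_chev adjacent_zero_one ![1, -2])).add isBar_diag
  rw [← theta2_eq_chevTheta, lower_mul_raise] at h
  have key : std (theta2 0 1 1 (-3)) - v⁻¹ ^ 2 • std (theta2 1 0 0 (-2)) =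
      std (theta2 0 1 1 (-3)) - (1 + v⁻¹ ^ 2) • std (theta2 1 0 0 (-2)) +
        std (theta2 1 0 0 (-2)) := by
    rw [add_smul, one_smul]
    abel
  rwa [key]

theorem theta2_zero_eq_colF : theta2 0 1 1 (-3) = colF 1 := by
  simp [colF]

theorem theta2_one_eq_colE : theta2 1 0 0 (-2) = colE 0 := by
  simp [colE]

theorem theta2_ne : theta2 1 0 0 (-2) ≠ theta2 0 1 1 (-3) := fun h => by
  have := congrFun (congrFun (congrArg Subtype.val h) 0) 0
  simp [theta2_val] at this

theorem blm_sub : blm (theta2 0 1 1 (-3)) =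
    std (theta2 0 1 1 (-3)) - v⁻¹ ^ 2 • std (theta2 1 0 0 (-2)) := by
  classical
  refine blm_eq ⟨isBar_sub, ?_, fun B hB => ?_⟩ fun z hz => ?_
  · rw [Udot.coeff_sub, Udot.coeff_smul, Udot.coeff_std, Udot.coeff_std, if_pos rfl,
      if_neg theta2_ne, mul_zero, sub_zero]
  · rw [Udot.coeff_sub, Udot.coeff_smul, Udot.coeff_std, Udot.coeff_std, if_neg hB.symm]
    split_ifs with h
    · refine ⟨⟨-v⁻¹, neg_mem (Subring.subset_closure rfl), by ring⟩, fun _ => ?_⟩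
      subst h
      unfold Below
      decide
    · exact ⟨⟨0, zero_mem _, by simp⟩, fun h => absurd (by simp) h⟩
  · refine hz.eq_zero_of_twoBlock (i := 0) (j := 1) rfl rfl (twoBlock_fin_two _)
      fun t B t0 t1 _ hB => ?_
    have ht : t = 1 := by
      simp only [theta2_val, Matrix.of_apply, Matrix.cons_val] at t1
      omega
    subst ht
    have h1 : B = theta2 1 0 0 (-2) := by
      refine Theta.ext' ?_
      rw [hB]
      ext r s
      fin_cases r <;> fin_cases s <;> simp [theta2_val, shear]
    rw [h1]
    -- A defect vanishes at `A` itself, so the correction term at the only lower matrix drops out.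
    have h2 : z.coeff (theta2 0 1 1 (-3)) = 0 := by
      by_contra hne
      exact ((hz.2 _).2 hne).1 rfl
    refine hz.coeff_eq_zero_of_bar _ ?_
    have h3 := (hz.1.coeff_col 0).2
    rw [← theta2_one_eq_colE, zero_add, ← theta2_zero_eq_colF, h2, map_zero, mul_zero,
      add_zero] at h3
    exact h3.symm

theorem raise_mul_sub : std (chevTheta 0 1 ![1, -2]) *
    (std (theta2 0 1 1 (-3)) - v⁻¹ ^ 2 • std (theta2 1 0 0 (-2))) =
      (v + v⁻¹) • std (theta2 0 2 1 (-4)) + (v ^ 4 - v⁻¹ ^ 2) • std (theta2 1 1 0 (-3)) := by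
  have h1 := raise_mul_std 0 1 0 (-3)
  have h2 := raise_mul_std_upper 1 0 (-2)
  norm_num at h1 h2
  rw [sub_eq_add_neg, ← neg_smul, Udot.mul_add', Udot.mul_smul', h1, h2, qint_one, qint_two]
  refine Udot.ext' fun B => ?_
  simp only [Udot.coeff_add, Udot.coeff_smul]
  ring

theorem lower_mul_double : std (chevTheta 1 0 ![2, -3]) * std (theta2 0 2 1 (-4)) =
    (v + v⁻¹) • std (theta2 (-1) 2 2 (-4)) -
      (v ^ 3 + v + v⁻¹) • std (theta2 0 1 1 (-3)) := by
  have h1 := lower_mul_std 0 1 1 (-4)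
  norm_num at h1
  rw [h1, show ((-3 : ℤ)) = -(3 : ℤ) from rfl, qint_neg, qint_three, qint_two, sub_eq_add_neg,
    ← neg_smul]
  congr 2
  have h0 := v_ne_zero
  field_simp

/-- The multiples of `{A}` and `1_λ` that are added are those cancelling the lower terms of `F E
{A}`. They have bar-invariant coefficients, and dividing by the bar-invariant `(v + v⁻¹)²` isolates
the standard element. -/
theorem isBar_double : IsBar (std (theta2 (-1) 2 2 (-4))) (std (theta2 (-1) 2 2 (-4))) := by
  have h0 := v_ne_zero
  have hbv : barQv v = v⁻¹ := barQv_v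
  have h1 := IsBar.gen_mul 1 0 adjacent_one_zero ![2, -3]
    (IsBar.gen_mul 0 1 adjacent_zero_one ![1, -2] isBar_sub)
  have h2 := (h1.add (isBar_sub.smul (2 * v ^ 2 + 2 + 2 * v⁻¹ ^ 2))).add
    (isBar_diag.smul (v⁻¹ ^ 4 + v⁻¹ ^ 2 + 2 + v ^ 2 + v ^ 4))
  have h3 := h2.smul (((v + v⁻¹) ^ 2)⁻¹)
  have hne : v + v⁻¹ ≠ 0 := by
    rw [← qint_two, qint]
    refine div_ne_zero ?_ v_sub_inv_ne_zero
    rw [sub_ne_zero]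
    intro h
    have h4 : v ^ (4 : ℤ) = v ^ (0 : ℤ) := by
      rw [show (4 : ℤ) = 2 + 2 by norm_num, zpow_add₀ h0]
      nth_rewrite 1 [h]
      rw [← zpow_add₀ h0]
      norm_num
    have h5 := v_pow_injective (a₁ := 4) (a₂ := 0) (by simpa using h4)
    omega
  rw [raise_mul_sub, Udot.mul_add', Udot.mul_smul', Udot.mul_smul', lower_mul_double,
    lower_mul_raise] at h3
  simp only [map_inv₀, map_pow, map_add, map_mul, map_ofNat, hbv, inv_inv] at h3
  have e1 : v⁻¹ + v = v + v⁻¹ := add_comm _ _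
  have e2 : 2 * v⁻¹ ^ 2 + 2 + 2 * v ^ 2 = 2 * v ^ 2 + 2 + 2 * v⁻¹ ^ 2 := by ring
  have e3 : v ^ 4 + v ^ 2 + 2 + v⁻¹ ^ 2 + v⁻¹ ^ 4 = v⁻¹ ^ 4 + v⁻¹ ^ 2 + 2 + v ^ 2 + v ^ 4 := by
    ring
  rw [e1, e2, e3] at h3
  have key : std (theta2 (-1) 2 2 (-4)) = ((v + v⁻¹) ^ 2)⁻¹ •
      ((v + v⁻¹) • ((v + v⁻¹) • std (theta2 (-1) 2 2 (-4)) -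
        (v ^ 3 + v + v⁻¹) • std (theta2 0 1 1 (-3))) +
      (v ^ 4 - v⁻¹ ^ 2) • (std (theta2 0 1 1 (-3)) - (1 + v⁻¹ ^ 2) • std (theta2 1 0 0 (-2))) +
      (2 * v ^ 2 + 2 + 2 * v⁻¹ ^ 2) •
        (std (theta2 0 1 1 (-3)) - v⁻¹ ^ 2 • std (theta2 1 0 0 (-2))) +
      (v⁻¹ ^ 4 + v⁻¹ ^ 2 + 2 + v ^ 2 + v ^ 4) • std (theta2 1 0 0 (-2))) := by
    rw [eq_inv_smul_iff₀ (pow_ne_zero 2 hne)]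
    refine Udot.ext' fun B => ?_
    simp only [Udot.coeff_add, Udot.coeff_sub, Udot.coeff_smul]
    field_simp
    ring
  rwa [← key] at h3

theorem blm_double : blm (theta2 (-1) 2 2 (-4)) = std (theta2 (-1) 2 2 (-4)) := by
  refine blm_eq (isBLM_std isBar_double) fun z hz => ?_
  refine hz.eq_zero_of_twoBlock (i := 0) (j := 1) rfl rfl (twoBlock_fin_two _)
    fun t B t0 t1 _ hB => ?_
  -- The chain below consists of `colF 1` and `colE 0`. At the former the relation acts by `barQv`
  -- alone; once that coefficient is zero, the correction at `colE 0` disappears.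
  have h1 : z.coeff (colF 1) = 0 := hz.coeff_eq_zero_of_bar _ (hz.1.coeff_col 1).1.symm
  have h2 : z.coeff (colE 0) = 0 := by
    refine hz.coeff_eq_zero_of_bar _ ?_
    have h3 := (hz.1.coeff_col 0).2
    rw [zero_add, h1, map_zero, mul_zero, add_zero] at h3
    exact h3.symm
  have ht : t = 1 ∨ t = 2 := by
    simp only [theta2_val, Matrix.of_apply, Matrix.cons_val] at t1
    omega
  rcases ht with rfl | rfl
  · have hB' : B = colF 1 := by
      refine Theta.ext' ?_
      rw [hB]
      ext r s
      fin_cases r <;> fin_cases s <;> simp [theta2_val, shear, colF]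
    rw [hB', h1]
  · have hB' : B = colE 0 := by
      refine Theta.ext' ?_
      rw [hB]
      ext r s
      fin_cases r <;> fin_cases s <;> simp [theta2_val, shear, colE]
    rw [hB', h2]

/-! ### Convolution of relative positions as a product of matrices -/

section Convolution

variable {n d : ℕ} {F : Type} [Field F]

theorem cum_diagonal (m : Fin n → ℕ) (s t : Fin (n + 1)) :
    cum (Matrix.diagonal m) s t = ∑ a, if a.castSucc < s ∧ a.castSucc < t then m a else 0 := by
  refine Finset.sum_congr rfl fun a _ => ?_
  rw [Finset.sum_eq_single a (fun b _ hb => by simp [Matrix.diagonal_apply_ne _ hb.symm])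
    (by simp), Matrix.diagonal_apply_eq]

theorem eq_of_relPos_eq_diagonal {m : Fin n → ℕ} {f f' : PFlag n F d}
    (h : relPos f f' = Matrix.diagonal m) : f' = f := by
  refine PFlag.ext' fun t => ?_
  have h1 := finrank_left f f' t
  have h2 := finrank_right f f' t
  have h3 := rk_eq_cum f f' t t
  simp only [h, cum_diagonal, Fin.castSucc_lt_last, and_true, true_and, and_self] at h1 h2 h3
  exact (Submodule.eq_of_le_of_finrank_eq (PFlag.eq_of_rk (h3.trans h1.symm))
    (h1.trans h2.symm)).symm

theorem relPos_self {m : Fin n → ℕ} (f : PFlag n F d)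
    (hm : ∀ a : Fin n, m a + Module.finrank F (f.V a.castSucc) = Module.finrank F (f.V a.succ)) :
    relPos f f = Matrix.diagonal m := by
  ext a b
  have h := relPos_cast f f a b
  simp only [rk_self] at h
  rw [Matrix.diagonal_apply]
  have ha := hm a
  rcases lt_trichotomy a b with hab | rfl | hab
  · rw [min_eq_left (Fin.succ_le_succ_iff.2 hab.le),
      min_eq_left ((Fin.castSucc_le_castSucc_iff.2 hab.le).trans (Fin.castSucc_le_succ b)),
      min_eq_left (Fin.succ_le_castSucc_iff.2 hab),
      min_eq_left (Fin.castSucc_le_castSucc_iff.2 hab.le)] at h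
    rw [if_neg hab.ne]
    omega
  · rw [min_self, min_self, min_eq_left (Fin.castSucc_le_succ a),
      min_eq_right (Fin.castSucc_le_succ a)] at h
    rw [if_pos rfl]
    omega
  · rw [min_eq_right (Fin.succ_le_succ_iff.2 hab.le),
      min_eq_right (Fin.succ_le_castSucc_iff.2 hab),
      min_eq_right ((Fin.castSucc_le_castSucc_iff.2 hab.le).trans (Fin.castSucc_le_succ a)),
      min_eq_right (Fin.castSucc_le_castSucc_iff.2 hab.le)] at h
    rw [if_neg hab.ne']
    omega

instance [Fintype F] : Finite (PFlag n F d) := by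
  have hV : Finite (Submodule F (Fin d → F)) :=
    Finite.of_injective _ (SetLike.coe_injective (A := Submodule F (Fin d → F)))
  exact Finite.of_injective (fun f : PFlag n F d => f.V) fun f g h => PFlag.ext' (congrFun h)

instance [Fintype F] : Fintype (PFlag n F d) := Fintype.ofFinite _

open Classical in
/-- The indicator matrix of the pairs of flags in position `M`. -/
def posMat (F : Type) [Field F] (d : ℕ) (M : Matrix (Fin n) (Fin n) ℕ) : Matrix (PFlag n F d) (PFlag n F d) ℤ := fun f g =>
  if relPos f g = M then 1 else 0

theorem posMat_mul_apply [Fintype F] (A B : Matrix (Fin n) (Fin n) ℕ) (f h : PFlag n F d) :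
    (posMat F d A * posMat F d B) f h =
      ({f' : PFlag n F d | relPos f f' = A ∧ relPos f' h = B}.ncard : ℤ) := by
  classical
  simp only [Matrix.mul_apply, posMat, ← ite_and, mul_ite, mul_one, mul_zero, Finset.sum_boole]
  rw [Set.ncard_eq_toFinset_card']
  simp [and_comm]

open Classical in
-- An identity of indicator matrices over all finite fields is read entrywise as a family of
-- structure polynomials. Associativity of matrix multiplication thereby becomes available for
-- products not involving a generator.
theorem isStructurePoly_of_posMat_mul {ι : Type} [Fintype ι] {A B : Matrix (Fin n) (Fin n) ℕ}
    (Z : ι → Matrix (Fin n) (Fin n) ℕ) (g : ι → ℤ[X])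
    (h : ∀ (F : Type) [Field F] [Fintype F] (d : ℕ),
      posMat F d A * posMat F d B = ∑ k, (g k).eval (Fintype.card F : ℤ) • posMat F d (Z k))
    (C : Matrix (Fin n) (Fin n) ℕ) :
    IsStructurePoly A B C (∑ k, if C = Z k then g k else 0) := by
  rw [isStructurePoly_iff]
  intro F _ _ d f f'' hC
  rw [← posMat_mul_apply, h, Matrix.sum_apply, eval_finsetSum]
  refine Finset.sum_congr rfl fun k _ => ?_
  rw [Matrix.smul_apply, posMat, hC]
  split_ifs <;> simp

theorem posMat_diagonal_mul [Fintype F] {m : Fin n → ℕ} {B : Matrix (Fin n) (Fin n) ℕ}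
    (hm : ∀ a, m a = ∑ b, B a b) :
    posMat F d (Matrix.diagonal m) * posMat F d B = posMat F d B := by
  classical
  ext f h
  have hs : ∀ f', relPos f f' = Matrix.diagonal m → f' = f := fun f' => eq_of_relPos_eq_diagonal
  rw [Matrix.mul_apply, Finset.sum_eq_single f (fun f' _ hf => by
    rw [posMat, if_neg fun h => hf (hs _ h), zero_mul]) (by simp)]
  simp only [posMat]
  split_ifs with h1 h2 h2
  · rfl
  · rfl
  · refine absurd (relPos_self f fun a => ?_) h1
    rw [← sum_row_relPos f h a, h2, hm]
  · rfl

theorem posMat_mul_diagonal [Fintype F] {m : Fin n → ℕ} {B : Matrix (Fin n) (Fin n) ℕ}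
    (hm : ∀ b, m b = ∑ a, B a b) :
    posMat F d B * posMat F d (Matrix.diagonal m) = posMat F d B := by
  classical
  ext f h
  have hs : ∀ f', relPos f' h = Matrix.diagonal m → h = f' := fun f' => eq_of_relPos_eq_diagonal
  rw [Matrix.mul_apply, Finset.sum_eq_single h (fun f' _ hf => by
    rw [posMat, posMat, if_neg fun h => hf (hs _ h).symm, mul_zero]) (by simp)]
  simp only [posMat]
  split_ifs with h1 h2 h2
  · rfl
  · refine absurd (relPos_self h fun a => ?_) h2
    rw [← sum_col_relPos f h a, h1, hm]
  · rfl
  · rfl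

/-- The polynomial coefficients of the product with a Chevalley generator. -/
def chevEval (q : ℤ) (i j p : Fin n) (Z : Matrix (Fin n) (Fin n) ℕ) : ℤ :=
  q ^ (∑ b ∈ side i j p, Z i b) * ∑ t ∈ Finset.range (Z i p), q ^ t

/-- The results `Z p` are given as data, because removing a unit over `ℕ` only makes sense where row
`j` has one. Columns outside `S` have none and contribute nothing. -/
theorem posMat_chevNat_mul [Fintype F] {i j : Fin n} (hij : Adjacent i j) (m : Fin n → ℕ)
    (B : Matrix (Fin n) (Fin n) ℕ)
    (hm : ∀ a, m a + (if a = j then 1 else 0) = ∑ b, B a b)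
    (Z : Fin n → Matrix (Fin n) (Fin n) ℕ) (S : Finset (Fin n))
    (hZ : ∀ p ∈ S, B + Matrix.single i p 1 = Z p + Matrix.single j p 1)
    (hS : ∀ p ∉ S, B j p = 0) :
    posMat F d (chevNat i j m) * posMat F d B =
      ∑ p ∈ S, chevEval (Fintype.card F) i j p (Z p) • posMat F d (Z p) := by
  classical
  ext f h
  rw [posMat_mul_apply, isStructurePoly_iff.1 (isStructurePoly_chevNat hij m B (relPos f h) hm) F d
    f h rfl, eval_finsetSum, Matrix.sum_apply, ← Finset.sum_subset (Finset.subset_univ S)]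
  · refine Finset.sum_congr rfl fun p hp => ?_
    rw [Matrix.smul_apply, posMat, hZ p hp]
    by_cases h1 : relPos f h = Z p
    · rw [if_pos (by rw [h1]), if_pos h1, h1]
      simp [chevEval, eval_finsetSum]
    · rw [if_neg fun h2 => h1 (add_right_cancel h2).symm, if_neg h1]
      simp
  · intro p _ hp
    rw [if_neg, eval_zero]
    intro h1
    have h2 := congrFun (congrFun h1 j) p
    have hne := hij.ne
    simp [hS p hp, hne] at h2

end Convolution

/-! ### Products with idempotents -/

section Idempotent

variable {n : ℕ}

theorem schurMul_eq_sum {ι : Type} [Fintype ι] {A B : Matrix (Fin n) (Fin n) ℕ}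
    (Z : ι → Matrix (Fin n) (Fin n) ℕ) (g : ι → ℤ[X])
    (h : ∀ (F : Type) [Field F] [Fintype F] (d : ℕ),
      posMat F d A * posMat F d B = ∑ k, (g k).eval (Fintype.card F : ℤ) • posMat F d (Z k))
    (hs : ∀ k, size (Z k) = size A) :
    schurMul A B = ∑ k, Finsupp.single (Z k)
      (v ^ ((dimA (Z k) : ℤ) - dimA A - dimA B) * aeval (v ^ 2) (g k)) := by
  classical
  ext C
  rw [schurMul_apply, (isStructurePoly_of_posMat_mul Z g h C).structurePoly_eq,
    Finsupp.finsetSum_apply, map_sum, Finset.mul_sum]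
  simp only [Finsupp.single_apply]
  split_ifs with hC
  · refine Finset.sum_congr rfl fun k _ => ?_
    by_cases hk : C = Z k
    · rw [if_pos hk, if_pos hk.symm, hk]
    · rw [if_neg hk, if_neg (Ne.symm hk), map_zero, mul_zero]
  · exact (Finset.sum_eq_zero fun k _ => if_neg fun (hk : Z k = C) => hC (hk ▸ hs k)).symm

theorem dimA_diagonal (m : Fin n → ℕ) : dimA (Matrix.diagonal m) = 0 := by
  have h := dimA_cast (Matrix.diagonal m)
  rw [toZ_diagonal, dimQ_diagonal_diagonal] at h
  exact_mod_cast h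

theorem shift_diagTheta (s : ℕ) (l : Fin n → ℤ) :
    shift s (diagTheta l) = Matrix.diagonal fun a => (l a + s).toNat := by
  ext a b
  by_cases hab : a = b
  · subst hab; simp [shift, diagTheta]
  · simp [shift, diagTheta, hab]

theorem std_diag_mul {l : Fin n → ℤ} {B : Theta n} (hl : ∀ a, ∑ b, B.1 a b = l a) :
    std (diagTheta l) * std B = std B := by
  have h : IsStableProduct (diagTheta l) B (Finsupp.single B 1) := by
    unfold IsStableProduct
    filter_upwards [eventually_pos B 0, eventually_pos (diagTheta l) 0] with s hB hl'
    have hm : ∀ a, (l a + s).toNat = ∑ b, shift s B a b := fun a => by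
      have := size_shift hB a
      rw [hl] at this
      omega
    rw [shift_diagTheta, schurMul_eq_sum (fun _ : Unit => shift s B) (fun _ => 1)
      (fun F _ _ d => by simp [posMat_diagonal_mul hm]) fun _ => by
        simp [size, ← hm, Matrix.diagonal_apply]]
    simp [dimA_diagonal]
  rw [Udot.std_mul_std, h.stdMul_eq]
  simp

theorem std_mul_diag {l : Fin n → ℤ} {B : Theta n} (hl : ∀ b, ∑ a, B.1 a b = l b) :
    std B * std (diagTheta l) = std B := by
  have h : IsStableProduct B (diagTheta l) (Finsupp.single B 1) := by
    unfold IsStableProduct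
    filter_upwards [eventually_pos B 0, eventually_pos (diagTheta l) 0] with s hB hl'
    have hm : ∀ a, (l a + s).toNat = ∑ b, shift s B b a := fun a => by
      have := shift_col_sum hB a
      rw [hl] at this
      omega
    rw [shift_diagTheta, schurMul_eq_sum (fun _ : Unit => shift s B) (fun _ => 1)
      (fun F _ _ d => by simp [posMat_mul_diagonal hm]) fun _ => rfl]
    simp [dimA_diagonal]
  rw [Udot.std_mul_std, h.stdMul_eq]
  simp

end Idempotent

/-! ### The square of a standard basis element in rank two -/

theorem shift_theta2 (s : ℕ) (a : ℤ) (b c : ℕ) (d : ℤ) :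
    shift s (theta2 a b c d) = !![(a + s).toNat, b; c, (d + s).toNat] := by
  ext r k
  fin_cases r <;> fin_cases k <;> simp [shift, theta2_val]

theorem dimA_two (a b c d : ℕ) : dimA !![a, b; c, d] = a * b + b * c + c * d := by
  simp [dimA, Fin.sum_univ_two]
  ring

variable {d : ℕ} {F : Type} [Field F]

/-- Here `A` is shifted by `t + 4`; a shift of `4` is the least for which all matrices in the
support of the square have natural entries. -/
theorem posMat_lower_raise [Fintype F] (t : ℕ) :
    posMat F d (chevNat 1 0 ![t + 5, t + 1]) * posMat F d (chevNat 0 1 ![t + 5, t + 1]) =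
      posMat F d !![t + 4, 1; 1, t + 1] +
        (∑ k ∈ Finset.range (t + 2), (Fintype.card F : ℤ) ^ k) •
          posMat F d !![t + 5, 0; 0, t + 2] := by
  rw [posMat_chevNat_mul adjacent_one_zero _ _ ?_
    ![!![t + 4, 1; 1, t + 1], !![t + 5, 0; 0, t + 2]] Finset.univ ?_ (by simp)]
  · simp [Fin.sum_univ_two, chevEval, side_one_zero_zero, side_one_zero_one]
  · intro a
    fin_cases a <;> simp [chevNat_apply]
  · intro p _
    fin_cases p <;> ext r s <;> fin_cases r <;> fin_cases s <;>
      simp [chevNat_apply]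

theorem posMat_raise_mul [Fintype F] (t : ℕ) :
    posMat F d (chevNat 0 1 ![t + 5, t + 1]) * posMat F d !![t + 4, 1; 1, t + 1] =
      (Fintype.card F * ∑ k ∈ Finset.range (t + 5), (Fintype.card F : ℤ) ^ k) •
          posMat F d (chevNat 0 1 ![t + 5, t + 1]) +
        (1 + Fintype.card F : ℤ) • posMat F d !![t + 4, 2; 1, t] := by
  rw [posMat_chevNat_mul adjacent_zero_one _ _ ?_
    ![chevNat 0 1 ![t + 5, t + 1], !![t + 4, 2; 1, t]] Finset.univ ?_ (by simp)]
  · simp [Fin.sum_univ_two, chevEval, side_zero_one_zero, side_zero_one_one, chevNat_apply,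
      Finset.sum_range_succ]
  · intro a
    fin_cases a
    all_goals simp
    all_goals omega
  · intro p _
    fin_cases p <;> ext r s <;> fin_cases r <;> fin_cases s <;>
      simp [chevNat_apply]

theorem posMat_lower_mul [Fintype F] (t : ℕ) :
    posMat F d (chevNat 1 0 ![t + 5, t + 1]) * posMat F d !![t + 4, 2; 1, t] =
      (1 + Fintype.card F : ℤ) • posMat F d !![t + 3, 2; 2, t] +
        (Fintype.card F * ∑ k ∈ Finset.range (t + 1), (Fintype.card F : ℤ) ^ k) •
          posMat F d !![t + 4, 1; 1, t + 1] := by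
  rw [posMat_chevNat_mul adjacent_one_zero _ _ ?_
    ![!![t + 3, 2; 2, t], !![t + 4, 1; 1, t + 1]] Finset.univ ?_ (by simp)]
  · simp [Fin.sum_univ_two, chevEval, side_one_zero_zero, side_one_zero_one,
      Finset.sum_range_succ _ 1]
  · intro a
    fin_cases a
    all_goals simp
    all_goals omega
  · intro p _
    fin_cases p <;> ext r s <;> fin_cases r <;> fin_cases s <;>
      simp

/-- By `posMat_lower_raise`, `A = F E - c·1` with `c` a geometric sum. Associativity gives `A² = F
(E A) - c A`, and each product on the right is one with a generator or an idempotent. -/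
theorem posMat_sq [Fintype F] (t : ℕ) (q : ℤ) (hq : q = Fintype.card F) :
    posMat F d !![t + 4, 1; 1, t + 1] * posMat F d !![t + 4, 1; 1, t + 1] =
      (1 + q) ^ 2 • posMat F d !![t + 3, 2; 2, t] +
      (q * ∑ k ∈ Finset.range (t + 5), q ^ k + (1 + q) * (q * ∑ k ∈ Finset.range (t + 1), q ^ k) -
        ∑ k ∈ Finset.range (t + 2), q ^ k) • posMat F d !![t + 4, 1; 1, t + 1] +
      (q * (∑ k ∈ Finset.range (t + 5), q ^ k) * ∑ k ∈ Finset.range (t + 2), q ^ k) •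
        posMat F d !![t + 5, 0; 0, t + 2] := by
  have hD : posMat F d !![t + 5, 0; 0, t + 2] * posMat F d !![t + 4, 1; 1, t + 1] =
      posMat F d !![t + 4, 1; 1, t + 1] := by
    have hd : (!![t + 5, 0; 0, t + 2] : Matrix (Fin 2) (Fin 2) ℕ) =
        Matrix.diagonal ![t + 5, t + 2] := by
      ext r s
      fin_cases r <;> fin_cases s <;> simp
    rw [hd, posMat_diagonal_mul]
    intro a
    fin_cases a
    all_goals simp
    all_goals omega
  have h := Matrix.mul_assoc (posMat F d (chevNat 1 0 ![t + 5, t + 1]))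
    (posMat F d (chevNat 0 1 ![t + 5, t + 1])) (posMat F d !![t + 4, 1; 1, t + 1])
  rw [posMat_lower_raise, posMat_raise_mul, Matrix.add_mul, Matrix.smul_mul, hD, Matrix.mul_add,
    Matrix.mul_smul, Matrix.mul_smul, posMat_lower_raise, posMat_lower_mul, ← hq] at h
  rw [eq_sub_of_add_eq h]
  module

/-- The structure polynomials of the square of `[[t + 4, 1], [1, t + 1]]`. -/
def sqPoly (t : ℕ) : Fin 3 → ℤ[X] :=
  ![(1 + X) ^ 2, X * ∑ k ∈ Finset.range (t + 5), X ^ k +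
      (1 + X) * (X * ∑ k ∈ Finset.range (t + 1), X ^ k) - ∑ k ∈ Finset.range (t + 2), X ^ k,
    X * (∑ k ∈ Finset.range (t + 5), X ^ k) * ∑ k ∈ Finset.range (t + 2), X ^ k]

/-- The matrices in the support of the square of `[[0, 1], [1, -3]]`. -/
def sqSupp : Fin 3 → Theta 2 := ![theta2 (-1) 2 2 (-4), theta2 0 1 1 (-3), theta2 1 0 0 (-2)]

/-- The stable structure constants of the square of `[[0, 1], [1, -3]]`. -/
def sqStable : Fin 3 → Qv[X] :=
  ![C ((v + v⁻¹) ^ 2),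
    C (v ^ 2 * (v⁻¹ ^ 2 + v ^ 4) / (v ^ 2 - 1)) -
      C (v ^ 2 * (v ^ 4 + 2 * v ^ 2 - 1) / (v ^ 2 - 1)) * X ^ 2,
    C (v ^ 6 / (v ^ 2 - 1) ^ 2) * (C (v ^ 2) - X ^ 2) * (C (v⁻¹ ^ 4) - X ^ 2)]

theorem shift_sqSupp (t : ℕ) (k : Fin 3) : shift (t + 4) (sqSupp k) =
    ![!![t + 3, 2; 2, t], !![t + 4, 1; 1, t + 1], !![t + 5, 0; 0, t + 2]] k := by
  fin_cases k <;> simp only [sqSupp, Fin.zero_eta, Fin.mk_one, Fin.reduceFinMk, Matrix.cons_val,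
    shift_theta2] <;> ext r s <;> fin_cases r <;> fin_cases s <;> simp <;> omega

/-- The exponent from `dimA` absorbs the positive powers of `v^t` in the geometric sums, so only
powers of `v' = v^(-(t+4))` remain. -/
theorem schur_sqPoly (t : ℕ) (k : Fin 3) :
    v ^ ((dimA (shift (t + 4) (sqSupp k)) : ℤ) - dimA !![t + 4, 1; 1, t + 1] -
        dimA !![t + 4, 1; 1, t + 1]) * aeval (v ^ 2) (sqPoly t k) =
      (sqStable k).eval (v⁻¹ ^ (t + 4)) := by
  have h0 := v_ne_zero
  have h1 := v_sq_sub_one_ne_zero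
  have hg : ∀ m, ∑ k ∈ Finset.range m, (v ^ 2) ^ k = ((v ^ 2) ^ m - 1) / (v ^ 2 - 1) := fun m =>
    geom_sum_eq v_sq_ne_one m
  have hz : ∀ a b : ℕ, v ^ ((a : ℤ) - (b : ℤ)) = v ^ a / v ^ b := fun a b => by
    rw [zpow_sub₀ h0, zpow_natCast, zpow_natCast]
  rw [shift_sqSupp, sub_sub, ← Nat.cast_add, hz]
  fin_cases k
  · simp only [sqPoly, sqStable, Fin.zero_eta, Matrix.cons_val, dimA_two, map_pow, map_add,
      map_one, aeval_X, eval_C, eval_add, eval_pow]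
    field_simp
    ring
  · simp only [sqPoly, sqStable, Fin.mk_one, Matrix.cons_val, dimA_two, map_pow, map_add, map_sub,
      map_mul, map_sum, map_one, aeval_X, eval_C, eval_sub, eval_mul, eval_pow, eval_X, hg,
      inv_pow]
    field_simp
    ring
  · simp only [sqPoly, sqStable, Fin.reduceFinMk, Matrix.cons_val, dimA_two, map_pow, map_add,
      map_mul, map_sum, aeval_X, eval_C, eval_sub, eval_mul, eval_pow, eval_X, hg,
      inv_pow]
    field_simp
    ring

theorem isStableProduct_sq : IsStableProduct (theta2 0 1 1 (-3)) (theta2 0 1 1 (-3))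
    (∑ k, Finsupp.single (sqSupp k) (sqStable k)) := by
  unfold IsStableProduct
  filter_upwards [Filter.eventually_ge_atTop 4] with s hs
  obtain ⟨t, rfl⟩ := Nat.exists_eq_add_of_le' hs
  have hA : shift (t + 4) (theta2 0 1 1 (-3)) = !![t + 4, 1; 1, t + 1] := shift_sqSupp t 1
  rw [hA, schurMul_eq_sum (fun k => shift (t + 4) (sqSupp k)) (sqPoly t),
    ← Finsupp.sum_finsetSum_index (by simp) (by simp)]
  · refine Finset.sum_congr rfl fun k _ => ?_
    rw [Finsupp.sum_single_index (by simp), schur_sqPoly]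
  · intro F _ _ d
    rw [posMat_sq t _ rfl, Fin.sum_univ_three]
    simp only [shift_sqSupp]
    simp [sqPoly, eval_finsetSum]
  · intro k
    rw [shift_sqSupp]
    fin_cases k <;> simp [size, Fin.sum_univ_two] <;> ring

theorem std_mul_self : std (theta2 0 1 1 (-3)) * std (theta2 0 1 1 (-3)) =
    ((v + v⁻¹) ^ 2) • std (theta2 (-1) 2 2 (-4)) - (2 * v ^ 2 + 1) • std (theta2 0 1 1 (-3)) -
      (v ^ 2 + v ^ 4) • std (theta2 1 0 0 (-2)) := by
  have h0 := v_ne_zero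
  have h1 := v_sq_sub_one_ne_zero
  rw [Udot.std_mul_std, isStableProduct_sq.stdMul_eq,
    ← Finsupp.sum_finsetSum_index (by simp) (by simp [add_smul]), Fin.sum_univ_three,
    Finsupp.sum_single_index (by simp), Finsupp.sum_single_index (by simp),
    Finsupp.sum_single_index (by simp), sub_eq_add_neg, sub_eq_add_neg, ← neg_smul, ← neg_smul]
  -- At `v' = 1` the numerators become divisible by the powers of `v² - 1` below them.
  simp only [sqStable, sqSupp, Matrix.cons_val, eval_C, eval_sub, eval_mul, eval_pow, eval_X,
    one_pow, mul_one]
  congr 3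
  · field_simp
    ring
  · field_simp
    ring

/-- `([A] - v⁻² 1_λ)²` is expanded by bilinearity, `1_λ` acting as the identity on `[A]` from both
sides. The outcome is compared with the right-hand side in standard coordinates. -/
theorem blm_mul_self : blm (theta2 0 1 1 (-3)) * blm (theta2 0 1 1 (-3)) =
    ((v + v⁻¹) ^ 2) • blm (theta2 (-1) 2 2 (-4)) -
      (2 * v⁻¹ ^ 2 + 1 + 2 * v ^ 2) • blm (theta2 0 1 1 (-3)) -
      (v⁻¹ ^ 4 + v⁻¹ ^ 2 + 2 + v ^ 2 + v ^ 4) • blm (theta2 1 0 0 (-2)) := by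
  have hrow : ∀ (a : ℤ) (b c : ℕ) (d : ℤ), a + b = 1 → c + d = -2 →
      ∀ r, ∑ s, (theta2 a b c d).1 r s = ![1, -2] r := fun a b c d h1 h2 r => by
    rw [sum_row_theta2, h1, h2]
  have h1 : std (theta2 1 0 0 (-2)) * std (theta2 0 1 1 (-3)) = std (theta2 0 1 1 (-3)) := by
    rw [theta2_eq_diagTheta, std_diag_mul (hrow _ _ _ _ (by norm_num) (by norm_num))]
  have h2 : std (theta2 1 0 0 (-2)) * std (theta2 1 0 0 (-2)) = std (theta2 1 0 0 (-2)) := by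
    nth_rewrite 1 [theta2_eq_diagTheta]
    rw [std_diag_mul (hrow _ _ _ _ (by norm_num) (by norm_num))]
  have h3 : std (theta2 0 1 1 (-3)) * std (theta2 1 0 0 (-2)) = std (theta2 0 1 1 (-3)) := by
    rw [theta2_eq_diagTheta, std_mul_diag]
    intro r
    fin_cases r <;> simp [theta2_val]
  rw [blm_sub, blm_double, blm_diag, sub_eq_add_neg (std (theta2 0 1 1 (-3))), ← neg_smul,
    Udot.add_mul', Udot.mul_add', Udot.mul_add', Udot.smul_mul', Udot.smul_mul', Udot.mul_smul',
    Udot.mul_smul', h1, h2, h3, std_mul_self]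
  refine Udot.ext' fun B => ?_
  simp only [Udot.coeff_add, Udot.coeff_sub, Udot.coeff_smul]
  have h0 := v_ne_zero
  field_simp
  ring

end

end BLM

theorem mainTheorem8 :
    (∀ n : ℕ, 2 ≤ n → ∃ A B : BLM.Theta n,
      (∃ c : BLM.Theta n →₀ BLM.Qv, BLM.blm A * BLM.blm B = c.sum fun C a => a • BLM.blm C) ∧
      ∀ c : BLM.Theta n →₀ BLM.Qv, (BLM.blm A * BLM.blm B = c.sum fun C a => a • BLM.blm C) →
        ∃ C, c C ∉ BLM.NLaurent) ∧
    BLM.blm (BLM.theta2 0 1 1 (-3)) * BLM.blm (BLM.theta2 0 1 1 (-3)) =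
      ((BLM.v + BLM.v⁻¹) ^ 2) • BLM.blm (BLM.theta2 (-1) 2 2 (-4))
      - (2 * BLM.v⁻¹ ^ 2 + 1 + 2 * BLM.v ^ 2) • BLM.blm (BLM.theta2 0 1 1 (-3))
      - (BLM.v⁻¹ ^ 4 + BLM.v⁻¹ ^ 2 + 2 + BLM.v ^ 2 + BLM.v ^ 4) •
          BLM.blm (BLM.theta2 1 0 0 (-2)) :=
  ⟨fun _ hn => BLM.exists_structure_constant_notMem_NLaurent hn, BLM.blm_mul_self⟩
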